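/- **Setting.** Let $0<r_0<r_w$, $\gamma>1$, $A,\varepsilon,\delta>0$, and let $p\in C^{2,1}([0,r_0])$ be an admissible pressure: $p\ge 0$ on $[0,r_0]$, $p(r)=0$ if and only if $r=r_0$, $p'\le 0$ near $r_0$, $-\int_0^r s^2p'(s)\,ds\ge 0$ for all $r\in[0,r_0]$, and $\lim_{r\to r_0}p(r)/p'(r)=0$. Put $$\rho=(p/A)^{1/\gamma},\qquad B_\theta(r)=\Big(-\frac{2}{r^2}\int_0^r s^2p'(s)\,ds\Big)^{1/2},\qquad \widehat B_\theta(r)=B_\theta(r_0)\frac{r_0}{r}.$$ For $m,k\in\mathbb Z$ and real functions $\xi,\eta,\zeta$ on $(0,r_0)$ let $\mathcal J(\xi,\eta,\zeta)=2\pi^2\int_0^{r_0}\rho(\xi^2+\eta^2+\zeta^2)\,r\,dr$, $$\begin{aligned}G_{m,k}^{\alpha}&=\alpha\Big(-2\xi'+\tfrac{\xi}{r}+\tfrac{m}{r}\zeta-k\eta\Big)^2+\alpha\Big(\xi'-\tfrac{2\xi}{r}-\tfrac{2m}{r}\zeta-k\eta\Big)^2+\alpha\Big(\xi'+\tfrac{\xi}{r}+\tfrac{m}{r}\zeta+2k\eta\Big)^2\\&\quad+\Big(-\zeta'+\tfrac{\zeta}{r}+\tfrac{m}{r}\xi\Big)^2+(\eta'+k\xi)^2+\Big(\tfrac{m}{r}\eta-k\zeta\Big)^2,\end{aligned}$$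 $$D_{m,k}=2\pi^2\int_0^{r_0}\Big[\varepsilon\, G_{m,k}^{2/9}+\delta\Big(\xi'+\tfrac{\xi}{r}+\tfrac{m}{r}\zeta-k\eta\Big)^2\Big]r\,dr .$$ Let $X_k$ (for $m=0$) be the completion of the triples in $C^\infty([0,r_0])^3$ with $\xi(0)=\zeta(0)=0$, and $Y_{m,k}$ (for $m\ne0$) the completion of those with $\xi(0)=\eta(0)=\zeta(0)=0$, for the norm whose square is $\int_0^{r_0}\big[G^{1}_{m,k}+(\xi'+\frac{\xi}{r}+\frac{m}{r}\zeta-k\eta)^2+\rho(\xi^2+\eta^2+\zeta^2)\big]r\,dr$. For $s>0$ let $$E_{0,k}(\xi,\eta,\zeta;s)=2\pi^2\int_0^{r_0}\Big\{\frac{2p'\xi^2}{r}+B_\theta^2\Big[k\eta-\frac1r\big((r\xi)'-2\xi\big)\Big]^2+\gamma p\Big[\frac1r(r\xi)'-k\eta\Big]^2\Big\}r\,dr+s\,D_{0,k},$$ and, for $m\neq 0$, $$\begin{aligned}E_{m,k}(\xi,\eta,\zeta,\widehat Q_r;s)&=2\pi^2\int_0^{r_0}\Big\{(m^2+k^2r^2)\Big[\frac{B_\theta}{r}\eta+\frac{-kB_\theta(r\xi)'+2kB_\theta\xi}{m^2+k^2r^2}\Big]^2+\gamma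 p\Big[\frac1r(r\xi)'-k\eta+\frac{m\zeta}{r}\Big]^2\Big\}r\,dr+s\,D_{m,k}\\&\quad+2\pi^2\int_0^{r_0}\frac{m^2B_\theta^2}{r(m^2+k^2r^2)}(\xi-r\xi')^2dr+2\pi^2\int_0^{r_0}\Big[2p'+\frac{m^2B_\theta^2}{r}\Big]\xi^2dr\\&\quad+2\pi^2\int_{r_0}^{r_w}\Big[\widehat Q_r^2+\frac{1}{m^2+k^2r^2}\big((r\widehat Q_r)'\big)^2\Big]r\,dr.\end{aligned}$$ Let $\lambda_{0,k}(s)$ be the infimum of $E_{0,k}(\cdot;s)$ over $\{(\xi,\eta,\zeta)\in X_k:\mathcal J=1\}$, and for $m\neq0$ let $\lambda_{m,k}(s)$ be the infimum of $E_{m,k}(\cdot;s)$ over all $((\xi,\eta,\zeta),\widehat Q_r)\in Y_{m,k}\times H^1(r_0,r_w)$ with $\mathcal J=1$, $m\widehat B_\theta\xi=r\widehat Q_r$ at $r=r_0$, and $\widehat Q_r(r_w)=0$. Put $\mathcal S_{m,k}=\{s>0:\lambda_{m,k}(s)<0\}$ and $\mu_{m,k}(s)=\sqrt{-\lambda_{m,k}(s)}$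 for $s\in\mathcal S_{m,k}$. Call $(m,k)$ *unstable* if $\mathcal S_{m,k}\neq\emptyset$. **Proposition 4.3.** 1. For all $m,k\in\mathbb Z$ and $s>0$, the set over which the infimum is taken is non-empty and $\lambda_{m,k}(s)>-\infty$. Every mode $(0,k)$ with $k\ne0$ is unstable. 2. For every unstable mode $(m,k)$ there is exactly one $s=s_{m,k}\in\mathcal S_{m,k}$ with $\mu_{m,k}(s)=s$. It is called the growth rate of the mode, and $\mu_{m,k}:=\mu_{m,k}(s_{m,k})=s_{m,k}>0$. 3. Over the unstable modes, $\mu_{m,k}=s_{m,k}\to0$ as $|m|\to\infty$ or $|k|\to\infty$: for each $c>0$ there is $N$ such that $s_{m,k}<c$ whenever $(m,k)$ is unstable and $|m|\ge N$ or $|k|\ge N$. In particular, for each $c>0$ only finitely many unstable modes have $s_{m,k}\ge c$. 4. There is a largest growing mode: $\Lambda=\max\{s_{m,k}:(m,k)\text{ unstable}\}$ exists and $0<\Lambda<\infty$. At some unstable mode $(m,k)$ with $s_{m,k}=\Lambda$, the infimum $\lambda_{m,k}(\Lambda)=-\Lambda^2$ is attained. -/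

import Mathlib

open Set Filter Topology MeasureTheory
open scoped NNReal ENNReal ContDiff

noncomputable section

/-- The data of a viscous z-pinch: the plasma radius `r₀`, the wall radius `rw`, the adiabatic
exponent `γ`, the entropy constant `A` of the law `p = A ρ ^ γ`, the dynamic viscosity `ε`, the
bulk viscosity `δ` and the equilibrium pressure `p`, of which only the values on `[0, r₀]`
are used. -/
structure ZPinch where
  r₀ : ℝ
  rw : ℝ
  γ : ℝ
  A : ℝ
  ε : ℝ
  δ : ℝ
  p : ℝ → ℝ

/-- Three real functions `(ξ, η, ζ)` of the radius: for a normal mode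
`(g_r, g_θ, g_z) exp (μ t + i (m θ + k z))`, `ξ = g_r`, `η = - i g_z`, `ζ = i g_θ`. -/
structure Disp where
  ξ : ℝ → ℝ
  η : ℝ → ℝ
  ζ : ℝ → ℝ

/-- Componentwise difference. -/
def Disp.sub (u v : Disp) : Disp :=
  ⟨fun r => u.ξ r - v.ξ r, fun r => u.η r - v.η r, fun r => u.ζ r - v.ζ r⟩

namespace ZPinch

variable (P : ZPinch)

/-- The derivative `p'` on `[0, r₀]` (one-sided at the end points). -/
def dp (r : ℝ) : ℝ := derivWithin P.p (Icc 0 P.r₀) r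

/-- The standing assumptions: the ranges of the constants, and admissibility of the pressure. -/
structure Admissible : Prop where
  r₀_pos : 0 < P.r₀
  r₀_lt_rw : P.r₀ < P.rw
  one_lt_γ : 1 < P.γ
  A_pos : 0 < P.A
  ε_pos : 0 < P.ε
  δ_pos : 0 < P.δ
  /-- `p` is of class `C^{2,1}` on `[0, r₀]`. -/
  p_contDiffOn : ContDiffOn ℝ 2 P.p (Icc 0 P.r₀)
  p_lipschitz : ∃ K : ℝ≥0,
    LipschitzOnWith K (iteratedDerivWithin 2 P.p (Icc 0 P.r₀)) (Icc 0 P.r₀)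
  p_nonneg : ∀ r ∈ Icc 0 P.r₀, 0 ≤ P.p r
  p_eq_zero_iff : ∀ r ∈ Icc 0 P.r₀, (P.p r = 0 ↔ r = P.r₀)
  dp_nonpos : ∃ ϵ > 0, ∀ r ∈ Ioc (P.r₀ - ϵ) P.r₀, P.dp r ≤ 0
  integral_nonneg : ∀ r ∈ Icc 0 P.r₀, 0 ≤ -∫ s in (0 : ℝ)..r, s ^ 2 * P.dp s
  /-- `p / p' → 0` as `r → r₀` from inside, written without a quotient. -/
  p_littleO : P.p =o[𝓝[<] P.r₀] P.dp

/-- Equilibrium density `ρ = (p / A) ^ (1 / γ)`. -/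
def ρ (r : ℝ) : ℝ := (P.p r / P.A) ^ (1 / P.γ)

/-- Equilibrium azimuthal field `B_θ` in the plasma. -/
def Bθ (r : ℝ) : ℝ := Real.sqrt (-(2 / r ^ 2) * ∫ s in (0 : ℝ)..r, s ^ 2 * P.dp s)

/-- Equilibrium azimuthal field in the vacuum. -/
def Bvac (r : ℝ) : ℝ := P.Bθ P.r₀ * P.r₀ / r

/-! ### The weighted Sobolev spaces -/

/-- The square of the norm of `X_k` (for `m = 0`) and of `Y_{m,k}` (for `m ≠ 0`), as an extended
nonnegative number. -/
def normSq (m k : ℤ) (u : Disp) : ℝ≥0∞ :=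
  ∫⁻ r in Ioo 0 P.r₀, ENNReal.ofReal
    (((-2 * deriv u.ξ r + u.ξ r / r + m / r * u.ζ r - k * u.η r) ^ 2
      + (deriv u.ξ r - 2 * u.ξ r / r - 2 * m / r * u.ζ r - k * u.η r) ^ 2
      + (deriv u.ξ r + u.ξ r / r + m / r * u.ζ r + 2 * k * u.η r) ^ 2
      + (-deriv u.ζ r + u.ζ r / r + m / r * u.ξ r) ^ 2
      + (deriv u.η r + k * u.ξ r) ^ 2
      + (m / r * u.η r - k * u.ζ r) ^ 2
      + (deriv u.ξ r + u.ξ r / r + m / r * u.ζ r - k * u.η r) ^ 2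
      + P.ρ r * (u.ξ r ^ 2 + u.η r ^ 2 + u.ζ r ^ 2)) * r)

/-- The smooth triples on `[0, r₀]` whose completion is taken: `ξ` and `ζ` vanish at `0`, and for
`m ≠ 0` also `η`. -/
def SmoothCore (m : ℤ) (u : Disp) : Prop :=
  ContDiffOn ℝ ∞ u.ξ (Icc 0 P.r₀) ∧ ContDiffOn ℝ ∞ u.η (Icc 0 P.r₀) ∧
    ContDiffOn ℝ ∞ u.ζ (Icc 0 P.r₀) ∧
    u.ξ 0 = 0 ∧ u.ζ 0 = 0 ∧ (m ≠ 0 → u.η 0 = 0)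

/-- `f` is absolutely continuous on every compact subinterval of `(0, r₀]`. -/
def LocAC (f : ℝ → ℝ) : Prop :=
  ∀ a ∈ Ioo 0 P.r₀, AbsolutelyContinuousOnInterval f a P.r₀

/-- The space `X_k` (for `m = 0`) or `Y_{m,k}` (for `m ≠ 0`), the completion of the smooth core
for the norm above, realized as a space of functions. The norm controls `H¹` on each `[a, r₀]` with
`0 < a < r₀`, so an element of the completion is a triple of functions that are absolutely
continuous on compact subintervals of `(0, r₀]` (this fixes the values on `(0, r₀]`, in
particular the trace at `r₀`, and the weak derivative is `deriv` almost everywhere) and that is a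
limit of elements of the core in the norm. -/
def Space (m k : ℤ) : Set Disp :=
  {u | P.LocAC u.ξ ∧ P.LocAC u.η ∧ P.LocAC u.ζ ∧
    ∃ v : ℕ → Disp, (∀ n, P.SmoothCore m (v n)) ∧
      Tendsto (fun n => P.normSq m k (u.sub (v n))) atTop (𝓝 0)}

/-- `H¹(r₀, rw)`, through absolutely continuous representatives on `[r₀, rw]`. -/
def VacuumH1 : Set (ℝ → ℝ) :=
  {Q | AbsolutelyContinuousOnInterval Q P.r₀ P.rw ∧
    MemLp (deriv Q) 2 (volume.restrict (Ioo P.r₀ P.rw))}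

/-! ### The functionals -/

/-- The constraint functional `𝒥`. -/
def J (u : Disp) : ℝ :=
  2 * Real.pi ^ 2 * ∫ r in (0 : ℝ)..P.r₀, P.ρ r * (u.ξ r ^ 2 + u.η r ^ 2 + u.ζ r ^ 2) * r

/-- The viscous dissipation `D_{m,k}`. -/
def dissipation (m k : ℤ) (u : Disp) : ℝ :=
  2 * Real.pi ^ 2 * (∫ r in (0 : ℝ)..P.r₀, P.ε *
      (2 / 9 * (-2 * deriv u.ξ r + u.ξ r / r + m / r * u.ζ r - k * u.η r) ^ 2
      + 2 / 9 * (deriv u.ξ r - 2 * u.ξ r / r - 2 * m / r * u.ζ r - k * u.η r) ^ 2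
      + 2 / 9 * (deriv u.ξ r + u.ξ r / r + m / r * u.ζ r + 2 * k * u.η r) ^ 2
      + (-deriv u.ζ r + u.ζ r / r + m / r * u.ξ r) ^ 2
      + (deriv u.η r + k * u.ξ r) ^ 2
      + (m / r * u.η r - k * u.ζ r) ^ 2) * r)
  + 2 * Real.pi ^ 2 * ∫ r in (0 : ℝ)..P.r₀, P.δ *
      (deriv u.ξ r + u.ξ r / r + m / r * u.ζ r - k * u.η r) ^ 2 * r

/-- The modified energy `E_{0,k}(ξ, η, ζ; s)` for `m = 0`, with viscosities `s ε` and `s δ`. -/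
def energyZero (k : ℤ) (s : ℝ) (u : Disp) : ℝ :=
  2 * Real.pi ^ 2 * (∫ r in (0 : ℝ)..P.r₀,
      (2 * P.dp r * u.ξ r ^ 2 / r
      + P.Bθ r ^ 2 * (k * u.η r - 1 / r * (deriv (fun x => x * u.ξ x) r - 2 * u.ξ r)) ^ 2
      + P.γ * P.p r * (1 / r * deriv (fun x => x * u.ξ x) r - k * u.η r) ^ 2) * r)
  + s * P.dissipation 0 k u

/-- The modified energy `E_{m,k}(ξ, η, ζ, Q_r; s)` for `m ≠ 0`, with viscosities `s ε` and
`s δ`. -/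
def energyNonzero (m k : ℤ) (s : ℝ) (u : Disp) (Q : ℝ → ℝ) : ℝ :=
  2 * Real.pi ^ 2 * (∫ r in (0 : ℝ)..P.r₀,
      ((m ^ 2 + k ^ 2 * r ^ 2) * (P.Bθ r / r * u.η r
          + (-k * P.Bθ r * deriv (fun x => x * u.ξ x) r + 2 * k * P.Bθ r * u.ξ r)
            / (m ^ 2 + k ^ 2 * r ^ 2)) ^ 2
      + P.γ * P.p r
          * (1 / r * deriv (fun x => x * u.ξ x) r - k * u.η r + m * u.ζ r / r) ^ 2) * r)
  + s * P.dissipation m k u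
  + 2 * Real.pi ^ 2 * (∫ r in (0 : ℝ)..P.r₀,
      m ^ 2 * P.Bθ r ^ 2 / (r * (m ^ 2 + k ^ 2 * r ^ 2)) * (u.ξ r - r * deriv u.ξ r) ^ 2)
  + 2 * Real.pi ^ 2 * (∫ r in (0 : ℝ)..P.r₀,
      (2 * P.dp r + m ^ 2 * P.Bθ r ^ 2 / r) * u.ξ r ^ 2)
  + 2 * Real.pi ^ 2 * (∫ r in P.r₀..P.rw,
      (Q r ^ 2 + 1 / (m ^ 2 + k ^ 2 * r ^ 2) * deriv (fun x => x * Q x) r ^ 2) * r)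

/-! ### The constrained minimization and the growth rates -/

/-- The constraint set `𝒜₁` for `m = 0`. -/
def constraintZero (k : ℤ) : Set Disp := {u | u ∈ P.Space 0 k ∧ P.J u = 1}

/-- The constraint set `𝒜₂` for `m ≠ 0`. -/
def constraintNonzero (m k : ℤ) : Set (Disp × (ℝ → ℝ)) :=
  {w | w.1 ∈ P.Space m k ∧ w.2 ∈ P.VacuumH1 ∧ P.J w.1 = 1 ∧
    m * P.Bvac P.r₀ * w.1.ξ P.r₀ = P.r₀ * w.2 P.r₀ ∧ w.2 P.rw = 0}

/-- The values of the modified energy on the constraint set of the mode `(m, k)`. -/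
def energyValues (m k : ℤ) (s : ℝ) : Set ℝ :=
  if m = 0 then P.energyZero k s '' P.constraintZero k
  else (fun w => P.energyNonzero m k s w.1 w.2) '' P.constraintNonzero m k

/-- `λ_{m,k}(s)`, the infimum of the modified energy on the constraint set. -/
def lowest (m k : ℤ) (s : ℝ) : ℝ := sInf (P.energyValues m k s)

/-- `μ_{m,k}(s) = √(-λ_{m,k}(s))`. -/
def μ (m k : ℤ) (s : ℝ) : ℝ := Real.sqrt (-P.lowest m k s)

/-- The set `𝒮_{m,k}` of the parameters `s > 0` with `λ_{m,k}(s) < 0`. -/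
def negSet (m k : ℤ) : Set ℝ := {s | 0 < s ∧ P.lowest m k s < 0}

/-- `s` is a growth rate of the mode `(m, k)`: it lies in `𝒮_{m,k}` and `μ_{m,k}(s) = s`. -/
def IsGrowthRate (m k : ℤ) (s : ℝ) : Prop := s ∈ P.negSet m k ∧ P.μ m k s = s

end ZPinch

end

/-! ### Weighted one-dimensional Sobolev estimates -/

/-! Write the energy of a mode as I + sD + V, with I the ideal plasma part, D the dissipation and V
≥ 0 the vacuum part (zero for m = 0). The only term of I that can be negative is 2p'ξ², so I ≥ -M ∫
ξ² dr with M independent of the mode (`le_idealDens`). The dissipation dominates the integrated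
squared strain T, because the bulk viscosity restores the trace that the deviatoric squares miss
(`le_dissDens`). Everything then rests on comparing ∫ ξ² dr with T and the kinetic integral K.

T contains ∫ ξ'² r dr, which gives ξ a modulus of continuity in log r. As log is integrable, the
mass of ξ² near 0 and near r₀ is small relative to T, up to a multiple of its interior mass; in the
interior ρ r is bounded below. Hence ∫ ξ² ≤ δT + C_δ K uniformly in (m, k)
(`exists_integral_sq_zero_le`), and the energy is bounded below at fixed K. For large |k| or |m| the
strain components η' + kξ and -ζ' + ζ/r + mξ/r give more: multiplied by a cutoff times ξ and
integrated by parts, they bound |k| ∫ χξ² and |m| ∫ χξ² by a multiple of T + K, so the constant in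
front of K becomes small as well (`exists_integral_sq_zero_le_of_large`).

As a function of s, λ is an infimum of affine functions with slopes D ≥ 0, hence concave, continuous
and nondecreasing. So λ(s) + s² is strictly increasing, and it has exactly one zero if λ is negative
somewhere (`existsUnique_sqrt_neg_eq`). A growth rate s ≥ c at a large mode would contradict λ(s) =
-s², since the refined estimate gives λ(s) > -c². Therefore the rates decay, finitely many lie above
any positive level, and a maximum exists as soon as one mode is unstable. For m = 0 and k ≠ 0 the
choice ξ = rφ, η = rφ'/k annihilates the magnetic square and leaves ∫ φ² r (2rp' + 4γp) dr, which is
negative for φ supported near r₀ because p/p' → 0 (`exists_idealInt_neg`); a small s keeps the sign.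

Attainment is the direct method for quadratic forms (`exists_minimizer`). Along a minimizing
sequence a subsequence of ξ is Cauchy in L², by the logarithmic estimate; the parallelogram law and
λ < 0 upgrade this to Cauchy in the full norm. Completeness supplies the limit, and the interface
condition survives because the values at r₀ converge (`exists_pairs_tendsto`). -/

theorem intervalIntegrable_one_div_of_pos {x y : ℝ} (hx : 0 < x) (hxy : x ≤ y) :
    IntervalIntegrable (fun r : ℝ => 1 / r) volume x y := by
  apply ContinuousOn.intervalIntegrable
  rw [uIcc_of_le hxy]
  exact continuousOn_const.div continuousOn_id fun r hr => (hx.trans_le hr.1).ne'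

/-- Cauchy-Schwarz for f' = (f' √r)(1/√r), the logarithm being ∫ dr/r. It is derived from the
discriminant of t ↦ ∫ (t f' r + 1)² / r, a nonnegative quadratic polynomial. -/
theorem AbsolutelyContinuousOnInterval.sq_sub_le_log_mul {f : ℝ → ℝ} {x y : ℝ} (hx : 0 < x)
    (hxy : x ≤ y) (hf : AbsolutelyContinuousOnInterval f x y)
    (hK : IntervalIntegrable (fun r => deriv f r ^ 2 * r) volume x y) :
    (f y - f x) ^ 2 ≤ (Real.log y - Real.log x) * ∫ r in x..y, deriv f r ^ 2 * r := by
  have h1 := intervalIntegrable_one_div_of_pos hx hxy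
  have h2 := hf.intervalIntegrable_deriv
  have h3 : ∫ r in x..y, 1 / r = Real.log y - Real.log x := by
    rw [integral_one_div_of_pos hx (hx.trans_le hxy),
      Real.log_div (hx.trans_le hxy).ne' hx.ne']
  have key : ∀ t : ℝ, 0 ≤ (∫ r in x..y, deriv f r ^ 2 * r) * (t * t) + (2 * (f y - f x)) * t
      + (Real.log y - Real.log x) := by
    intro t
    have h4 : ∫ r in x..y, (t * deriv f r * r + 1) ^ 2 / r
        = (∫ r in x..y, deriv f r ^ 2 * r) * (t * t) + (2 * (f y - f x)) * t
          + (Real.log y - Real.log x) := by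
      rw [← h3, ← hf.integral_deriv_eq_sub]
      have h5 : ∫ r in x..y, (t * deriv f r * r + 1) ^ 2 / r
          = ∫ r in x..y, ((t * t) * (deriv f r ^ 2 * r) + (2 * t) * deriv f r + 1 / r) := by
        apply intervalIntegral.integral_congr
        intro r hr
        rw [uIcc_of_le hxy] at hr
        have : r ≠ 0 := (hx.trans_le hr.1).ne'
        simp only
        field_simp
        ring
      rw [h5, intervalIntegral.integral_add ((hK.const_mul _).add (h2.const_mul _)) h1,
        intervalIntegral.integral_add (hK.const_mul _) (h2.const_mul _),
        intervalIntegral.integral_const_mul, intervalIntegral.integral_const_mul]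
      ring
    rw [← h4]
    apply intervalIntegral.integral_nonneg hxy
    intro r hr
    have : 0 < r := hx.trans_le hr.1
    positivity
  have := discrim_le_zero key
  unfold discrim at this
  nlinarith

section

variable {R : ℝ} {f : ℝ → ℝ}

theorem sq_sub_le_abs_log_mul (hf : ∀ a ∈ Ioo 0 R, AbsolutelyContinuousOnInterval f a R)
    (hK : IntervalIntegrable (fun r => deriv f r ^ 2 * r) volume 0 R) {x y : ℝ}
    (hx : x ∈ Ioc 0 R) (hy : y ∈ Ioc 0 R) :
    (f y - f x) ^ 2 ≤ |Real.log y - Real.log x| * ∫ r in (0 : ℝ)..R, deriv f r ^ 2 * r := by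
  wlog hxy : x ≤ y generalizing x y
  · rw [abs_sub_comm, ← neg_sub (f x), neg_sq]
    exact this hy hx (le_of_not_ge hxy)
  rcases eq_or_lt_of_le hxy with rfl | hlt
  · simp
  have hx' : x ∈ Ioo 0 R := ⟨hx.1, hlt.trans_le hy.2⟩
  have hsub : uIcc x y ⊆ uIcc x R := by
    rw [uIcc_of_le hxy, uIcc_of_le hx.2]
    exact Icc_subset_Icc_right hy.2
  have hsub' : uIcc x y ⊆ uIcc 0 R := by
    rw [uIcc_of_le hxy, uIcc_of_le (hx.1.le.trans hx.2)]
    exact Icc_subset_Icc hx.1.le hy.2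
  have hK' := hK.mono_set hsub'
  refine (((hf x hx').mono hsub).sq_sub_le_log_mul hx.1 hxy hK').trans ?_
  rw [abs_of_nonneg (sub_nonneg.2 (Real.log_le_log hx.1 hxy))]
  apply mul_le_mul_of_nonneg_left _ (sub_nonneg.2 (Real.log_le_log hx.1 hxy))
  apply intervalIntegral.integral_mono_interval hx.1.le hxy hy.2 _ hK
  filter_upwards [ae_restrict_mem measurableSet_Ioc] with r hr
  have : 0 < r := hr.1
  positivity

theorem continuousOn_of_locAC (hf : ∀ a ∈ Ioo 0 R, AbsolutelyContinuousOnInterval f a R) :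
    ContinuousOn f (Ioc 0 R) := by
  intro x hx
  have ha : x / 2 ∈ Ioo 0 R := ⟨by linarith [hx.1], by linarith [hx.1, hx.2]⟩
  have h1 := (hf _ ha).continuousOn x (by
    rw [uIcc_of_le ha.2.le]; exact ⟨by linarith [hx.1], hx.2⟩)
  rw [uIcc_of_le ha.2.le] at h1
  refine h1.mono_of_mem_nhdsWithin ?_
  rw [mem_nhdsWithin]
  exact ⟨Ioi (x / 2), isOpen_Ioi, half_lt_self hx.1, fun y hy => ⟨le_of_lt hy.1, hy.2.2⟩⟩

theorem ae_differentiableAt_of_locAC (hf : ∀ a ∈ Ioo 0 R, AbsolutelyContinuousOnInterval f a R) :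
    ∀ᵐ r ∂volume.restrict (Ioo 0 R), DifferentiableAt ℝ f r := by
  rcases le_or_gt R 0 with hR | hR
  · simp [Ioo_eq_empty (not_lt.2 hR)]
  -- The intervals [R/(n+2), R] exhaust (0, R]; the shift by 2 keeps the left end strictly inside
  -- (0, R) also for n = 0.
  have h1 : ∀ n : ℕ, ∀ᵐ r, r ∈ uIcc (R / (n + 2)) R → DifferentiableAt ℝ f r := by
    intro n
    apply (hf _ _).ae_differentiableAt
    refine ⟨by positivity, ?_⟩
    rw [div_lt_iff₀ (by positivity)]
    nlinarith [(Nat.cast_nonneg n : (0 : ℝ) ≤ n)]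
  rw [ae_restrict_iff' measurableSet_Ioo]
  filter_upwards [ae_all_iff.2 h1] with r hr hr'
  obtain ⟨n, hn⟩ := exists_nat_gt (R / r)
  apply hr n
  have hle : R / (n + 2) ≤ r := by
    rw [div_le_iff₀ (by positivity)]
    rw [div_lt_iff₀ hr'.1] at hn
    nlinarith [hr'.1]
  rw [uIcc_of_le (hle.trans hr'.2.le)]
  exact ⟨hle, hr'.2.le⟩

theorem intervalIntegrable_sq_of_locAC (hf : ∀ a ∈ Ioo 0 R, AbsolutelyContinuousOnInterval f a R)
    {a b : ℝ} (ha : 0 < a) (hab : a ≤ b) (hb : b ≤ R) :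
    IntervalIntegrable (fun r => f r ^ 2) volume a b := by
  apply ContinuousOn.intervalIntegrable
  rw [uIcc_of_le hab]
  exact ((continuousOn_of_locAC hf).mono fun r hr => ⟨ha.trans_le hr.1, hr.2.trans hb⟩).pow 2

/-- Averaging f(x)² ≤ 2f(y)² + 2(f(x) - f(y))² over y in [a, b] trades the unknown value f(y) for an
interior mass. The only singularity left in x is |log x|, which is integrable. -/
theorem sq_le_average_add (hf : ∀ a ∈ Ioo 0 R, AbsolutelyContinuousOnInterval f a R)
    (hK : IntervalIntegrable (fun r => deriv f r ^ 2 * r) volume 0 R) {a b : ℝ}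
    (ha : 0 < a) (hab : a < b) (hb : b ≤ R) {x : ℝ} (hx : x ∈ Ioc 0 R) :
    f x ^ 2 ≤ 2 / (b - a) * (∫ r in a..b, f r ^ 2)
      + 2 * (|Real.log x| + (|Real.log a| + |Real.log b|))
        * ∫ r in (0 : ℝ)..R, deriv f r ^ 2 * r := by
  set K := ∫ r in (0 : ℝ)..R, deriv f r ^ 2 * r with hKdef
  have hK0 : 0 ≤ K := by
    apply intervalIntegral.integral_nonneg (hx.1.le.trans hx.2)
    intro r hr
    have := hr.1
    positivity
  have h1 : ∀ y ∈ Icc a b, f x ^ 2 ≤ 2 * f y ^ 2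
      + 2 * (|Real.log x| + (|Real.log a| + |Real.log b|)) * K := by
    intro y hy
    have hy' : y ∈ Ioc 0 R := ⟨ha.trans_le hy.1, hy.2.trans hb⟩
    have h2 := sq_sub_le_abs_log_mul hf hK hy' hx
    have h3 : |Real.log x - Real.log y| ≤ |Real.log x| + (|Real.log a| + |Real.log b|) := by
      have h4 := Real.log_le_log ha hy.1
      have h5 := Real.log_le_log (ha.trans_le hy.1) hy.2
      have h6 : |Real.log y| ≤ |Real.log a| + |Real.log b| := by
        rw [abs_le]
        constructor
        · linarith [neg_abs_le (Real.log a), abs_nonneg (Real.log b)]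
        · linarith [le_abs_self (Real.log b), abs_nonneg (Real.log a)]
      linarith [abs_sub (Real.log x) (Real.log y)]
    have h7 := mul_le_mul_of_nonneg_right h3 hK0
    nlinarith [sq_nonneg (f x - 2 * f y)]
  have h2 : ∫ y in a..b, f x ^ 2 ≤ ∫ y in a..b, (2 * f y ^ 2
      + 2 * (|Real.log x| + (|Real.log a| + |Real.log b|)) * K) := by
    apply intervalIntegral.integral_mono_on hab.le (by simp) _ h1
    exact ((intervalIntegrable_sq_of_locAC hf ha hab.le hb).const_mul 2).add (by simp)
  rw [intervalIntegral.integral_add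
    ((intervalIntegrable_sq_of_locAC hf ha hab.le hb).const_mul 2) (by simp),
    intervalIntegral.integral_const, intervalIntegral.integral_const,
    intervalIntegral.integral_const_mul, smul_eq_mul, smul_eq_mul] at h2
  have hba : 0 < b - a := sub_pos.2 hab
  rw [show 2 / (b - a) * (∫ r in a..b, f r ^ 2)
      + 2 * (|Real.log x| + (|Real.log a| + |Real.log b|)) * K
      = (2 * (∫ r in a..b, f r ^ 2)
        + (b - a) * (2 * (|Real.log x| + (|Real.log a| + |Real.log b|)) * K)) / (b - a) by
    field_simp, le_div_iff₀ hba]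
  linarith

theorem aestronglyMeasurable_of_locAC
    (hf : ∀ a ∈ Ioo 0 R, AbsolutelyContinuousOnInterval f a R) :
    AEStronglyMeasurable f (volume.restrict (Ioo 0 R)) :=
  ((continuousOn_of_locAC hf).mono Ioo_subset_Ioc_self).aestronglyMeasurable measurableSet_Ioo

theorem intervalIntegrable_abs_log_add (c : ℝ) :
    IntervalIntegrable (fun r => |Real.log r| + c) volume 0 R :=
  intervalIntegral.intervalIntegrable_log'.abs.add (by simp)

theorem intervalIntegrable_sq_of_deriv (hR : 0 < R)
    (hf : ∀ a ∈ Ioo 0 R, AbsolutelyContinuousOnInterval f a R)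
    (hK : IntervalIntegrable (fun r => deriv f r ^ 2 * r) volume 0 R) :
    IntervalIntegrable (fun r => f r ^ 2) volume 0 R := by
  set c := |Real.log (R / 3)| + |Real.log (R / 2)|
  have h1 := (intervalIntegrable_const (μ := volume) (a := 0) (b := R)
    (c := 2 / (R / 2 - R / 3) * (∫ r in (R / 3)..(R / 2), f r ^ 2))).add
    (((intervalIntegrable_abs_log_add (R := R) c).const_mul 2).mul_const
      (∫ r in (0 : ℝ)..R, deriv f r ^ 2 * r))
  rw [intervalIntegrable_iff_integrableOn_Ioo_of_le hR.le] at h1 ⊢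
  refine Integrable.mono h1 ((aestronglyMeasurable_of_locAC hf).pow 2) ?_
  filter_upwards [ae_restrict_mem measurableSet_Ioo] with x hx
  rw [Real.norm_of_nonneg (sq_nonneg _)]
  refine le_trans ?_ (Real.le_norm_self _)
  exact sq_le_average_add hf hK (by positivity) (by linarith) (by linarith) ⟨hx.1, hx.2.le⟩

/-- The mass of `f ^ 2` near the two end points is small relative to the weighted Dirichlet
integral. -/
theorem exists_integral_sq_le {δ : ℝ} (hR : 0 < R) (hδ : 0 < δ) :
    ∃ a b C : ℝ, 0 < a ∧ a < b ∧ b < R ∧ 0 ≤ C ∧ ∀ f : ℝ → ℝ,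
      (∀ a ∈ Ioo 0 R, AbsolutelyContinuousOnInterval f a R) →
      IntervalIntegrable (fun r => deriv f r ^ 2 * r) volume 0 R →
      ∫ r in (0 : ℝ)..R, f r ^ 2 ≤
        δ * (∫ r in (0 : ℝ)..R, deriv f r ^ 2 * r) + C * ∫ r in a..b, f r ^ 2 := by
  set c := |Real.log (R / 3)| + |Real.log (R / 2)| with hc
  set g : ℝ → ℝ := fun r => |Real.log r| + c with hg
  have hgi : ∀ x y, IntervalIntegrable g volume x y := fun x y =>
    intervalIntegral.intervalIntegrable_log'.abs.add (by simp)
  set G : ℝ → ℝ := fun x => ∫ r in (0 : ℝ)..x, g r with hG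
  have hGc : Continuous G := intervalIntegral.continuous_primitive hgi 0
  -- The primitive of the logarithmic weight is continuous, so the weight of the two edge strips of
  -- width h tends to zero with h.
  have h1 : Tendsto (fun h => G h + (G R - G (R - h))) (𝓝[>] 0) (𝓝 0) := by
    have : Continuous (fun h => G h + (G R - G (R - h))) := by fun_prop
    have h2 := this.tendsto 0
    simp only [sub_zero, sub_self, add_zero] at h2
    rw [show G 0 = 0 by simp [hG]] at h2
    exact h2.mono_left nhdsWithin_le_nhds
  have h2 : ∀ᶠ h in 𝓝[>] (0 : ℝ), G h + (G R - G (R - h)) < δ / 2 :=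
    h1.eventually (gt_mem_nhds (by positivity))
  have h3 : ∀ᶠ h in 𝓝[>] (0 : ℝ), h < R / 3 :=
    (gt_mem_nhds (by positivity : (0 : ℝ) < R / 3)).filter_mono nhdsWithin_le_nhds
  obtain ⟨h, ⟨h2, h3⟩, h0⟩ := ((h2.and h3).and self_mem_nhdsWithin).exists
  replace h0 : 0 < h := h0
  -- The 1 pays for the middle interval. The second summand pays for the averages over [R/3, R/2] in
  -- the two strip estimates; as h < R/3, that interval lies inside [h, R - h].
  refine ⟨h, R - h, 1 + 2 * h * (2 / (R / 2 - R / 3)), h0, by linarith, by linarith, ?_, ?_⟩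
  · have : 0 < R / 2 - R / 3 := by linarith
    positivity
  intro f hf hK
  set K := ∫ r in (0 : ℝ)..R, deriv f r ^ 2 * r with hKdef
  set I := ∫ r in h..(R - h), f r ^ 2 with hI
  set I0 := ∫ r in (R / 3)..(R / 2), f r ^ 2 with hI0
  have hK0 : 0 ≤ K := by
    apply intervalIntegral.integral_nonneg hR.le
    intro r hr
    have := hr.1
    positivity
  have hsq := intervalIntegrable_sq_of_deriv hR hf hK
  have hmono : ∀ x y, 0 ≤ x → x ≤ y → y ≤ R →
      IntervalIntegrable (fun r => f r ^ 2) volume x y := by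
    intro x y hx hxy hy
    apply hsq.mono_set
    rw [uIcc_of_le hxy, uIcc_of_le hR.le]
    exact Icc_subset_Icc hx hy
  have hI0I : I0 ≤ I :=
    intervalIntegral.integral_mono_interval (by linarith) (by linarith) (by linarith)
      (Eventually.of_forall fun r => sq_nonneg _)
      (hmono _ _ h0.le (by linarith) (by linarith))
  have hI00 : 0 ≤ I0 := intervalIntegral.integral_nonneg (by linarith) fun r _ => sq_nonneg _
  have hedge : ∀ x y, 0 ≤ x → x ≤ y → y ≤ R → ∫ r in x..y, f r ^ 2 ≤
      (y - x) * (2 / (R / 2 - R / 3) * I0) + 2 * (G y - G x) * K := by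
    intro x y hx hxy hy
    have : ∫ r in x..y, f r ^ 2 ≤ ∫ r in x..y, (2 / (R / 2 - R / 3) * I0 + 2 * K * g r) := by
      apply intervalIntegral.integral_mono_on_of_le_Ioo hxy (hmono x y hx hxy hy)
        ((by simp : IntervalIntegrable _ volume x y).add ((hgi x y).const_mul _))
      intro r hr
      have := sq_le_average_add hf hK (a := R / 3) (b := R / 2) (by positivity) (by linarith)
        (by linarith) (x := r) ⟨hx.trans_lt hr.1, hr.2.le.trans hy⟩
      linarith
    rw [intervalIntegral.integral_add (by simp) ((hgi x y).const_mul _),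
      intervalIntegral.integral_const, intervalIntegral.integral_const_mul, smul_eq_mul] at this
    have h5 : ∫ r in x..y, g r = G y - G x :=
      (intervalIntegral.integral_interval_sub_left (hgi 0 y) (hgi 0 x)).symm
    rw [h5] at this
    linarith
  have hsplit : ∫ r in (0 : ℝ)..R, f r ^ 2 = (∫ r in (0 : ℝ)..h, f r ^ 2) + I
      + ∫ r in (R - h)..R, f r ^ 2 := by
    rw [hI, intervalIntegral.integral_add_adjacent_intervals (hmono _ _ le_rfl h0.le (by linarith))
      (hmono _ _ h0.le (by linarith) (by linarith)),
      intervalIntegral.integral_add_adjacent_intervals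
        (hmono _ _ le_rfl (by linarith) (by linarith))
        (hmono _ _ (by linarith) (by linarith) le_rfl)]
  have e1 := hedge 0 h le_rfl h0.le (by linarith)
  have e2 := hedge (R - h) R (by linarith) (by linarith) le_rfl
  have hG0 : G 0 = 0 := by simp [hG]
  have e3 : 2 * (G h + (G R - G (R - h))) * K ≤ δ * K := by nlinarith
  have e4 : 2 * h * (2 / (R / 2 - R / 3)) * I0 ≤ 2 * h * (2 / (R / 2 - R / 3)) * I := by
    have : 0 < R / 2 - R / 3 := by linarith
    gcongr
  rw [hsplit]
  rw [hG0] at e1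
  linarith

end

/-! ### Compactness and completeness in weighted Sobolev spaces on an interval -/

section

variable {R : ℝ}

/-- A sequence with bounded weighted Dirichlet integrals and bounded mass has a subsequence that is
Cauchy in `L²(0, R)`. -/
theorem exists_subseq_integral_sq_sub_tendsto (hR : 0 < R) {f : ℕ → ℝ → ℝ}
    (hf : ∀ n, ∀ a ∈ Ioo 0 R, AbsolutelyContinuousOnInterval (f n) a R)
    (hK : ∀ n, IntervalIntegrable (fun r => deriv (f n) r ^ 2 * r) volume 0 R)
    {M : ℝ} (hM : ∀ n, ∫ r in (0 : ℝ)..R, deriv (f n) r ^ 2 * r ≤ M)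
    {a b : ℝ} (ha : 0 < a) (hab : a < b) (hb : b ≤ R)
    {M' : ℝ} (hM' : ∀ n, ∫ r in a..b, f n r ^ 2 ≤ M') :
    ∃ φ : ℕ → ℕ, StrictMono φ ∧ Tendsto
      (fun p : ℕ × ℕ => ∫ r in (0 : ℝ)..R, (f (φ p.1) r - f (φ p.2) r) ^ 2)
      (atTop ×ˢ atTop) (𝓝 0) := by
  set c := |Real.log a| + |Real.log b| with hc
  set B : ℝ → ℝ := fun x => 2 / (b - a) * M' + 2 * (|Real.log x| + c) * M with hB
  have hM0 : 0 ≤ M := by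
    refine le_trans ?_ (hM 0)
    apply intervalIntegral.integral_nonneg hR.le
    intro r hr
    have := hr.1
    positivity
  have hbd : ∀ n, ∀ x ∈ Ioc 0 R, f n x ^ 2 ≤ B x := by
    intro n x hx
    refine (sq_le_average_add (hf n) (hK n) ha hab hb hx).trans ?_
    have hba : 0 < b - a := sub_pos.2 hab
    simp only [hB]
    have h0 : 0 ≤ |Real.log x| + c := by positivity
    have h1 := hM n
    have h2 := hM' n
    gcongr
  set K : (ℚ → Set ℝ) := fun q => Icc (-(B q + 1)) (B q + 1)
  set D : Set ℝ := Ioc 0 R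
  classical
  -- The values at rational points form a point of a countable product of compact intervals, so
  -- sequential compactness of the product extracts one subsequence for all rationals at once.
  set F : ℕ → ℚ → ℝ := fun n q => if (q : ℝ) ∈ Ioc 0 R then f n q else 0 with hF
  have hFmem : ∀ n, F n ∈ Set.pi univ (fun q : ℚ => Icc (-(|B q| + 1)) (|B q| + 1)) := by
    intro n q _
    simp only [hF]
    split_ifs with hq
    · have h1 := hbd n q hq
      have h2 : |f n q| ≤ |B q| + 1 := by
        have := le_abs_self (B q)
        rw [← sq_abs] at h1
        nlinarith [sq_nonneg (|f n q| - 1), abs_nonneg (f n q)]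
      exact abs_le.1 h2
    · have := abs_nonneg (B q)
      constructor <;> linarith
  obtain ⟨F', -, φ, hφ, hlim⟩ :=
    (isCompact_univ_pi fun q : ℚ => isCompact_Icc (a := -(|B q| + 1)) (b := |B q| + 1)).tendsto_subseq
      hFmem
  rw [tendsto_pi_nhds] at hlim
  -- The logarithmic modulus is uniform in n, so convergence at a rational close to x forces the
  -- values at x to be Cauchy.
  have hcauchy : ∀ x ∈ Ioo 0 R, CauchySeq fun n => f (φ n) x := by
    intro x hx
    rw [Metric.cauchySeq_iff']
    intro ε hε
    have h1 : ∀ᶠ y in 𝓝 x, |Real.log y - Real.log x| * M < (ε / 3) ^ 2 := by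
      have : ContinuousAt (fun y => |Real.log y - Real.log x| * M) x := by
        have := Real.continuousAt_log hx.1.ne'
        fun_prop
      have h2 := this.tendsto
      simp only [sub_self, abs_zero, zero_mul] at h2
      exact h2.eventually (gt_mem_nhds (by positivity))
    obtain ⟨δ, hδ, h2⟩ := Metric.eventually_nhds_iff.1 (h1.and (Ioo_mem_nhds hx.1 hx.2))
    obtain ⟨q, hq1, hq2⟩ := exists_rat_btwn (show x < x + δ by linarith)
    obtain ⟨h3, h4⟩ := h2 (y := q) (by rw [Real.dist_eq, abs_lt]; constructor <;> linarith)
    have hqm : (q : ℝ) ∈ Ioc 0 R := ⟨h4.1, h4.2.le⟩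
    have h5 : ∀ n, |f n q - f n x| < ε / 3 := by
      intro n
      apply abs_lt_of_sq_lt_sq _ (by positivity)
      refine (sq_sub_le_abs_log_mul (hf n) (hK n) ⟨hx.1, hx.2.le⟩ hqm).trans_lt
        (lt_of_le_of_lt ?_ h3)
      exact mul_le_mul_of_nonneg_left (hM n) (abs_nonneg _)
    have h6 := (hlim q).cauchySeq
    rw [Metric.cauchySeq_iff'] at h6
    obtain ⟨N, hN⟩ := h6 (ε / 3) (by positivity)
    refine ⟨N, fun n hn => ?_⟩
    have h7 := hN n hn
    simp only [Function.comp_apply, hF, if_pos hqm, Real.dist_eq] at h7 ⊢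
    have h8 := h5 (φ n)
    have h9 := h5 (φ N)
    rw [abs_lt] at *
    constructor <;> linarith
  choose! g hg using fun x hx => cauchySeq_tendsto_of_complete (hcauchy x hx)
  refine ⟨φ, hφ, ?_⟩
  have hint : IntegrableOn (fun x => 4 * B x) (Ioo 0 R) := by
    rw [← intervalIntegrable_iff_integrableOn_Ioo_of_le hR.le]
    exact ((by simp : IntervalIntegrable _ volume 0 R).add
      (((intervalIntegrable_abs_log_add c).const_mul 2).mul_const M)).const_mul 4
  have h1 : Tendsto
      (fun p : ℕ × ℕ => ∫ r in Ioo 0 R, (f (φ p.1) r - f (φ p.2) r) ^ 2)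
      -- Dominated convergence: (u - v)² ≤ 2u² + 2v² ≤ 4B, and B has only a logarithmic singularity.
      (atTop ×ˢ atTop) (𝓝 (∫ r in Ioo 0 R, (0 : ℝ))) := by
    apply tendsto_integral_filter_of_dominated_convergence (fun x => 4 * B x) _ _ hint
    · filter_upwards [ae_restrict_mem measurableSet_Ioo] with x hx
      have h2 := (hg x hx).comp (tendsto_fst (f := atTop) (g := (atTop : Filter ℕ)))
      have h3 := (hg x hx).comp (tendsto_snd (g := atTop) (f := (atTop : Filter ℕ)))
      have h4 := (h2.sub h3).pow 2
      simpa using h4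
    · refine Eventually.of_forall fun p => ?_
      exact ((aestronglyMeasurable_of_locAC (hf _)).sub
        (aestronglyMeasurable_of_locAC (hf _))).pow 2
    · refine Eventually.of_forall fun p => ?_
      filter_upwards [ae_restrict_mem measurableSet_Ioo] with x hx
      have h2 := hbd (φ p.1) x ⟨hx.1, hx.2.le⟩
      have h3 := hbd (φ p.2) x ⟨hx.1, hx.2.le⟩
      rw [Real.norm_of_nonneg (sq_nonneg _)]
      nlinarith [sq_nonneg (f (φ p.1) x + f (φ p.2) x)]
  simp only [integral_zero] at h1
  refine h1.congr fun p => ?_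
  rw [intervalIntegral.integral_of_le hR.le, integral_Ioc_eq_integral_Ioo]

/-- Completeness of the weighted one-dimensional Sobolev space: if the derivatives are Cauchy in
`L²(r⁴ dr)` and the end point values converge, then the functions converge pointwise to a locally
absolutely continuous function, and along a subsequence so do the derivatives. -/
theorem exists_ac_limit {c : ℝ} (hc0 : 0 ≤ c) (hcR : c < R) {f : ℕ → ℝ → ℝ}
    (hf : ∀ n, ∀ a, 0 < a → a ∈ Ico c R → AbsolutelyContinuousOnInterval (f n) a R)
    (hK : ∀ n, MemLp (fun r => deriv (f n) r * r ^ 2) 2 (volume.restrict (Ioo c R)))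
    (hc : Tendsto (fun p : ℕ × ℕ => eLpNorm (fun r => deriv (f p.1) r * r ^ 2
      - deriv (f p.2) r * r ^ 2) 2 (volume.restrict (Ioo c R))) (atTop ×ˢ atTop) (𝓝 0))
    {l : ℝ} (hl : Tendsto (fun n => f n R) atTop (𝓝 l)) :
    ∃ g : ℝ → ℝ, (∀ a, 0 < a → a ∈ Ico c R → AbsolutelyContinuousOnInterval g a R) ∧
      (∀ x, 0 < x → x ∈ Icc c R → Tendsto (fun n => f n x) atTop (𝓝 (g x))) ∧
      ∀ φ : ℕ → ℕ, Tendsto φ atTop atTop → ∃ ψ : ℕ → ℕ, StrictMono ψ ∧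
        ∀ᵐ r ∂volume.restrict (Ioo c R),
          Tendsto (fun n => deriv (f (φ (ψ n))) r) atTop (𝓝 (deriv g r)) := by
  set ν := volume.restrict (Ioo c R) with hν
  set d : ℕ → ℝ → ℝ := fun n r => deriv (f n) r * r ^ 2 with hd
  obtain ⟨G, hGm, hconv⟩ : ∃ G : ℝ → ℝ, MemLp G 2 ν ∧
      Tendsto (fun n => eLpNorm (d n - G) 2 ν) atTop (𝓝 0) := by
    obtain ⟨G, hG⟩ : ∃ G : Lp ℝ 2 ν, Tendsto (fun n => (hK n).toLp (d n)) atTop (𝓝 G) := by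
      apply cauchySeq_tendsto_of_complete
      rw [cauchySeq_iff_tendsto_dist_atTop_0, ← prod_atTop_atTop_eq]
      have h1 := (ENNReal.tendsto_toReal ENNReal.zero_ne_top).comp hc
      refine h1.congr fun p => ?_
      rw [Lp.dist_edist, Lp.edist_toLp_toLp]
      rfl
    refine ⟨G, Lp.memLp G, ?_⟩
    rw [Lp.tendsto_Lp_iff_tendsto_eLpNorm'] at hG
    refine hG.congr fun n => ?_
    apply eLpNorm_congr_ae
    filter_upwards [(hK n).coeFn_toLp] with x hx
    exact congrArg (· - (G : ℝ → ℝ) x) hx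
  have hdiv : ∀ x, 0 < x → x ∈ Ico c R → ∀ h : ℝ → ℝ, MemLp h 2 ν →
      IntervalIntegrable (fun r => h r / r ^ 2) volume x R := by
    intro x hx0 hx h hh
    have h1 : IntervalIntegrable h volume x R := by
      have h2 : IntegrableOn h (Ioo c R) := hh.integrable (by norm_num)
      rw [← intervalIntegrable_iff_integrableOn_Ioo_of_le hcR.le] at h2
      apply h2.mono_set
      rw [uIcc_of_le hx.2.le, uIcc_of_le hcR.le]
      exact Icc_subset_Icc_left hx.1
    simp_rw [div_eq_mul_inv]
    apply h1.mul_continuousOn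
    rw [uIcc_of_le hx.2.le]
    exact (continuousOn_id.pow 2).inv₀ fun r hr => (pow_pos (hx0.trans_le hr.1) 2).ne'
  -- G is the L² limit of f' r². The limit function is rebuilt by integrating backwards from R,
  -- where the values converge, because nothing is controlled at r = 0.
  set g : ℝ → ℝ := fun x => l - ∫ r in x..R, G r / r ^ 2 with hg
  have hgac : ∀ a, 0 < a → a ∈ Ico c R → AbsolutelyContinuousOnInterval g a R := by
    intro a ha0 ha
    have h1 := (hdiv a ha0 ha G hGm).absolutelyContinuousOnInterval_intervalIntegral
      (c := R) right_mem_uIcc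
    have h2 : AbsolutelyContinuousOnInterval (fun _ : ℝ => l) a R :=
      (contDiffOn_const (n := 1)).absolutelyContinuousOnInterval
    have h3 : g = (fun _ : ℝ => l) + fun x => ∫ r in R..x, G r / r ^ 2 := by
      funext x
      simp only [hg, Pi.add_apply]
      rw [intervalIntegral.integral_symm R x]
      ring
    rw [h3]
    exact h2.add h1
  have hgd : ∀ᵐ r ∂ν, deriv g r = G r / r ^ 2 := by
    have hmem : ∀ n : ℕ, 0 < c + (R - c) / (n + 2) ∧ c + (R - c) / (n + 2) ∈ Ico c R := by
      intro n
      have h0 : 0 < R - c := sub_pos.2 hcR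
      have h1 : 0 < (R - c) / (n + 2) := by positivity
      have h2 : (R - c) / (n + 2) < R - c := by
        rw [div_lt_iff₀ (by positivity)]
        nlinarith [(Nat.cast_nonneg n : (0 : ℝ) ≤ n)]
      exact ⟨by linarith, by linarith, by linarith⟩
    have h1 : ∀ n : ℕ, ∀ᵐ r, r ∈ uIcc (c + (R - c) / (n + 2)) R →
        HasDerivAt g (G r / r ^ 2) r := by
      intro n
      filter_upwards [(hdiv _ (hmem n).1 (hmem n).2 G hGm).ae_hasDerivAt_integral] with r hr hr'
      have h2 := (hr hr' R right_mem_uIcc).const_add l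
      have h3 : g = fun x => l + ∫ r in R..x, G r / r ^ 2 := by
        funext x
        simp only [hg]
        rw [intervalIntegral.integral_symm R x]
        ring
      rwa [h3]
    rw [hν, ae_restrict_iff' measurableSet_Ioo]
    filter_upwards [ae_all_iff.2 h1] with r hr hr'
    have hrc : 0 < r - c := sub_pos.2 hr'.1
    obtain ⟨n, hn⟩ := exists_nat_gt ((R - c) / (r - c))
    apply (hr n _).deriv
    have hle : c + (R - c) / (n + 2) ≤ r := by
      have : (R - c) / (n + 2) ≤ r - c := by
        rw [div_le_iff₀ (by positivity)]
        rw [div_lt_iff₀ hrc] at hn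
        nlinarith
      linarith
    rw [uIcc_of_le (hle.trans hr'.2.le)]
    exact ⟨hle, hr'.2.le⟩
  refine ⟨g, hgac, ?_, ?_⟩
  · intro x hx0 hx
    rcases eq_or_lt_of_le hx.2 with rfl | hlt
    · simpa [hg] using hl
    have hx' : x ∈ Ico c R := ⟨hx.1, hlt⟩
    have h1 : ∀ n, f n x = f n R - ∫ r in x..R, d n r / r ^ 2 := by
      intro n
      have h2 := (hf n x hx0 hx').integral_deriv_eq_sub
      have h3 : ∫ r in x..R, d n r / r ^ 2 = ∫ r in x..R, deriv (f n) r := by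
        apply intervalIntegral.integral_congr
        intro r hr
        rw [uIcc_of_le hlt.le] at hr
        have : r ≠ 0 := (hx0.trans_le hr.1).ne'
        simp only [hd]
        field_simp
      linarith
    simp_rw [h1]
    apply hl.sub
    rw [intervalIntegral.integral_of_le hlt.le]
    simp_rw [intervalIntegral.integral_of_le hlt.le]
    have h4 : ∀ n, IntegrableOn (fun r => d n r / r ^ 2) (Ioc x R) := fun n =>
      (intervalIntegrable_iff_integrableOn_Ioc_of_le hlt.le).1 (hdiv x hx0 hx' _ (hK n))
    apply tendsto_integral_of_L1' _ ((intervalIntegrable_iff_integrableOn_Ioc_of_le hlt.le).1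
      (hdiv x hx0 hx' _ hGm)).aestronglyMeasurable (Eventually.of_forall h4)
    -- On (x, R) the factor 1/r² is at most 1/x², and the interval is bounded, so L² convergence of
    -- f' r² gives L¹ convergence of f'.
    have h5 : ∀ n, eLpNorm ((fun r => d n r / r ^ 2) - fun r => G r / r ^ 2) 1
        (volume.restrict (Ioc x R)) ≤ ENNReal.ofReal (1 / x ^ 2) *
          (eLpNorm (d n - G) 2 ν * (ν univ) ^ (1 / (1 : ℝ≥0∞).toReal - 1 / (2 : ℝ≥0∞).toReal)) := by
      intro n
      have h6 : eLpNorm ((fun r => d n r / r ^ 2) - fun r => G r / r ^ 2) 1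
        (volume.restrict (Ioc x R)) ≤ ENNReal.ofReal (1 / x ^ 2) * eLpNorm (d n - G) 1
          (volume.restrict (Ioc x R)) := by
        apply eLpNorm_le_mul_eLpNorm_of_ae_le_mul
        filter_upwards [ae_restrict_mem measurableSet_Ioc] with r hr
        have hr0 : 0 < r := hx0.trans hr.1
        simp only [Pi.sub_apply, Real.norm_eq_abs]
        rw [← sub_div, abs_div, abs_of_pos (pow_pos hr0 2), div_eq_mul_one_div, mul_comm]
        gcongr
        exact hr.1.le
      refine h6.trans (mul_le_mul_right ?_ _)
      refine le_trans ?_ (eLpNorm_le_eLpNorm_mul_rpow_measure_univ (by norm_num)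
        ((hK n).aestronglyMeasurable.sub hGm.aestronglyMeasurable))
      rw [← restrict_Ioo_eq_restrict_Ioc]
      exact eLpNorm_mono_measure _ (Measure.restrict_mono (Ioo_subset_Ioo_left hx.1) le_rfl)
    apply tendsto_of_tendsto_of_tendsto_of_le_of_le tendsto_const_nhds _ (fun _ => zero_le) h5
    have h6 : (ν univ) ^ (1 / (1 : ℝ≥0∞).toReal - 1 / (2 : ℝ≥0∞).toReal) ≠ ⊤ := by
      apply ENNReal.rpow_ne_top_of_nonneg (by norm_num)
      simp [hν]
    have h7 := ENNReal.Tendsto.const_mul (a := ENNReal.ofReal (1 / x ^ 2))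
      (ENNReal.Tendsto.mul_const hconv (Or.inr h6)) (Or.inr ENNReal.ofReal_ne_top)
    simpa using h7
  · intro φ hφ
    have h1 : TendstoInMeasure ν (fun n => d (φ n)) atTop G :=
      tendstoInMeasure_of_tendsto_eLpNorm (by norm_num) (fun n => (hK _).aestronglyMeasurable)
        hGm.aestronglyMeasurable (hconv.comp hφ)
    obtain ⟨ψ, hψ, h2⟩ := h1.exists_seq_tendsto_ae
    refine ⟨ψ, hψ, ?_⟩
    filter_upwards [h2, hgd, ae_restrict_mem measurableSet_Ioo] with r h3 h4 h5
    rw [h4]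
    have hr0 : r ≠ 0 := (hc0.trans_lt h5.1).ne'
    refine (h3.div_const (r ^ 2)).congr fun n => ?_
    simp only [hd]
    field_simp

/-- The value at the end point is controlled by the mass and the derivative in `L²(r⁴ dr)`. -/
theorem sq_right_le {f : ℝ → ℝ} {a b : ℝ} (ha : 0 < a) (hab : a < b) (hb : b ≤ R)
    (hf : AbsolutelyContinuousOnInterval f a R)
    (hK : IntegrableOn (fun r => deriv f r ^ 2 * r ^ 4) (Ioo 0 R)) :
    f R ^ 2 ≤ 2 / (b - a) * (∫ r in a..b, f r ^ 2)
      + 2 * ((Real.log R - Real.log a) / a ^ 3) * ∫ r in Ioo 0 R, deriv f r ^ 2 * r ^ 4 := by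
  have haR : a ≤ R := (hab.trans_le hb).le
  have hsub : Ioo a R ⊆ Ioo 0 R := Ioo_subset_Ioo_left ha.le
  set K := ∫ r in Ioo 0 R, deriv f r ^ 2 * r ^ 4 with hKdef
  -- To the right of a one has r ≤ r⁴/a³, which turns the degenerate weight r⁴ into the weight r of
  -- the logarithmic estimate.
  have hle : ∀ r ∈ Ioo a R, deriv f r ^ 2 * r ≤ 1 / a ^ 3 * (deriv f r ^ 2 * r ^ 4) := by
    intro r hr
    have h1 : a ^ 3 ≤ r ^ 3 := pow_le_pow_left₀ ha.le hr.1.le 3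
    have hr0 : 0 < r := ha.trans hr.1
    rw [div_mul_eq_mul_div, one_mul, le_div_iff₀ (by positivity)]
    have h2 : 0 ≤ deriv f r ^ 2 * r := by positivity
    nlinarith
  have hKi : IntegrableOn (fun r => deriv f r ^ 2 * r) (Ioo a R) := by
    refine Integrable.mono' ((hK.mono_set hsub).const_mul (1 / a ^ 3))
      (((measurable_deriv _).pow_const 2).mul measurable_id).aestronglyMeasurable ?_
    filter_upwards [ae_restrict_mem measurableSet_Ioo] with r hr
    have hr0 : 0 < r := ha.trans hr.1
    rw [Real.norm_of_nonneg (by positivity)]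
    exact hle r hr
  have hKle : ∫ r in a..R, deriv f r ^ 2 * r ≤ 1 / a ^ 3 * K := by
    rw [intervalIntegral.integral_of_le haR, integral_Ioc_eq_integral_Ioo]
    have h1 : ∫ r in Ioo a R, deriv f r ^ 2 * r ≤
        ∫ r in Ioo a R, 1 / a ^ 3 * (deriv f r ^ 2 * r ^ 4) :=
      setIntegral_mono_on hKi ((hK.mono_set hsub).const_mul _) measurableSet_Ioo hle
    rw [integral_const_mul] at h1
    refine h1.trans (mul_le_mul_of_nonneg_left ?_ (by positivity))
    apply setIntegral_mono_set hK _ (Eventually.of_forall hsub)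
    exact Eventually.of_forall fun r => by simp only [Pi.zero_apply]; positivity
  have hKI : IntervalIntegrable (fun r => deriv f r ^ 2 * r) volume a R :=
    (intervalIntegrable_iff_integrableOn_Ioo_of_le haR).2 hKi
  set A := 2 * ((Real.log R - Real.log a) / a ^ 3) * K with hA
  have h1 : ∀ y ∈ Icc a b, f R ^ 2 ≤ 2 * f y ^ 2 + A := by
    intro y hy
    have hy0 : 0 < y := ha.trans_le hy.1
    have hyR : y ≤ R := hy.2.trans hb
    have hsub' : uIcc y R ⊆ uIcc a R := by
      rw [uIcc_of_le hyR, uIcc_of_le haR]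
      exact Icc_subset_Icc_left hy.1
    have h2 := (hf.mono hsub').sq_sub_le_log_mul hy0 hyR (hKI.mono_set hsub')
    have h3 : ∫ r in y..R, deriv f r ^ 2 * r ≤ ∫ r in a..R, deriv f r ^ 2 * r := by
      apply intervalIntegral.integral_mono_interval hy.1 hyR le_rfl _ hKI
      filter_upwards [ae_restrict_mem measurableSet_Ioc] with r hr
      have : 0 < r := ha.trans hr.1
      simp only [Pi.zero_apply]
      positivity
    have h4 := Real.log_le_log ha hy.1
    have h5 := Real.log_le_log hy0 hyR
    have h6 : (f R - f y) ^ 2 ≤ (Real.log R - Real.log a) * (1 / a ^ 3 * K) := by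
      refine h2.trans (mul_le_mul (by linarith) (h3.trans hKle) ?_ (by linarith))
      apply intervalIntegral.integral_nonneg hyR
      intro r hr
      have : 0 < r := hy0.trans_le hr.1
      positivity
    have h7 : A = 2 * ((Real.log R - Real.log a) * (1 / a ^ 3 * K)) := by
      rw [hA]
      ring
    rw [h7]
    nlinarith [sq_nonneg (f R - 2 * f y)]
  have hfi : IntervalIntegrable (fun r => f r ^ 2) volume a b := by
    apply ContinuousOn.intervalIntegrable
    refine (hf.continuousOn.mono ?_).pow 2
    rw [uIcc_of_le hab.le, uIcc_of_le haR]
    exact Icc_subset_Icc_right hb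
  have h2 : ∫ y in a..b, f R ^ 2 ≤ ∫ y in a..b, (2 * f y ^ 2 + A) :=
    intervalIntegral.integral_mono_on hab.le (by simp) ((hfi.const_mul 2).add (by simp)) h1
  rw [intervalIntegral.integral_add (hfi.const_mul 2) (by simp),
    intervalIntegral.integral_const, intervalIntegral.integral_const,
    intervalIntegral.integral_const_mul, smul_eq_mul, smul_eq_mul] at h2
  have hba : 0 < b - a := sub_pos.2 hab
  rw [show 2 / (b - a) * (∫ r in a..b, f r ^ 2) + A
      = (2 * (∫ r in a..b, f r ^ 2) + (b - a) * A) / (b - a) by field_simp, le_div_iff₀ hba]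
  linarith

theorem tendsto_eLpNorm_two_of_tendsto_integral_sq {ι α : Type*} [MeasurableSpace α]
    {μ : Measure α} {L : Filter ι} {h : ι → α → ℝ} (hm : ∀ i, MemLp (h i) 2 μ)
    (hlim : Tendsto (fun i => ∫ x, h i x ^ 2 ∂μ) L (𝓝 0)) :
    Tendsto (fun i => eLpNorm (h i) 2 μ) L (𝓝 0) := by
  have h1 : ∀ i, eLpNorm (h i) 2 μ = ENNReal.ofReal (Real.sqrt (∫ x, h i x ^ 2 ∂μ)) := by
    intro i
    rw [(hm i).eLpNorm_eq_integral_rpow_norm (by norm_num) (by norm_num), Real.sqrt_eq_rpow]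
    norm_num
  simp_rw [h1]
  have h2 := ENNReal.tendsto_ofReal hlim.sqrt
  simpa using h2

/-- Completeness in terms of integrals: derivatives Cauchy in `L²(r⁴ dr)`, functions Cauchy in `L²`
of some interval. -/
theorem exists_locAC_limit (hR : 0 < R) {f : ℕ → ℝ → ℝ}
    (hf : ∀ n, ∀ a ∈ Ioo 0 R, AbsolutelyContinuousOnInterval (f n) a R)
    (hK : ∀ n, IntegrableOn (fun r => deriv (f n) r ^ 2 * r ^ 4) (Ioo 0 R))
    (hc : Tendsto (fun p : ℕ × ℕ => ∫ r in Ioo 0 R, deriv (f p.1 - f p.2) r ^ 2 * r ^ 4)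
      (atTop ×ˢ atTop) (𝓝 0)) {a b : ℝ} (ha : 0 < a) (hab : a < b) (hb : b ≤ R)
    (hl : Tendsto (fun p : ℕ × ℕ => ∫ r in a..b, (f p.1 r - f p.2 r) ^ 2)
      (atTop ×ˢ atTop) (𝓝 0)) :
    ∃ g : ℝ → ℝ, (∀ a ∈ Ioo 0 R, AbsolutelyContinuousOnInterval g a R) ∧
      (∀ x ∈ Ioc 0 R, Tendsto (fun n => f n x) atTop (𝓝 (g x))) ∧
      ∀ φ : ℕ → ℕ, Tendsto φ atTop atTop → ∃ ψ : ℕ → ℕ, StrictMono ψ ∧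
        ∀ᵐ r ∂volume.restrict (Ioo 0 R),
          Tendsto (fun n => deriv (f (φ (ψ n))) r) atTop (𝓝 (deriv g r)) := by
  have hm : ∀ n, MemLp (fun r => deriv (f n) r * r ^ 2) 2 (volume.restrict (Ioo 0 R)) := by
    intro n
    have hmeas : Measurable fun r => deriv (f n) r * r ^ 2 :=
      (measurable_deriv _).mul (measurable_id'.pow_const 2)
    refine (memLp_two_iff_integrable_sq hmeas.aestronglyMeasurable).2 ?_
    refine (hK n).congr (Eventually.of_forall fun r => ?_)
    simp only
    ring
  have hae : ∀ p : ℕ × ℕ, ∀ᵐ r ∂volume.restrict (Ioo 0 R),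
      deriv (f p.1 - f p.2) r = deriv (f p.1) r - deriv (f p.2) r := by
    intro p
    filter_upwards [ae_differentiableAt_of_locAC (hf p.1), ae_differentiableAt_of_locAC (hf p.2)]
      with r h1 h2
    exact deriv_sub h1 h2
  have hsq : ∀ p : ℕ × ℕ, (fun r => deriv (f p.1 - f p.2) r ^ 2 * r ^ 4)
      =ᵐ[volume.restrict (Ioo 0 R)]
      fun r => (deriv (f p.1) r * r ^ 2 - deriv (f p.2) r * r ^ 2) ^ 2 := by
    intro p
    filter_upwards [hae p] with r hr
    rw [hr]
    ring
  have hKd : ∀ p : ℕ × ℕ, IntegrableOn (fun r => deriv (f p.1 - f p.2) r ^ 2 * r ^ 4)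
      (Ioo 0 R) := by
    intro p
    refine Integrable.congr ?_ (hsq p).symm
    exact ((hm p.1).sub (hm p.2)).integrable_sq
  -- The end point estimate `sq_right_le`, applied to differences, makes the values at R Cauchy;
  -- this is the anchor that `exists_ac_limit` needs.
  have hfR : CauchySeq fun n => f n R := by
    rw [cauchySeq_iff_tendsto_dist_atTop_0, ← prod_atTop_atTop_eq]
    have h1 : Tendsto (fun p : ℕ × ℕ => (f p.1 R - f p.2 R) ^ 2) (atTop ×ˢ atTop) (𝓝 0) := by
      have h2 := (hl.const_mul (2 / (b - a))).add
        (hc.const_mul (2 * ((Real.log R - Real.log a) / a ^ 3)))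
      rw [mul_zero, mul_zero, add_zero] at h2
      refine squeeze_zero (fun p => sq_nonneg _) (fun p => ?_) h2
      exact sq_right_le ha hab hb ((hf p.1 a ⟨ha, hab.trans_le hb⟩).sub
        (hf p.2 a ⟨ha, hab.trans_le hb⟩)) (hKd p)
    have h3 := h1.sqrt
    simp only [Real.sqrt_sq_eq_abs, Real.sqrt_zero] at h3
    exact h3
  obtain ⟨l, hl'⟩ := cauchySeq_tendsto_of_complete hfR
  obtain ⟨g, h1, h2, h3⟩ := exists_ac_limit le_rfl hR
    (fun n a ha0 ha => hf n a ⟨ha0, ha.2⟩) hm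
    (tendsto_eLpNorm_two_of_tendsto_integral_sq (fun p => (hm p.1).sub (hm p.2))
      (hc.congr fun p => integral_congr_ae (hsq p))) hl'
  exact ⟨g, fun a ha => h1 a ha.1 ⟨ha.1.le, ha.2⟩, fun x hx => h2 x hx.1 ⟨hx.1.le, hx.2⟩, h3⟩

/-- Fatou's lemma for a Cauchy family. -/
theorem tendsto_lintegral_of_cauchy {α : Type*} [MeasurableSpace α] {μ : Measure α}
    {F : ℕ → ℕ → α → ℝ≥0∞} {G : ℕ → α → ℝ≥0∞} (hF : ∀ n l, AEMeasurable (F n l) μ)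
    (hlim : Tendsto (fun p : ℕ × ℕ => ∫⁻ x, F p.1 p.2 x ∂μ) (atTop ×ˢ atTop) (𝓝 0))
    {ψ : ℕ → ℕ} (hψ : Tendsto ψ atTop atTop)
    (hG : ∀ n, ∀ᵐ x ∂μ, Tendsto (fun l => F n (ψ l) x) atTop (𝓝 (G n x))) :
    Tendsto (fun n => ∫⁻ x, G n x ∂μ) atTop (𝓝 0) := by
  rw [ENNReal.tendsto_nhds_zero]
  intro ε hε
  have h1 := ENNReal.tendsto_nhds_zero.1 hlim ε hε
  rw [prod_atTop_atTop_eq] at h1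
  obtain ⟨⟨N, M⟩, hN⟩ := eventually_atTop.1 h1
  filter_upwards [eventually_ge_atTop N] with n hn
  -- With n fixed, the Cauchy bound holds for all large l; Fatou in l alone carries it to the limit.
  calc ∫⁻ x, G n x ∂μ = ∫⁻ x, liminf (fun l => F n (ψ l) x) atTop ∂μ :=
        lintegral_congr_ae ((hG n).mono fun x hx => hx.liminf_eq.symm)
    _ ≤ liminf (fun l => ∫⁻ x, F n (ψ l) x ∂μ) atTop := lintegral_liminf_le' fun l => hF n (ψ l)
    _ ≤ ε := by
      apply liminf_le_of_frequently_le'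
      apply Eventually.frequently
      filter_upwards [hψ.eventually_ge_atTop M] with l hl
      exact hN (n, ψ l) ⟨hn, hl⟩

/-- Integration by parts against a weight that vanishes at both end points. -/
theorem abs_integral_mul_mul_deriv_le {ψ : ℝ → ℝ} {a b : ℝ} (hab : a ≤ b) (hψ : ContDiff ℝ 1 ψ)
    (ha : ψ a = 0) (hb : ψ b = 0) :
    ∃ C : ℝ, 0 ≤ C ∧ ∀ f g : ℝ → ℝ, AbsolutelyContinuousOnInterval f a b →
      AbsolutelyContinuousOnInterval g a b →
      IntervalIntegrable (fun r => deriv f r ^ 2) volume a b →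
      |∫ r in a..b, ψ r * f r * deriv g r| ≤
        C * ((∫ r in a..b, f r ^ 2) + (∫ r in a..b, deriv f r ^ 2) + ∫ r in a..b, g r ^ 2) := by
  have hcd : Continuous (deriv ψ) := hψ.continuous_deriv le_rfl
  obtain ⟨A, hA⟩ := isCompact_Icc.exists_bound_of_continuousOn (s := Icc a b)
    hψ.continuous.continuousOn
  obtain ⟨B, hB⟩ := isCompact_Icc.exists_bound_of_continuousOn (s := Icc a b) hcd.continuousOn
  have hA0 : 0 ≤ A := (norm_nonneg _).trans (hA a (left_mem_Icc.2 hab))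
  have hB0 : 0 ≤ B := (norm_nonneg _).trans (hB a (left_mem_Icc.2 hab))
  refine ⟨A + B, by positivity, fun f g hf hg hf' => ?_⟩
  have hψac : AbsolutelyContinuousOnInterval ψ a b := hψ.contDiffOn.absolutelyContinuousOnInterval
  have hm := hψac.fun_mul hf
  -- The derivative leaves g, for which only the L² norm may appear in the bound; the boundary terms
  -- vanish with ψ.
  rw [hm.integral_mul_deriv_eq_deriv_mul hg, ha, hb]
  simp only [zero_mul, sub_zero, zero_sub, abs_neg]
  have hfi : IntervalIntegrable (fun r => f r ^ 2) volume a b :=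
    (hf.continuousOn.pow 2).intervalIntegrable
  have hgi : IntervalIntegrable (fun r => g r ^ 2) volume a b :=
    (hg.continuousOn.pow 2).intervalIntegrable
  rw [← intervalIntegral.integral_add hfi hf', ← intervalIntegral.integral_add (hfi.add hf') hgi,
    ← intervalIntegral.integral_const_mul]
  refine (intervalIntegral.abs_integral_le_integral_abs hab).trans ?_
  have hmi := (hm.intervalIntegrable_deriv.mul_continuousOn hg.continuousOn).abs
  have hri := ((hfi.add hf').add hgi).const_mul (A + B)
  rw [intervalIntegral.integral_of_le hab, intervalIntegral.integral_of_le hab]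
  rw [intervalIntegrable_iff_integrableOn_Ioc_of_le hab] at hmi hri
  apply integral_mono_ae hmi hri
  filter_upwards [ae_restrict_mem measurableSet_Ioc, ae_restrict_of_ae hf.ae_differentiableAt]
    with r hr hfr
  have hr' : r ∈ Icc a b := Ioc_subset_Icc_self hr
  have hd : deriv (fun x => ψ x * f x) r = deriv ψ r * f r + ψ r * deriv f r :=
    ((hψ.differentiable one_ne_zero).differentiableAt.hasDerivAt.mul
      (hfr (by rwa [uIcc_of_le hab])).hasDerivAt).deriv
  simp only [hd]
  have h1 := hA r hr'
  have h2 := hB r hr'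
  rw [Real.norm_eq_abs] at h1 h2
  have h3 : |(deriv ψ r * f r + ψ r * deriv f r) * g r|
      ≤ B * (|f r| * |g r|) + A * (|deriv f r| * |g r|) := by
    rw [add_mul]
    refine (abs_add_le _ _).trans ?_
    rw [abs_mul, abs_mul, abs_mul, abs_mul, mul_assoc, mul_assoc]
    gcongr
  have h4 : |f r| * |g r| ≤ f r ^ 2 + g r ^ 2 := by
    rw [← sq_abs (f r), ← sq_abs (g r)]
    nlinarith [sq_nonneg (|f r| - |g r|), sq_nonneg (|f r| + |g r|)]
  have h5 : |deriv f r| * |g r| ≤ deriv f r ^ 2 + g r ^ 2 := by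
    rw [← sq_abs (deriv f r), ← sq_abs (g r)]
    nlinarith [sq_nonneg (|deriv f r| - |g r|), sq_nonneg (|deriv f r| + |g r|)]
  have h6 := mul_le_mul_of_nonneg_left h4 hB0
  have h7 := mul_le_mul_of_nonneg_left h5 hA0
  nlinarith [sq_nonneg (deriv f r), sq_nonneg (f r)]

end

/-! ### Quadratic functions and constrained minimization -/

/-- `q` is a quadratic form on `V`, expressed through its restrictions to lines. -/
def IsQuadFun {V : Type*} [AddCommGroup V] [Module ℝ V] (q : V → ℝ) : Prop :=
  ∀ a b : V, ∃ c : ℝ, ∀ t : ℝ, q (a + t • b) = q a + t * c + t ^ 2 * q b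

namespace IsQuadFun

variable {V : Type*} [AddCommGroup V] [Module ℝ V] {q q' : V → ℝ}

theorem map_zero (hq : IsQuadFun q) : q 0 = 0 := by
  obtain ⟨c, hc⟩ := hq 0 0
  have h1 := hc 1
  have h2 := hc (-1)
  simp only [smul_zero, add_zero] at h1 h2
  linarith

theorem map_smul (hq : IsQuadFun q) (t : ℝ) (v : V) : q (t • v) = t ^ 2 * q v := by
  obtain ⟨c, hc⟩ := hq 0 v
  have h1 := hc 1
  have h2 := hc t
  rw [hq.map_zero, zero_add] at h1 h2
  rw [one_smul] at h1
  have : c = 0 := by linarith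
  rw [h2, this]
  ring

theorem parallelogram (hq : IsQuadFun q) (a b : V) :
    q (a + b) + q (a - b) = 2 * q a + 2 * q b := by
  obtain ⟨c, hc⟩ := hq a b
  have h1 := hc 1
  have h2 := hc (-1)
  rw [one_smul] at h1
  rw [neg_one_smul, ← sub_eq_add_neg] at h2
  linarith

theorem add (hq : IsQuadFun q) (hq' : IsQuadFun q') : IsQuadFun fun v => q v + q' v := by
  intro a b
  obtain ⟨c, hc⟩ := hq a b
  obtain ⟨c', hc'⟩ := hq' a b
  exact ⟨c + c', fun t => by simp only [hc, hc']; ring⟩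

theorem const_mul (hq : IsQuadFun q) (s : ℝ) : IsQuadFun fun v => s * q v := by
  intro a b
  obtain ⟨c, hc⟩ := hq a b
  exact ⟨s * c, fun t => by simp only [hc]; ring⟩

/-- A nonnegative form satisfies Cauchy-Schwarz: the discriminant of t ↦ q(w + t(u - w)) bounds the
cross term by 2 √(q(w) q(u - w)). So convergence in the seminorm implies convergence of the values,
and no bilinear form is needed. -/
theorem tendsto_of_nonneg (hq : IsQuadFun q) (h0 : ∀ v, 0 ≤ q v) {u : ℕ → V} {w : V}
    (hu : Tendsto (fun n => q (u n - w)) atTop (𝓝 0)) :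
    Tendsto (fun n => q (u n)) atTop (𝓝 (q w)) := by
  choose c hc using fun n => hq w (u n - w)
  have h1 : ∀ n, q (u n) = q w + c n + q (u n - w) := by
    intro n
    have := hc n 1
    rw [one_smul, add_sub_cancel] at this
    linarith
  have h2 : ∀ n, c n ^ 2 ≤ 4 * q w * q (u n - w) := by
    intro n
    have := discrim_le_zero (a := q (u n - w)) (b := c n) (c := q w) fun t => by
      have := hc n t
      have := h0 (w + t • (u n - w))
      nlinarith
    unfold discrim at this
    linarith
  have h3 : Tendsto (fun n => c n ^ 2) atTop (𝓝 0) := by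
    apply squeeze_zero (fun n => sq_nonneg _) h2
    simpa using hu.const_mul (4 * q w)
  have h4 : Tendsto c atTop (𝓝 0) := by
    have := h3.sqrt
    simp only [Real.sqrt_sq_eq_abs, Real.sqrt_zero] at this
    exact (tendsto_zero_iff_abs_tendsto_zero c).2 this
  simp_rw [h1]
  simpa using (tendsto_const_nhds.add h4).add hu

end IsQuadFun

/-- A quadratic form `E` whose negative part is compact relative to `S + J` attains a negative
infimum on `{J = 1}`. -/
theorem exists_minimizer {V : Type*} [AddCommGroup V] [Module ℝ V] {E J N S : V → ℝ}
    (hE : IsQuadFun E) (hJ : IsQuadFun J) (hN : IsQuadFun N)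
    (hJ0 : ∀ v, 0 ≤ J v) (hN0 : ∀ v, 0 ≤ N v) (hS0 : ∀ v, 0 ≤ S v)
    (hSE : ∀ v, S v ≤ E v + N v)
    {C : ℝ} (hEC : ∀ v, E v + N v ≤ C * (S v + J v)) (hNC : ∀ v, N v ≤ C * (S v + J v))
    {C' : ℝ} (hNS : ∀ v, N v ≤ 1 / 2 * S v + C' * J v)
    (hcomp : ∀ u : ℕ → V, (∃ M, ∀ n, S (u n) + J (u n) ≤ M) → ∃ φ : ℕ → ℕ, StrictMono φ ∧
      Tendsto (fun p : ℕ × ℕ => N (u (φ p.1) - u (φ p.2))) (atTop ×ˢ atTop) (𝓝 0))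
    (hcpl : ∀ u : ℕ → V, Tendsto (fun p : ℕ × ℕ => S (u p.1 - u p.2) + J (u p.1 - u p.2))
      (atTop ×ˢ atTop) (𝓝 0) → ∃ w, Tendsto (fun n => S (u n - w) + J (u n - w)) atTop (𝓝 0))
    {l : ℝ} (hl0 : l < 0) (hl : ∀ v, l * J v ≤ E v)
    {u : ℕ → V} (hu1 : ∀ n, J (u n) = 1) (hu : Tendsto (fun n => E (u n)) atTop (𝓝 l)) :
    ∃ w, J w = 1 ∧ E w = l := by
  obtain ⟨φ, hφ, hcau⟩ := hcomp u (by
    obtain ⟨M, hM⟩ := hu.bddAbove_range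
    -- From S ≤ E + N ≤ M + S/2 + C', where J = 1, one gets S ≤ 2(M + C'); the last 1 is J itself.
    refine ⟨2 * (M + C') + 1, fun n => ?_⟩
    have h1 := hM ⟨n, rfl⟩
    have h2 := hSE (u n)
    have h3 := hNS (u n)
    rw [hu1] at h3 ⊢
    simp only at h1
    linarith)
  have huφ : Tendsto (fun n => E (u (φ n))) atTop (𝓝 l) := hu.comp hφ.tendsto_atTop
  have hfst := huφ.comp (tendsto_fst (f := (atTop : Filter ℕ)) (g := (atTop : Filter ℕ)))
  have hsnd := huφ.comp (tendsto_snd (f := (atTop : Filter ℕ)) (g := (atTop : Filter ℕ)))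
  -- With a and b two terms of the sequence, E(a - b) = 2E(a) + 2E(b) - E(a + b), and E(a + b) ≥ l
  -- J(a + b) = l (4 - J(a - b)). Since l < 0, the term -l J(a - b) moves to the left as a coercive
  -- one; the factor 1 + 1/(-l) then replaces its weight -l by 1.
  have hmain : ∀ p : ℕ × ℕ, S (u (φ p.1) - u (φ p.2)) + J (u (φ p.1) - u (φ p.2)) ≤
      (1 + 1 / (-l)) * (2 * E (u (φ p.1)) + 2 * E (u (φ p.2)) - 4 * l
        + N (u (φ p.1) - u (φ p.2))) := by
    intro p
    set a := u (φ p.1)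
    set b := u (φ p.2)
    have h1 := hE.parallelogram a b
    have h2 := hJ.parallelogram a b
    have h3 := hl (a + b)
    have h4 := hSE (a - b)
    rw [hu1, hu1] at h2
    have h5 : S (a - b) + (-l) * J (a - b) ≤ 2 * E a + 2 * E b - 4 * l + N (a - b) := by
      have : J (a + b) = 4 - J (a - b) := by linarith
      rw [this] at h3
      linarith
    have hl' : 0 < -l := by linarith
    calc S (a - b) + J (a - b)
        ≤ S (a - b) + J (a - b) + ((-l) * J (a - b) + 1 / (-l) * S (a - b)) := by
          have := hS0 (a - b)
          have := hJ0 (a - b)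
          have : 0 ≤ (-l) * J (a - b) + 1 / (-l) * S (a - b) := by positivity
          linarith
      _ = (1 + 1 / (-l)) * (S (a - b) + (-l) * J (a - b)) := by
          have : l ≠ 0 := hl0.ne
          field_simp
          ring
      _ ≤ _ := by gcongr
  obtain ⟨w, hw⟩ := hcpl (fun n => u (φ n)) (by
    refine squeeze_zero (fun p => add_nonneg (hS0 _) (hJ0 _)) hmain ?_
    have h1 := ((((hfst.const_mul 2).add (hsnd.const_mul 2)).sub_const (4 * l)).add
      hcau).const_mul (1 + 1 / (-l))
    rw [show (1 + 1 / (-l)) * (2 * l + 2 * l - 4 * l + 0) = 0 by ring] at h1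
    exact h1)
  have hJw : Tendsto (fun n => J (u (φ n))) atTop (𝓝 (J w)) :=
    hJ.tendsto_of_nonneg hJ0 (squeeze_zero (fun n => hJ0 _)
      (fun n => le_add_of_nonneg_left (hS0 _)) hw)
  have hNw : Tendsto (fun n => N (u (φ n))) atTop (𝓝 (N w)) :=
    hN.tendsto_of_nonneg hN0 (squeeze_zero (fun n => hN0 _) (fun n => hNC _)
      (by simpa using hw.const_mul C))
  -- E itself has no sign, so its convergence is read off from the nonnegative forms E + N and N.
  have hEN : Tendsto (fun n => E (u (φ n)) + N (u (φ n))) atTop (𝓝 (E w + N w)) :=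
    (hE.add hN).tendsto_of_nonneg (fun v => (hS0 v).trans (hSE v))
      (squeeze_zero (fun n => (hS0 _).trans (hSE _)) (fun n => hEC _)
        (by simpa using hw.const_mul C))
  refine ⟨w, ?_, ?_⟩
  · simp_rw [hu1] at hJw
    exact (tendsto_nhds_unique hJw tendsto_const_nhds)
  · have := hEN.sub hNw
    simp only [add_sub_cancel_right] at this
    exact tendsto_nhds_unique this huφ

/-! ### The infimum of a family of affine functions of a parameter -/

section

variable {ι : Type*} {A : Set ι} {e d : ι → ℝ} {l : ℝ → ℝ}

theorem monotoneOn_of_isGLB_affine (hd : ∀ i ∈ A, 0 ≤ d i)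
    (hl : ∀ s, 0 < s → IsGLB ((fun i => e i + s * d i) '' A) (l s)) : MonotoneOn l (Ioi 0) := by
  intro s hs t ht hst
  refine (hl t ht).2 ?_
  rintro _ ⟨i, hi, rfl⟩
  refine ((hl s hs).1 ⟨i, hi, rfl⟩).trans ?_
  have := mul_le_mul_of_nonneg_right hst (hd i hi)
  simp only
  linarith

/-- An infimum of affine functions is concave, and a concave function on an open interval is
continuous. -/
theorem continuousOn_of_isGLB_affine
    (hl : ∀ s, 0 < s → IsGLB ((fun i => e i + s * d i) '' A) (l s)) : ContinuousOn l (Ioi 0) := by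
  have hc : ConcaveOn ℝ (Ioi 0) l := by
    refine ⟨convex_Ioi 0, fun s hs t ht a b ha hb hab => ?_⟩
    refine (hl _ ((convex_Ioi 0) hs ht ha hb hab)).2 ?_
    rintro _ ⟨i, hi, rfl⟩
    have h1 := (hl s hs).1 ⟨i, hi, rfl⟩
    have h2 := (hl t ht).1 ⟨i, hi, rfl⟩
    simp only [smul_eq_mul] at h1 h2 ⊢
    have h3 := mul_le_mul_of_nonneg_left h1 ha
    have h4 := mul_le_mul_of_nonneg_left h2 hb
    have h5 : a * e i + b * e i = e i := by rw [← add_mul, hab, one_mul]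
    linarith
  exact hc.continuousOn isOpen_Ioi

/-- The condition is equivalent to l(s) + s² = 0 with s > 0. This function is continuous and, l
being nondecreasing, strictly increasing; one s₀ with l(s₀) < 0 is enough to locate a sign change.
-/
theorem existsUnique_sqrt_neg_eq (hd : ∀ i ∈ A, 0 ≤ d i)
    (hl : ∀ s, 0 < s → IsGLB ((fun i => e i + s * d i) '' A) (l s))
    (hneg : ∃ s, 0 < s ∧ l s < 0) :
    ∃! s, (0 < s ∧ l s < 0) ∧ Real.sqrt (-l s) = s := by
  have hmono := monotoneOn_of_isGLB_affine hd hl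
  have hcont := continuousOn_of_isGLB_affine hl
  have hiff : ∀ s, ((0 < s ∧ l s < 0) ∧ Real.sqrt (-l s) = s) ↔ 0 < s ∧ l s + s ^ 2 = 0 := by
    intro s
    constructor
    · rintro ⟨⟨h0, h1⟩, h2⟩
      refine ⟨h0, ?_⟩
      have := Real.sq_sqrt (show 0 ≤ -l s by linarith)
      rw [h2] at this
      linarith
    · rintro ⟨h0, h1⟩
      refine ⟨⟨h0, by nlinarith⟩, ?_⟩
      rw [show -l s = s ^ 2 by linarith, Real.sqrt_sq h0.le]
  simp_rw [hiff]
  obtain ⟨s₀, hs₀, hls₀⟩ := hneg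
  -- Left of s₀ monotonicity gives l(a) ≤ l(s₀), and a² ≤ -l(s₀)/4, so l(a) + a² ≤ 0. The point b
  -- below works symmetrically: b ≥ s₀ and b² ≥ -l(s₀).
  set a := min s₀ (Real.sqrt (-l s₀) / 2) with ha
  have hsq : 0 < Real.sqrt (-l s₀) := Real.sqrt_pos.2 (by linarith)
  have ha0 : 0 < a := lt_min hs₀ (by positivity)
  have hga : l a + a ^ 2 ≤ 0 := by
    have h1 : l a ≤ l s₀ := hmono ha0 hs₀ (min_le_left _ _)
    have h2 : a ≤ Real.sqrt (-l s₀) / 2 := min_le_right _ _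
    have h3 := Real.sq_sqrt (show 0 ≤ -l s₀ by linarith)
    nlinarith
  set b := s₀ + Real.sqrt (-l s₀) with hb
  have hgb : 0 ≤ l b + b ^ 2 := by
    have h1 : l s₀ ≤ l b := hmono hs₀ (show 0 < b by positivity) (by linarith)
    have h3 := Real.sq_sqrt (show 0 ≤ -l s₀ by linarith)
    nlinarith
  have hab : a ≤ b := (min_le_left _ _).trans (by linarith)
  have hg : ContinuousOn (fun s => l s + s ^ 2) (Icc a b) :=
    (hcont.mono fun s hs => ha0.trans_le hs.1).add (by fun_prop)
  obtain ⟨s, hs, hs'⟩ := intermediate_value_Icc hab hg ⟨hga, hgb⟩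
  refine ⟨s, ⟨ha0.trans_le hs.1, hs'⟩, ?_⟩
  rintro t ⟨ht0, ht⟩
  have hs0 : 0 < s := ha0.trans_le hs.1
  simp only at hs'
  rcases lt_trichotomy t s with h | h | h
  · have := hmono ht0 hs0 h.le
    nlinarith
  · exact h
  · have := hmono hs0 ht0 h.le
    nlinarith

end

/-! ### Quadratic forms given by integral densities -/

noncomputable section

theorem IsQuadFun.of_forall {V : Type*} [AddCommGroup V] [Module ℝ V] {q : V → ℝ}
    (h : ∀ a b : V, ∀ t : ℝ, q (a + t • b) = q a + t * (q (a + b) - q a - q b) + t ^ 2 * q b) :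
    IsQuadFun q := fun a b => ⟨q (a + b) - q a - q b, h a b⟩

/-- Differentiation is linear only where the components are differentiable, so the expansion along a
line holds almost everywhere and must be integrated. The cross term is q(a + b) - q(a) - q(b), hence
integrable because q is integrable at every vector. -/
theorem isQuadFun_integral {V ι : Type*} [AddCommGroup V] [Module ℝ V] [Countable ι]
    (π : V →ₗ[ℝ] ι → ℝ → ℝ) {μ : Measure ℝ} {q : ℝ → (ι → ℝ) → (ι → ℝ) → ℝ}
    (hq : ∀ r, IsQuadFun fun z : (ι → ℝ) × (ι → ℝ) => q r z.1 z.2)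
    (hd : ∀ v i, ∀ᵐ r ∂μ, DifferentiableAt ℝ (π v i) r)
    (hi : ∀ v, Integrable (fun r => q r (fun i => π v i r) fun i => deriv (π v i) r) μ) :
    IsQuadFun fun v => ∫ r, q r (fun i => π v i r) (fun i => deriv (π v i) r) ∂μ := by
  set F : V → ℝ → ℝ := fun v r => q r (fun i => π v i r) fun i => deriv (π v i) r with hF
  have hF' : ∀ a b : V, ∀ t : ℝ, ∀ᵐ r ∂μ,
      F (a + t • b) r = F a r + t * (F (a + b) r - F a r - F b r) + t ^ 2 * F b r := by
    intro a b t
    filter_upwards [ae_all_iff.2 (hd a), ae_all_iff.2 (hd b)] with r ha hb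
    have h1 : ∀ s : ℝ, F (a + s • b) r
        = q r ((fun i => π a i r) + s • fun i => π b i r)
          ((fun i => deriv (π a i) r) + s • fun i => deriv (π b i) r) := by
      intro s
      simp only [hF]
      congr 1
      · funext i
        simp
      · funext i
        have h2 : π (a + s • b) i = fun x => π a i x + s * π b i x := by
          funext x
          simp
        rw [h2, deriv_fun_add (ha i) ((hb i).const_mul s), deriv_const_mul _ (hb i)]
        simp
    obtain ⟨c, hc⟩ := hq r (fun i => π a i r, fun i => deriv (π a i) r)
      (fun i => π b i r, fun i => deriv (π b i) r)
    have h3 := h1 t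
    have h4 := h1 1
    have h5 := hc t
    have h6 := hc 1
    simp only [Prod.fst_add, Prod.snd_add, Prod.smul_fst, Prod.smul_snd] at h5 h6
    rw [one_smul] at h4
    rw [h3, h4, h5, h6]
    simp only [hF]
    ring
  have hi' : ∀ v, Integrable (F v) μ := hi
  apply IsQuadFun.of_forall
  intro a b t
  change ∫ r, F (a + t • b) r ∂μ = ∫ r, F a r ∂μ
    + t * (∫ r, F (a + b) r ∂μ - ∫ r, F a r ∂μ - ∫ r, F b r ∂μ) + t ^ 2 * ∫ r, F b r ∂μ
  have h1 : Integrable (fun r => F (a + b) r - F a r) μ := (hi' (a + b)).sub (hi' a)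
  have h2 : Integrable (fun r => t * (F (a + b) r - F a r - F b r)) μ :=
    (h1.sub (hi' b)).const_mul t
  have h3 : Integrable (fun r => F a r + t * (F (a + b) r - F a r - F b r)) μ := (hi' a).add h2
  rw [integral_congr_ae (hF' a b t), integral_add h3 ((hi' b).const_mul _),
    integral_add (hi' a) h2, integral_const_mul, integral_const_mul, integral_sub h1 (hi' b),
    integral_sub (hi' (a + b)) (hi' a)]

/-! ### Pointwise densities and their comparison with the strain -/

namespace ZPinch

/-- The squared components of the strain of the mode `(m, k)` at the radius `r`, for a displacement
with values `x` and derivatives `y`. -/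
def strainSq (m k : ℤ) (r : ℝ) (x y : Fin 3 → ℝ) : ℝ :=
  y 0 ^ 2 + (x 0 / r + m / r * x 2) ^ 2 + (k * x 1) ^ 2
    + (-y 2 + x 2 / r + m / r * x 0) ^ 2 + (y 1 + k * x 0) ^ 2 + (m / r * x 1 - k * x 2) ^ 2

/-- The integrand of `dissipation`. -/
def dissDens (P : ZPinch) (m k : ℤ) (r : ℝ) (x y : Fin 3 → ℝ) : ℝ :=
  P.ε * (2 / 9 * (-2 * y 0 + x 0 / r + m / r * x 2 - k * x 1) ^ 2
      + 2 / 9 * (y 0 - 2 * x 0 / r - 2 * m / r * x 2 - k * x 1) ^ 2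
      + 2 / 9 * (y 0 + x 0 / r + m / r * x 2 + 2 * k * x 1) ^ 2
      + (-y 2 + x 2 / r + m / r * x 0) ^ 2
      + (y 1 + k * x 0) ^ 2
      + (m / r * x 1 - k * x 2) ^ 2) * r
    + P.δ * (y 0 + x 0 / r + m / r * x 2 - k * x 1) ^ 2 * r

/-- The integrand of `normSq`. -/
def normDens (P : ZPinch) (m k : ℤ) (r : ℝ) (x y : Fin 3 → ℝ) : ℝ :=
  ((-2 * y 0 + x 0 / r + m / r * x 2 - k * x 1) ^ 2
      + (y 0 - 2 * x 0 / r - 2 * m / r * x 2 - k * x 1) ^ 2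
      + (y 0 + x 0 / r + m / r * x 2 + 2 * k * x 1) ^ 2
      + (-y 2 + x 2 / r + m / r * x 0) ^ 2
      + (y 1 + k * x 0) ^ 2
      + (m / r * x 1 - k * x 2) ^ 2
      + (y 0 + x 0 / r + m / r * x 2 - k * x 1) ^ 2
      + P.ρ r * (x 0 ^ 2 + x 1 ^ 2 + x 2 ^ 2)) * r

/-- The integrand of the non-viscous part of the plasma energy. -/
def idealDens (P : ZPinch) (m k : ℤ) (r : ℝ) (x y : Fin 3 → ℝ) : ℝ :=
  if m = 0 then
    (2 * P.dp r * x 0 ^ 2 / r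
      + P.Bθ r ^ 2 * (k * x 1 - 1 / r * (x 0 + r * y 0 - 2 * x 0)) ^ 2
      + P.γ * P.p r * (1 / r * (x 0 + r * y 0) - k * x 1) ^ 2) * r
  else
    ((m ^ 2 + k ^ 2 * r ^ 2) * (P.Bθ r / r * x 1
          + (-k * P.Bθ r * (x 0 + r * y 0) + 2 * k * P.Bθ r * x 0)
            / (m ^ 2 + k ^ 2 * r ^ 2)) ^ 2
      + P.γ * P.p r
          * (1 / r * (x 0 + r * y 0) - k * x 1 + m * x 2 / r) ^ 2) * r
    + m ^ 2 * P.Bθ r ^ 2 / (r * (m ^ 2 + k ^ 2 * r ^ 2)) * (x 0 - r * y 0) ^ 2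
    + (2 * P.dp r + m ^ 2 * P.Bθ r ^ 2 / r) * x 0 ^ 2

/-- The integrand of the vacuum energy. -/
def vacDens (m k : ℤ) (r : ℝ) (x y : Fin 1 → ℝ) : ℝ :=
  (x 0 ^ 2 + 1 / (m ^ 2 + k ^ 2 * r ^ 2) * (x 0 + r * y 0) ^ 2) * r

variable (P : ZPinch) (m k : ℤ) (r : ℝ) (x y : Fin 3 → ℝ)

theorem isQuadFun_strainSq :
    IsQuadFun fun z : (Fin 3 → ℝ) × (Fin 3 → ℝ) => strainSq m k r z.1 z.2 * r :=
  .of_forall fun a b t => by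
    simp only [strainSq, Prod.fst_add, Prod.snd_add, Prod.smul_fst, Prod.smul_snd, Pi.add_apply,
      Pi.smul_apply, smul_eq_mul]
    ring

theorem isQuadFun_dissDens :
    IsQuadFun fun z : (Fin 3 → ℝ) × (Fin 3 → ℝ) => P.dissDens m k r z.1 z.2 :=
  .of_forall fun a b t => by
    simp only [dissDens, Prod.fst_add, Prod.snd_add, Prod.smul_fst, Prod.smul_snd, Pi.add_apply,
      Pi.smul_apply, smul_eq_mul]
    ring

theorem isQuadFun_idealDens :
    IsQuadFun fun z : (Fin 3 → ℝ) × (Fin 3 → ℝ) => P.idealDens m k r z.1 z.2 :=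
  .of_forall fun a b t => by
    simp only [idealDens, Prod.fst_add, Prod.snd_add, Prod.smul_fst, Prod.smul_snd, Pi.add_apply,
      Pi.smul_apply, smul_eq_mul]
    split_ifs
    · ring
    · ring

theorem isQuadFun_vacDens :
    IsQuadFun fun z : (Fin 1 → ℝ) × (Fin 1 → ℝ) => vacDens m k r z.1 z.2 :=
  .of_forall fun a b t => by
    simp only [vacDens, Prod.fst_add, Prod.snd_add, Prod.smul_fst, Prod.smul_snd, Pi.add_apply,
      Pi.smul_apply, smul_eq_mul]
    ring

theorem strainSq_nonneg : 0 ≤ strainSq m k r x y := by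
  unfold strainSq
  positivity

theorem strainSq_add_le (x' y' : Fin 3 → ℝ) :
    strainSq m k r (x + x') (y + y') ≤ 2 * strainSq m k r x y + 2 * strainSq m k r x' y' := by
  have key : ∀ a b : ℝ, (a + b) ^ 2 ≤ 2 * a ^ 2 + 2 * b ^ 2 := fun a b => by
    nlinarith [sq_nonneg (a - b)]
  have h0 := key (y 0) (y' 0)
  have h1 := key (x 0 / r + m / r * x 2) (x' 0 / r + m / r * x' 2)
  have h2 := key (k * x 1) (k * x' 1)
  have h3 := key (-y 2 + x 2 / r + m / r * x 0) (-y' 2 + x' 2 / r + m / r * x' 0)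
  have h4 := key (y 1 + k * x 0) (y' 1 + k * x' 0)
  have h5 := key (m / r * x 1 - k * x 2) (m / r * x' 1 - k * x' 2)
  simp only [strainSq, Pi.add_apply]
  ring_nf at h0 h1 h2 h3 h4 h5 ⊢
  linarith

variable {P m k r x y}

theorem sq_radial_le_strainSq : y 0 ^ 2 ≤ strainSq m k r x y := by
  unfold strainSq
  linarith [sq_nonneg (x 0 / r + m / r * x 2), sq_nonneg (k * x 1),
    sq_nonneg (-y 2 + x 2 / r + m / r * x 0), sq_nonneg (y 1 + k * x 0),
    sq_nonneg (m / r * x 1 - k * x 2)]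

theorem sq_azimuthal_le_strainSq :
    (-y 2 + x 2 / r + m / r * x 0) ^ 2 ≤ strainSq m k r x y := by
  unfold strainSq
  linarith [sq_nonneg (x 0 / r + m / r * x 2), sq_nonneg (k * x 1), sq_nonneg (y 0),
    sq_nonneg (y 1 + k * x 0), sq_nonneg (m / r * x 1 - k * x 2)]

theorem sq_axial_le_strainSq : (y 1 + k * x 0) ^ 2 ≤ strainSq m k r x y := by
  unfold strainSq
  linarith [sq_nonneg (x 0 / r + m / r * x 2), sq_nonneg (k * x 1), sq_nonneg (y 0),
    sq_nonneg (-y 2 + x 2 / r + m / r * x 0), sq_nonneg (m / r * x 1 - k * x 2)]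

/-- Let a, b, c be the entries y₀, (x₀ + m x₂)/r, k x₁ and t = a + b - c. The three deviatoric
squares are those of t - 3a, t - 3b, t + 3c and sum to 9(a² + b² + c²) - 3t². Adding t² and using t²
≤ 3(a² + b² + c²) gives both this bound and the converse `normDens_le`. -/
theorem strainSq_le_normDens (hr : 0 ≤ r) :
    strainSq m k r x y * r + P.ρ r * (x 0 ^ 2 + x 1 ^ 2 + x 2 ^ 2) * r
      ≤ P.normDens m k r x y := by
  unfold strainSq normDens
  rw [← add_mul]
  apply mul_le_mul_of_nonneg_right _ hr
  set a := y 0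
  set b := x 0 / r + m / r * x 2 with hb
  set c := (k : ℝ) * x 1
  rw [show -2 * a + x 0 / r + m / r * x 2 - c = -2 * a + b - c by rw [hb]; ring,
    show a - 2 * x 0 / r - 2 * m / r * x 2 - c = a - 2 * b - c by rw [hb]; ring,
    show a + x 0 / r + m / r * x 2 + 2 * k * x 1 = a + b + 2 * c by rw [hb]; ring,
    show a + x 0 / r + m / r * x 2 - c = a + b - c by rw [hb]; ring]
  nlinarith [sq_nonneg (a - b), sq_nonneg (a + c), sq_nonneg (b + c)]

theorem normDens_le (hr : 0 ≤ r) :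
    P.normDens m k r x y
      ≤ 9 * (strainSq m k r x y * r + P.ρ r * (x 0 ^ 2 + x 1 ^ 2 + x 2 ^ 2) * r)
        - 8 * (P.ρ r * (x 0 ^ 2 + x 1 ^ 2 + x 2 ^ 2) * r) := by
  rw [show ∀ s t : ℝ, 9 * (s * r + t * r) - 8 * (t * r) = (9 * s + t) * r by intros; ring]
  unfold strainSq normDens
  apply mul_le_mul_of_nonneg_right _ hr
  set a := y 0
  set b := x 0 / r + m / r * x 2 with hb
  set c := (k : ℝ) * x 1
  rw [show -2 * a + x 0 / r + m / r * x 2 - c = -2 * a + b - c by rw [hb]; ring,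
    show a - 2 * x 0 / r - 2 * m / r * x 2 - c = a - 2 * b - c by rw [hb]; ring,
    show a + x 0 / r + m / r * x 2 + 2 * k * x 1 = a + b + 2 * c by rw [hb]; ring,
    show a + x 0 / r + m / r * x 2 - c = a + b - c by rw [hb]; ring]
  nlinarith [sq_nonneg (a + b - c), sq_nonneg (-y 2 + x 2 / r + m / r * x 0),
    sq_nonneg (y 1 + k * x 0), sq_nonneg (m / r * x 1 - k * x 2)]

/-- With the factor 2/9 the deviatoric squares give 2(a² + b² + c²) - (2/3)t², which vanishes when a
= b = -c. One bulk term t² turns this into 2(a² + b² + c²) + t²/3, so a positive bulk viscosity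
makes the full strain controllable. -/
theorem le_dissDens {κ : ℝ} (hκε : κ ≤ P.ε) (hκδ : κ ≤ P.δ) (hκ : 0 ≤ κ) (hr : 0 ≤ r) :
    κ * (strainSq m k r x y * r) ≤ P.dissDens m k r x y := by
  unfold dissDens strainSq
  rw [← mul_assoc, ← add_mul]
  apply mul_le_mul_of_nonneg_right _ hr
  set a := y 0
  set b := x 0 / r + m / r * x 2 with hb
  set c := (k : ℝ) * x 1
  rw [show -2 * a + x 0 / r + m / r * x 2 - c = -2 * a + b - c by rw [hb]; ring,
    show a - 2 * x 0 / r - 2 * m / r * x 2 - c = a - 2 * b - c by rw [hb]; ring,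
    show a + x 0 / r + m / r * x 2 + 2 * k * x 1 = a + b + 2 * c by rw [hb]; ring,
    show a + x 0 / r + m / r * x 2 - c = a + b - c by rw [hb]; ring]
  set X := 2 / 9 * (-2 * a + b - c) ^ 2 + 2 / 9 * (a - 2 * b - c) ^ 2 + 2 / 9 * (a + b + 2 * c) ^ 2
    + (-y 2 + x 2 / r + m / r * x 0) ^ 2 + (y 1 + k * x 0) ^ 2 + (m / r * x 1 - k * x 2) ^ 2 with hX
  have h1 : κ * X ≤ P.ε * X := mul_le_mul_of_nonneg_right hκε (by positivity)
  have h2 := mul_le_mul_of_nonneg_right hκδ (sq_nonneg (a + b - c))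
  refine le_trans ?_ (add_le_add h1 h2)
  rw [← mul_add]
  apply mul_le_mul_of_nonneg_left _ hκ
  rw [hX]
  nlinarith [sq_nonneg (a + b - c)]

theorem dissDens_nonneg (hε : 0 ≤ P.ε) (hδ : 0 ≤ P.δ) (hr : 0 ≤ r) :
    0 ≤ P.dissDens m k r x y := by
  unfold dissDens
  positivity

theorem dissDens_le (hε : 0 ≤ P.ε) (hδ : 0 ≤ P.δ) (hr : 0 ≤ r) :
    P.dissDens m k r x y ≤ (2 * P.ε + 3 * P.δ) * (strainSq m k r x y * r) := by
  unfold dissDens strainSq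
  rw [← mul_assoc, ← add_mul]
  apply mul_le_mul_of_nonneg_right _ hr
  set a := y 0
  set b := x 0 / r + m / r * x 2 with hb
  set c := (k : ℝ) * x 1
  rw [show -2 * a + x 0 / r + m / r * x 2 - c = -2 * a + b - c by rw [hb]; ring,
    show a - 2 * x 0 / r - 2 * m / r * x 2 - c = a - 2 * b - c by rw [hb]; ring,
    show a + x 0 / r + m / r * x 2 + 2 * k * x 1 = a + b + 2 * c by rw [hb]; ring,
    show a + x 0 / r + m / r * x 2 - c = a + b - c by rw [hb]; ring]
  set d := -y 2 + x 2 / r + m / r * x 0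
  set e := y 1 + k * x 0
  set f := m / r * x 1 - k * x 2
  rw [add_mul]
  apply add_le_add
  · rw [mul_comm 2 P.ε, mul_assoc]
    apply mul_le_mul_of_nonneg_left _ hε
    nlinarith [sq_nonneg (a + b - c), sq_nonneg d, sq_nonneg e, sq_nonneg f]
  · rw [mul_comm 3 P.δ, mul_assoc]
    apply mul_le_mul_of_nonneg_left _ hδ
    nlinarith [sq_nonneg (a - b), sq_nonneg (a + c), sq_nonneg (b + c), sq_nonneg d, sq_nonneg e,
      sq_nonneg f]

/-- Every other term is a square with a nonnegative coefficient. As a result only the mass of ξ can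
drive an instability, and the bound does not involve m or k. -/
theorem le_idealDens {M : ℝ} (hp : 0 ≤ P.p r) (hdp : |P.dp r| ≤ M) (hγ : 0 ≤ P.γ)
    (hr : 0 < r) : -(2 * M) * x 0 ^ 2 ≤ P.idealDens m k r x y := by
  have h1 : -(2 * M) * x 0 ^ 2 ≤ 2 * P.dp r * x 0 ^ 2 :=
    mul_le_mul_of_nonneg_right (by linarith [(abs_le.1 hdp).1]) (sq_nonneg _)
  refine h1.trans ?_
  unfold idealDens
  split_ifs with hm
  · rw [add_mul, add_mul, show 2 * P.dp r * x 0 ^ 2 / r * r = 2 * P.dp r * x 0 ^ 2 by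
      field_simp]
    rw [add_assoc]
    apply le_add_of_nonneg_right
    positivity
  · rw [add_mul (2 * P.dp r), add_comm (2 * P.dp r * x 0 ^ 2), ← add_assoc]
    apply le_add_of_nonneg_left
    positivity

/-- The coefficients that look singular at the axis are bounded because B_θ² ≤ M r; the strain pays
for the derivative and the divergence. Here the constant may depend on the mode: it only serves
integrability and continuity at a fixed (m, k). -/
theorem abs_idealDens_le {M R : ℝ} (hM : 0 ≤ M) (hp : 0 ≤ P.p r) (hpM : P.p r ≤ M)
    (hdp : |P.dp r| ≤ M) (hB : P.Bθ r ^ 2 ≤ M * r) (hγ : 0 ≤ P.γ) (hr : 0 < r) (hrR : r ≤ R) :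
    |P.idealDens m k r x y| ≤ (8 + 2 * m ^ 2 + 2 * k ^ 2 * R ^ 2 + 6 * R + 3 * P.γ) * M
      * (strainSq m k r x y * r + x 0 ^ 2 + x 1 ^ 2) := by
  set a := y 0 with ha
  set b := x 0 / r + m / r * x 2 with hb
  set c := (k : ℝ) * x 1 with hc
  set T := strainSq m k r x y with hT
  have hTle : a ^ 2 + b ^ 2 + c ^ 2 ≤ T := by
    have : T = a ^ 2 + b ^ 2 + c ^ 2 + ((-y 2 + x 2 / r + m / r * x 0) ^ 2
        + (y 1 + k * x 0) ^ 2 + (m / r * x 1 - k * x 2) ^ 2) := by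
      rw [hT, strainSq]
      ring
    rw [this]
    exact le_add_of_nonneg_right (by positivity)
  have hT0 : 0 ≤ T := strainSq_nonneg m k r x y
  have haT : a ^ 2 ≤ T := by linarith [sq_nonneg b, sq_nonneg c]
  have key : ∀ u v w : ℝ, (u + v + w) ^ 2 ≤ 3 * (u ^ 2 + v ^ 2 + w ^ 2) := fun u v w => by
    nlinarith [sq_nonneg (u - v), sq_nonneg (u - w), sq_nonneg (v - w)]
  have key' : ∀ u v : ℝ, (u + v) ^ 2 ≤ 2 * u ^ 2 + 2 * v ^ 2 := fun u v => by
    nlinarith [sq_nonneg (u - v)]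
  have h3 : (a + b - c) ^ 2 ≤ 3 * T := by
    have := key a b (-c)
    rw [neg_sq, ← sub_eq_add_neg] at this
    linarith
  have hR : 0 ≤ R := hr.le.trans hrR
  have hdpx : |2 * P.dp r * x 0 ^ 2| ≤ 2 * M * x 0 ^ 2 := by
    rw [abs_mul, abs_mul, abs_two, abs_of_nonneg (sq_nonneg (x 0))]
    gcongr
  have hdiv : |P.γ * P.p r * (a + b - c) ^ 2 * r| ≤ 3 * P.γ * M * (T * r) := by
    rw [abs_of_nonneg (by positivity)]
    calc P.γ * P.p r * (a + b - c) ^ 2 * r ≤ P.γ * M * (3 * T) * r := by gcongr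
      _ = _ := by ring
  have hTr : 0 ≤ M * (T * r) := by positivity
  have hx0 : 0 ≤ M * x 0 ^ 2 := by positivity
  have hx1 : 0 ≤ M * x 1 ^ 2 := by positivity
  have hfin : ∀ e : ℝ, e ≤ 2 * (m ^ 2 + k ^ 2 * R ^ 2) * (M * x 1 ^ 2)
      + (8 + m ^ 2) * (M * x 0 ^ 2) + (6 * R + 3 * P.γ) * (M * (T * r)) →
      e ≤ (8 + 2 * m ^ 2 + 2 * k ^ 2 * R ^ 2 + 6 * R + 3 * P.γ) * M * (T * r + x 0 ^ 2 + x 1 ^ 2) := by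
    intro e he
    refine he.trans ?_
    have h1 : 0 ≤ (8 + 6 * R + 3 * P.γ) * (M * x 1 ^ 2) := by positivity
    have h2 : 0 ≤ (m ^ 2 + 2 * k ^ 2 * R ^ 2 + 6 * R + 3 * P.γ) * (M * x 0 ^ 2) := by positivity
    have h4 : 0 ≤ (8 + 2 * m ^ 2 + 2 * k ^ 2 * R ^ 2 : ℝ) * (M * (T * r)) := by positivity
    have h5 : (8 + 2 * m ^ 2 + 2 * k ^ 2 * R ^ 2 + 6 * R + 3 * P.γ) * M
        * (T * r + x 0 ^ 2 + x 1 ^ 2) = 2 * (m ^ 2 + k ^ 2 * R ^ 2) * (M * x 1 ^ 2)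
      + (8 + m ^ 2) * (M * x 0 ^ 2) + (6 * R + 3 * P.γ) * (M * (T * r))
      + (8 + 6 * R + 3 * P.γ) * (M * x 1 ^ 2)
      + (m ^ 2 + 2 * k ^ 2 * R ^ 2 + 6 * R + 3 * P.γ) * (M * x 0 ^ 2)
      + (8 + 2 * m ^ 2 + 2 * k ^ 2 * R ^ 2 : ℝ) * (M * (T * r)) := by ring
    rw [h5]
    linarith
  have hr0 : r ≠ 0 := hr.ne'
  unfold idealDens
  apply hfin
  split_ifs with hm
  · have hb' : b = x 0 / r := by rw [hb, hm]; simp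
    have e1 : (2 * P.dp r * x 0 ^ 2 / r
        + P.Bθ r ^ 2 * (k * x 1 - 1 / r * (x 0 + r * y 0 - 2 * x 0)) ^ 2
        + P.γ * P.p r * (1 / r * (x 0 + r * y 0) - k * x 1) ^ 2) * r
        = 2 * P.dp r * x 0 ^ 2 + P.Bθ r ^ 2 * (c - a + b) ^ 2 * r
          + P.γ * P.p r * (a + b - c) ^ 2 * r := by
      rw [hb', ha, hc]
      field_simp
      ring
    rw [e1]
    have h5 : (c - a + b) ^ 2 ≤ 3 * T := by
      have := key c (-a) b
      rw [neg_sq, ← sub_eq_add_neg] at this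
      linarith
    have h6 : |P.Bθ r ^ 2 * (c - a + b) ^ 2 * r| ≤ 3 * R * (M * (T * r)) := by
      rw [abs_of_nonneg (by positivity)]
      calc P.Bθ r ^ 2 * (c - a + b) ^ 2 * r ≤ (M * R) * (3 * T) * r := by
            gcongr
            exact hB.trans (by gcongr)
        _ = _ := by ring
    have h7 : 0 ≤ 2 * (m ^ 2 + k ^ 2 * R ^ 2) * (M * x 1 ^ 2) + (6 + m ^ 2) * (M * x 0 ^ 2)
        + 3 * R * (M * (T * r)) := by positivity
    refine (abs_add_three _ _ _).trans ?_
    linarith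
  · set q : ℝ := m ^ 2 + k ^ 2 * r ^ 2 with hq
    have hq0 : 0 < q := by
      have : (m : ℝ) ≠ 0 := by exact_mod_cast hm
      positivity
    set B2 := P.Bθ r ^ 2 with hB2
    have hB20 : 0 ≤ B2 := sq_nonneg _
    -- Since -(x₀ + r y₀) + 2x₀ = x₀ - r y₀, the magnetic square involves x₁/r + k (x₀ - r y₀)/q.
    -- The quotients m²/q and k²r²/q are both at most 1, which bounds the terms divided by q.
    have e1 : (q * (P.Bθ r / r * x 1
          + (-k * P.Bθ r * (x 0 + r * y 0) + 2 * k * P.Bθ r * x 0) / q) ^ 2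
        + P.γ * P.p r * (1 / r * (x 0 + r * y 0) - k * x 1 + m * x 2 / r) ^ 2) * r
        + m ^ 2 * B2 / (r * q) * (x 0 - r * y 0) ^ 2
        + (2 * P.dp r + m ^ 2 * B2 / r) * x 0 ^ 2
        = B2 * r * q * (x 1 / r + k * (x 0 - r * a) / q) ^ 2
          + P.γ * P.p r * (a + b - c) ^ 2 * r
          + m ^ 2 * (B2 / r) / q * (x 0 - r * a) ^ 2
          + 2 * P.dp r * x 0 ^ 2 + m ^ 2 * (B2 / r) * x 0 ^ 2 := by
      rw [ha, hb, hc, hB2]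
      clear_value q
      field_simp
      ring
    rw [e1]
    have hBr : B2 / r ≤ M := by rwa [div_le_iff₀ hr]
    have hBr0 : 0 ≤ B2 / r := by positivity
    have hxa : (x 0 - r * a) ^ 2 ≤ 2 * x 0 ^ 2 + 2 * R * (T * r) := by
      have h5 : (x 0 - r * a) ^ 2 ≤ 2 * x 0 ^ 2 + 2 * (r * (a ^ 2 * r)) := by
        have := key' (x 0) (-(r * a))
        rw [neg_sq, ← sub_eq_add_neg] at this
        linarith
      have h6 : r * (a ^ 2 * r) ≤ R * (T * r) := by gcongr
      linarith
    have hmq : (m : ℝ) ^ 2 / q ≤ 1 := by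
      rw [div_le_one hq0, hq]
      exact le_add_of_nonneg_right (by positivity)
    have hkq : (k : ℝ) ^ 2 * r ^ 2 / q ≤ 1 := by
      rw [div_le_one hq0, hq]
      exact le_add_of_nonneg_left (by positivity)
    have f1 : |B2 * r * q * (x 1 / r + k * (x 0 - r * a) / q) ^ 2| ≤
        2 * (m ^ 2 + k ^ 2 * R ^ 2) * (M * x 1 ^ 2) + 2 * M * (2 * x 0 ^ 2 + 2 * R * (T * r)) := by
      rw [abs_of_nonneg (by positivity)]
      have h5 : (x 1 / r + k * (x 0 - r * a) / q) ^ 2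
          ≤ 2 * (x 1 / r) ^ 2 + 2 * (k * (x 0 - r * a) / q) ^ 2 := key' _ _
      calc B2 * r * q * (x 1 / r + k * (x 0 - r * a) / q) ^ 2
          ≤ B2 * r * q * (2 * (x 1 / r) ^ 2 + 2 * (k * (x 0 - r * a) / q) ^ 2) := by gcongr
        _ = 2 * q * (B2 / r * x 1 ^ 2) + 2 * (B2 / r) * (k ^ 2 * r ^ 2 / q * (x 0 - r * a) ^ 2) := by
          field_simp
        _ ≤ 2 * (m ^ 2 + k ^ 2 * R ^ 2) * (M * x 1 ^ 2)
            + 2 * M * (1 * (2 * x 0 ^ 2 + 2 * R * (T * r))) := by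
          have : q ≤ m ^ 2 + k ^ 2 * R ^ 2 := by rw [hq]; gcongr
          gcongr
        _ = _ := by ring
    have f2 : |m ^ 2 * (B2 / r) / q * (x 0 - r * a) ^ 2|
        ≤ M * (2 * x 0 ^ 2 + 2 * R * (T * r)) := by
      rw [abs_of_nonneg (by positivity)]
      calc m ^ 2 * (B2 / r) / q * (x 0 - r * a) ^ 2
          = m ^ 2 / q * (B2 / r) * (x 0 - r * a) ^ 2 := by ring
        _ ≤ 1 * M * (2 * x 0 ^ 2 + 2 * R * (T * r)) := by gcongr
        _ = _ := by ring
    have f3 : |m ^ 2 * (B2 / r) * x 0 ^ 2| ≤ m ^ 2 * (M * x 0 ^ 2) := by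
      rw [abs_of_nonneg (by positivity), mul_assoc]
      gcongr
    refine (abs_add_le _ _).trans ?_
    refine (add_le_add_left ((abs_add_le _ _).trans (add_le_add_left (abs_add_three _ _ _) _))
      _).trans ?_
    linarith

end ZPinch

theorem intervalIntegral_eq_integral_Ioo {a b : ℝ} (hab : a ≤ b) (f : ℝ → ℝ) :
    ∫ r in a..b, f r = ∫ r in Ioo a b, f r := by
  rw [intervalIntegral.integral_of_le hab, integral_Ioc_eq_integral_Ioo]

/-! ### Bounds on the equilibrium profiles, and displacements of finite energy -/

namespace ZPinch

variable {P : ZPinch}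

namespace Admissible

variable (hP : P.Admissible)
include hP

theorem p_continuousOn : ContinuousOn P.p (Icc 0 P.r₀) := hP.p_contDiffOn.continuousOn

theorem dp_continuousOn : ContinuousOn P.dp (Icc 0 P.r₀) :=
  hP.p_contDiffOn.continuousOn_derivWithin (uniqueDiffOn_Icc hP.r₀_pos) (by norm_num)

theorem ρ_continuousOn : ContinuousOn P.ρ (Icc 0 P.r₀) := by
  apply (hP.p_continuousOn.div_const _).rpow_const
  intro r hr
  right
  have := hP.one_lt_γ
  positivity

theorem ρ_nonneg {r : ℝ} (hr : r ∈ Icc 0 P.r₀) : 0 ≤ P.ρ r :=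
  Real.rpow_nonneg (div_nonneg (hP.p_nonneg r hr) hP.A_pos.le) _

theorem p_pos {r : ℝ} (hr : r ∈ Ico 0 P.r₀) : 0 < P.p r := by
  have hr' : r ∈ Icc 0 P.r₀ := ⟨hr.1, hr.2.le⟩
  refine lt_of_le_of_ne (hP.p_nonneg r hr') fun h => hr.2.ne ((hP.p_eq_zero_iff r hr').1 h.symm)

theorem ρ_pos {r : ℝ} (hr : r ∈ Ico 0 P.r₀) : 0 < P.ρ r :=
  Real.rpow_pos_of_pos (div_pos (hP.p_pos hr) hP.A_pos) _

theorem intervalIntegrable_sq_mul_dp {x y : ℝ} (hx : x ∈ Icc 0 P.r₀) (hy : y ∈ Icc 0 P.r₀) :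
    IntervalIntegrable (fun s => s ^ 2 * P.dp s) volume x y := by
  apply ContinuousOn.intervalIntegrable
  exact ((continuousOn_id.pow 2).mul hP.dp_continuousOn).mono
    (ordConnected_Icc.uIcc_subset hx hy)

theorem Bθ_continuousOn : ContinuousOn P.Bθ (Ioc 0 P.r₀) := by
  have h1 : ContinuousOn (fun r => ∫ s in (0 : ℝ)..r, s ^ 2 * P.dp s) (Icc 0 P.r₀) := by
    have := intervalIntegral.continuousOn_primitive_interval (μ := volume) (a := 0) (b := P.r₀)
      (f := fun s => s ^ 2 * P.dp s) (by
        rw [← intervalIntegrable_iff']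
        exact hP.intervalIntegrable_sq_mul_dp ⟨le_rfl, hP.r₀_pos.le⟩ ⟨hP.r₀_pos.le, le_rfl⟩)
    rwa [uIcc_of_le hP.r₀_pos.le] at this
  have h2 : ContinuousOn (fun r : ℝ => -(2 / r ^ 2)) (Ioc 0 P.r₀) :=
    (continuousOn_const.div (continuousOn_id.pow 2) fun r hr => (pow_pos hr.1 2).ne').neg
  exact (h2.mul (h1.mono Ioc_subset_Icc_self)).sqrt

/-- With |p'| ≤ B, the integral of s²|p'| over (0, r) is at most B r³/3, so B_θ² ≤ (2/3) B r. The
nonnegativity assumption on -∫ s² p' makes the square of the real square root equal to its argument.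
-/
theorem exists_bound : ∃ M : ℝ, 0 ≤ M ∧ (∀ r ∈ Icc 0 P.r₀, P.p r ≤ M) ∧
    (∀ r ∈ Icc 0 P.r₀, |P.dp r| ≤ M) ∧ ∀ r ∈ Ioc 0 P.r₀, P.Bθ r ^ 2 ≤ M * r := by
  obtain ⟨A, hA⟩ := isCompact_Icc.exists_bound_of_continuousOn hP.p_continuousOn
  obtain ⟨B, hB⟩ := isCompact_Icc.exists_bound_of_continuousOn hP.dp_continuousOn
  have h0 : (0 : ℝ) ∈ Icc 0 P.r₀ := ⟨le_rfl, hP.r₀_pos.le⟩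
  have hA0 : 0 ≤ A := (norm_nonneg _).trans (hA 0 h0)
  have hB0 : 0 ≤ B := (norm_nonneg _).trans (hB 0 h0)
  refine ⟨A + B, by positivity, fun r hr => ?_, fun r hr => ?_, fun r hr => ?_⟩
  · have := (Real.le_norm_self _).trans (hA r hr)
    linarith
  · have := hB r hr
    rw [Real.norm_eq_abs] at this
    linarith
  · have hr' : r ∈ Icc 0 P.r₀ := Ioc_subset_Icc_self hr
    have h1 : -∫ s in (0 : ℝ)..r, s ^ 2 * P.dp s ≤ B * r ^ 3 / 3 := by
      rw [← intervalIntegral.integral_neg]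
      have h2 : ∫ s in (0 : ℝ)..r, B * s ^ 2 = B * r ^ 3 / 3 := by
        rw [intervalIntegral.integral_const_mul, integral_pow]
        norm_num
        ring
      rw [← h2]
      apply intervalIntegral.integral_mono_on hr.1.le
        (hP.intervalIntegrable_sq_mul_dp h0 hr').neg
        ((continuous_const.mul (continuous_pow 2)).intervalIntegrable _ _)
      intro s hs
      have h3 := hB s ⟨hs.1, hs.2.trans hr.2⟩
      rw [Real.norm_eq_abs] at h3
      change -(s ^ 2 * P.dp s) ≤ B * s ^ 2
      nlinarith [(abs_le.1 h3).1, sq_nonneg s]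
    have h4 : P.Bθ r ^ 2 = 2 / r ^ 2 * -∫ s in (0 : ℝ)..r, s ^ 2 * P.dp s := by
      have h5 := hP.integral_nonneg r hr'
      have hr2 : 0 < r ^ 2 := pow_pos hr.1 2
      rw [Bθ, Real.sq_sqrt]
      · ring
      · rw [neg_mul, ← mul_neg]
        positivity
    rw [h4]
    have hr2 : 0 < r ^ 2 := pow_pos hr.1 2
    calc 2 / r ^ 2 * -∫ s in (0 : ℝ)..r, s ^ 2 * P.dp s ≤ 2 / r ^ 2 * (B * r ^ 3 / 3) := by gcongr
      _ = 2 / 3 * (B * r) := by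
        have := hr.1.ne'
        field_simp
      _ ≤ (A + B) * r := by nlinarith [mul_nonneg hB0 hr.1.le, mul_nonneg hA0 hr.1.le]

/-- The weight ρ r degenerates only at the two end points: r vanishes at the axis and ρ at r₀. -/
theorem exists_le_ρ_mul {a b : ℝ} (ha : 0 < a) (hab : a ≤ b) (hb : b < P.r₀) :
    ∃ c : ℝ, 0 < c ∧ ∀ r ∈ Icc a b, c ≤ P.ρ r * r := by
  have hc : ContinuousOn (fun r => P.ρ r * r) (Icc a b) :=
    (hP.ρ_continuousOn.mono (Icc_subset_Icc ha.le hb.le)).mul continuousOn_id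
  obtain ⟨z, hz, hmin⟩ := isCompact_Icc.exists_isMinOn (nonempty_Icc.2 hab) hc
  refine ⟨P.ρ z * z, mul_pos (hP.ρ_pos ⟨ha.le.trans hz.1, hz.2.trans_lt hb⟩) (ha.trans_le hz.1),
    fun r hr => hmin hr⟩

end Admissible

/-- Displacements with finite strain and kinetic energy. -/
structure FinEnergy (P : ZPinch) (m k : ℤ) (u : Fin 3 → ℝ → ℝ) : Prop where
  ac : ∀ i, P.LocAC (u i)
  strain : IntegrableOn (fun r => strainSq m k r (fun i => u i r) (fun i => deriv (u i) r) * r)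
    (Ioo 0 P.r₀)
  kin : IntegrableOn (fun r => P.ρ r * (u 0 r ^ 2 + u 1 r ^ 2 + u 2 r ^ 2) * r) (Ioo 0 P.r₀)

/-- The integrated squared strain. -/
def strainInt (P : ZPinch) (m k : ℤ) (u : Fin 3 → ℝ → ℝ) : ℝ :=
  ∫ r in Ioo 0 P.r₀, strainSq m k r (fun i => u i r) (fun i => deriv (u i) r) * r

/-- The integral in `J`. -/
def kinInt (P : ZPinch) (u : Fin 3 → ℝ → ℝ) : ℝ :=
  ∫ r in Ioo 0 P.r₀, P.ρ r * (u 0 r ^ 2 + u 1 r ^ 2 + u 2 r ^ 2) * r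

theorem strainInt_nonneg (m k : ℤ) (u : Fin 3 → ℝ → ℝ) : 0 ≤ P.strainInt m k u :=
  setIntegral_nonneg measurableSet_Ioo fun _ hr => mul_nonneg (strainSq_nonneg _ _ _ _ _) hr.1.le

theorem kinInt_nonneg (hP : P.Admissible) (u : Fin 3 → ℝ → ℝ) : 0 ≤ P.kinInt u :=
  setIntegral_nonneg measurableSet_Ioo fun r hr => by
    have h1 := hr.1
    have h2 := hP.ρ_nonneg (r := r) ⟨hr.1.le, hr.2.le⟩
    positivity

section Measurability

variable {u : Fin 3 → ℝ → ℝ} (hu : ∀ i, P.LocAC (u i)) (m k : ℤ)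
include hu

theorem aemeasurable_of_locAC (i : Fin 3) : AEMeasurable (u i) (volume.restrict (Ioo 0 P.r₀)) :=
  (aestronglyMeasurable_of_locAC (hu i)).aemeasurable

theorem aemeasurable_strainSq : AEMeasurable
    (fun r => strainSq m k r (fun i => u i r) (fun i => deriv (u i) r) * r)
    (volume.restrict (Ioo 0 P.r₀)) := by
  have h0 := aemeasurable_of_locAC hu 0
  have h1 := aemeasurable_of_locAC hu 1
  have h2 := aemeasurable_of_locAC hu 2
  have h3 := (measurable_deriv (u 0)).aemeasurable (μ := volume.restrict (Ioo 0 P.r₀))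
  have h4 := (measurable_deriv (u 1)).aemeasurable (μ := volume.restrict (Ioo 0 P.r₀))
  have h5 := (measurable_deriv (u 2)).aemeasurable (μ := volume.restrict (Ioo 0 P.r₀))
  unfold strainSq
  fun_prop

theorem aemeasurable_dissDens : AEMeasurable
    (fun r => P.dissDens m k r (fun i => u i r) (fun i => deriv (u i) r))
    (volume.restrict (Ioo 0 P.r₀)) := by
  have h0 := aemeasurable_of_locAC hu 0
  have h1 := aemeasurable_of_locAC hu 1
  have h2 := aemeasurable_of_locAC hu 2
  have h3 := (measurable_deriv (u 0)).aemeasurable (μ := volume.restrict (Ioo 0 P.r₀))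
  have h4 := (measurable_deriv (u 1)).aemeasurable (μ := volume.restrict (Ioo 0 P.r₀))
  have h5 := (measurable_deriv (u 2)).aemeasurable (μ := volume.restrict (Ioo 0 P.r₀))
  unfold dissDens
  fun_prop

theorem aemeasurable_idealDens (hP : P.Admissible) : AEMeasurable
    (fun r => P.idealDens m k r (fun i => u i r) (fun i => deriv (u i) r))
    (volume.restrict (Ioo 0 P.r₀)) := by
  have h0 := aemeasurable_of_locAC hu 0
  have h1 := aemeasurable_of_locAC hu 1
  have h2 := aemeasurable_of_locAC hu 2
  have h3 := (measurable_deriv (u 0)).aemeasurable (μ := volume.restrict (Ioo 0 P.r₀))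
  have h4 := (measurable_deriv (u 1)).aemeasurable (μ := volume.restrict (Ioo 0 P.r₀))
  have h5 := (measurable_deriv (u 2)).aemeasurable (μ := volume.restrict (Ioo 0 P.r₀))
  have h6 := (hP.Bθ_continuousOn.mono Ioo_subset_Ioc_self).aemeasurable
    (μ := volume) measurableSet_Ioo
  have h7 := (hP.p_continuousOn.mono Ioo_subset_Icc_self).aemeasurable
    (μ := volume) measurableSet_Ioo
  have h8 := (hP.dp_continuousOn.mono Ioo_subset_Icc_self).aemeasurable
    (μ := volume) measurableSet_Ioo
  unfold idealDens
  split_ifs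
  · fun_prop
  · fun_prop

theorem aemeasurable_kin (hP : P.Admissible) : AEMeasurable
    (fun r => P.ρ r * (u 0 r ^ 2 + u 1 r ^ 2 + u 2 r ^ 2) * r)
    (volume.restrict (Ioo 0 P.r₀)) := by
  have h0 := aemeasurable_of_locAC hu 0
  have h1 := aemeasurable_of_locAC hu 1
  have h2 := aemeasurable_of_locAC hu 2
  have h3 := (hP.ρ_continuousOn.mono Ioo_subset_Icc_self).aemeasurable
    (μ := volume) measurableSet_Ioo
  fun_prop

end Measurability

/-! ### Square integrability of ξ and η from the strain -/

namespace FinEnergy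

variable {m k : ℤ} {u : Fin 3 → ℝ → ℝ}

theorem integrable_deriv_zero (hu : P.FinEnergy m k u) :
    IntegrableOn (fun r => deriv (u 0) r ^ 2 * r) (Ioo 0 P.r₀) := by
  refine Integrable.mono' hu.strain ?_ ?_
  · exact (((measurable_deriv _).pow_const 2).mul measurable_id).aestronglyMeasurable
  · filter_upwards [ae_restrict_mem measurableSet_Ioo] with r hr
    rw [Real.norm_of_nonneg (mul_nonneg (sq_nonneg _) hr.1.le)]
    apply mul_le_mul_of_nonneg_right _ hr.1.le
    exact sq_radial_le_strainSq (x := fun i => u i r) (y := fun i => deriv (u i) r)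

theorem intervalIntegrable_deriv_zero (hP : P.Admissible) (hu : P.FinEnergy m k u) :
    IntervalIntegrable (fun r => deriv (u 0) r ^ 2 * r) volume 0 P.r₀ :=
  (intervalIntegrable_iff_integrableOn_Ioo_of_le hP.r₀_pos.le).2 hu.integrable_deriv_zero

theorem integral_deriv_zero_le (hP : P.Admissible) (hu : P.FinEnergy m k u) :
    ∫ r in (0 : ℝ)..P.r₀, deriv (u 0) r ^ 2 * r ≤ P.strainInt m k u := by
  rw [intervalIntegral_eq_integral_Ioo hP.r₀_pos.le]
  apply setIntegral_mono_on hu.integrable_deriv_zero hu.strain measurableSet_Ioo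
  intro r hr
  apply mul_le_mul_of_nonneg_right _ hr.1.le
  simp only [strainSq]
  nlinarith [sq_nonneg (u 0 r / r + m / r * u 2 r), sq_nonneg (k * u 1 r),
    sq_nonneg (-deriv (u 2) r + u 2 r / r + m / r * u 0 r),
    sq_nonneg (deriv (u 1) r + k * u 0 r), sq_nonneg (m / r * u 1 r - k * u 2 r)]

theorem integrable_sq_zero (hP : P.Admissible) (hu : P.FinEnergy m k u) :
    IntegrableOn (fun r => u 0 r ^ 2) (Ioo 0 P.r₀) :=
  (intervalIntegrable_iff_integrableOn_Ioo_of_le hP.r₀_pos.le).1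
    (intervalIntegrable_sq_of_deriv hP.r₀_pos (hu.ac 0) (hu.intervalIntegrable_deriv_zero hP))

/-- Split η' = (η' + kξ) - kξ; the first part is a strain component. -/
theorem deriv_one_le {r : ℝ} (hr : r ∈ Ioo 0 P.r₀) : deriv (u 1) r ^ 2 * r ≤
    2 * (strainSq m k r (fun i => u i r) (fun i => deriv (u i) r) * r)
      + 2 * k ^ 2 * P.r₀ * u 0 r ^ 2 := by
  have h1 : (deriv (u 1) r + k * u 0 r) ^ 2
      ≤ strainSq m k r (fun i => u i r) (fun i => deriv (u i) r) := by
    exact sq_axial_le_strainSq (x := fun i => u i r) (y := fun i => deriv (u i) r)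
  have h2 : deriv (u 1) r ^ 2 ≤ 2 * (deriv (u 1) r + k * u 0 r) ^ 2 + 2 * (k * u 0 r) ^ 2 := by
    nlinarith [sq_nonneg (deriv (u 1) r + 2 * (k * u 0 r))]
  have h3 : (k * u 0 r) ^ 2 * r ≤ (k * u 0 r) ^ 2 * P.r₀ :=
    mul_le_mul_of_nonneg_left hr.2.le (sq_nonneg _)
  have h4 := mul_le_mul_of_nonneg_right h1 hr.1.le
  have h5 := mul_le_mul_of_nonneg_right h2 hr.1.le
  nlinarith

theorem integrable_deriv_one (hP : P.Admissible) (hu : P.FinEnergy m k u) :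
    IntegrableOn (fun r => deriv (u 1) r ^ 2 * r) (Ioo 0 P.r₀) := by
  refine Integrable.mono' ((hu.strain.const_mul 2).add
    ((hu.integrable_sq_zero hP).const_mul (2 * k ^ 2 * P.r₀))) ?_ ?_
  · exact (((measurable_deriv _).pow_const 2).mul measurable_id).aestronglyMeasurable
  · filter_upwards [ae_restrict_mem measurableSet_Ioo] with r hr
    rw [Real.norm_of_nonneg (mul_nonneg (sq_nonneg _) hr.1.le)]
    exact deriv_one_le hr

theorem intervalIntegrable_deriv_one (hP : P.Admissible) (hu : P.FinEnergy m k u) :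
    IntervalIntegrable (fun r => deriv (u 1) r ^ 2 * r) volume 0 P.r₀ :=
  (intervalIntegrable_iff_integrableOn_Ioo_of_le hP.r₀_pos.le).2 (hu.integrable_deriv_one hP)

theorem integral_deriv_one_le (hP : P.Admissible) (hu : P.FinEnergy m k u) :
    ∫ r in (0 : ℝ)..P.r₀, deriv (u 1) r ^ 2 * r ≤ 2 * P.strainInt m k u
      + 2 * k ^ 2 * P.r₀ * ∫ r in (0 : ℝ)..P.r₀, u 0 r ^ 2 := by
  rw [intervalIntegral_eq_integral_Ioo hP.r₀_pos.le, intervalIntegral_eq_integral_Ioo hP.r₀_pos.le,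
    strainInt, ← integral_const_mul, ← integral_const_mul, ← integral_add (hu.strain.const_mul 2)
    ((hu.integrable_sq_zero hP).const_mul _)]
  apply setIntegral_mono_on (hu.integrable_deriv_one hP) ((hu.strain.const_mul 2).add
    ((hu.integrable_sq_zero hP).const_mul (2 * k ^ 2 * P.r₀))) measurableSet_Ioo
  intro r hr
  exact deriv_one_le hr

theorem integrable_sq_one (hP : P.Admissible) (hu : P.FinEnergy m k u) :
    IntegrableOn (fun r => u 1 r ^ 2) (Ioo 0 P.r₀) :=
  (intervalIntegrable_iff_integrableOn_Ioo_of_le hP.r₀_pos.le).1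
    (intervalIntegrable_sq_of_deriv hP.r₀_pos (hu.ac 1) (hu.intervalIntegrable_deriv_one hP))

end FinEnergy

theorem exists_integral_sq_le_kinInt (hP : P.Admissible) {a b : ℝ} (ha : 0 < a) (hab : a ≤ b)
    (hb : b < P.r₀) : ∃ C : ℝ, 0 ≤ C ∧ ∀ (m k : ℤ) (u : Fin 3 → ℝ → ℝ), P.FinEnergy m k u →
      ∀ i, ∫ r in a..b, u i r ^ 2 ≤ C * P.kinInt u := by
  obtain ⟨c, hc, hcρ⟩ := hP.exists_le_ρ_mul ha hab hb
  refine ⟨1 / c, by positivity, fun m k u hu i => ?_⟩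
  have h1 : c * (∫ r in a..b, u i r ^ 2) ≤ P.kinInt u := by
    rw [← intervalIntegral.integral_const_mul, intervalIntegral_eq_integral_Ioo hab]
    have hsub : Ioo a b ⊆ Ioo 0 P.r₀ := Ioo_subset_Ioo ha.le hb.le
    calc ∫ r in Ioo a b, c * u i r ^ 2
        ≤ ∫ r in Ioo a b, P.ρ r * (u 0 r ^ 2 + u 1 r ^ 2 + u 2 r ^ 2) * r := by
          apply setIntegral_mono_on _ (hu.kin.mono_set hsub) measurableSet_Ioo
          · intro r hr
            have h2 := hcρ r (Ioo_subset_Icc_self hr)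
            have h3 : u i r ^ 2 ≤ u 0 r ^ 2 + u 1 r ^ 2 + u 2 r ^ 2 := by
              have h0 := sq_nonneg (u 0 r)
              have h1 := sq_nonneg (u 1 r)
              have h2 := sq_nonneg (u 2 r)
              fin_cases i <;> simp only [Fin.zero_eta, Fin.mk_one, Fin.reduceFinMk] <;> linarith
            calc c * u i r ^ 2 ≤ P.ρ r * r * (u 0 r ^ 2 + u 1 r ^ 2 + u 2 r ^ 2) := by
                  gcongr
                  exact hc.le.trans h2
              _ = _ := by ring
          · rw [← intervalIntegrable_iff_integrableOn_Ioo_of_le hab]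
            exact (intervalIntegrable_sq_of_locAC (hu.ac i) ha hab hb.le).const_mul c
      _ ≤ P.kinInt u := by
          apply setIntegral_mono_set hu.kin _ (Eventually.of_forall hsub)
          filter_upwards [ae_restrict_mem measurableSet_Ioo] with r hr
          have h1 := hr.1
          have h2 := hP.ρ_nonneg (r := r) ⟨hr.1.le, hr.2.le⟩
          simp only [Pi.zero_apply]
          positivity
  rw [div_mul_eq_mul_div, one_mul, le_div_iff₀ hc]
  linarith

/-- The edges are charged to the strain through ξ', and the interior to the kinetic energy through
the lower bound on ρ r. Neither step involves the mode, so C depends on δ only; this uniformity is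
what the decay of the growth rates uses for the lower bound. -/
theorem exists_integral_sq_zero_le (hP : P.Admissible) {δ : ℝ} (hδ : 0 < δ) :
    ∃ C : ℝ, 0 ≤ C ∧ ∀ (m k : ℤ) (u : Fin 3 → ℝ → ℝ), P.FinEnergy m k u →
      ∫ r in (0 : ℝ)..P.r₀, u 0 r ^ 2 ≤ δ * P.strainInt m k u + C * P.kinInt u := by
  obtain ⟨a, b, C, ha, hab, hb, hC, h⟩ := exists_integral_sq_le hP.r₀_pos hδ
  obtain ⟨C', hC', h'⟩ := exists_integral_sq_le_kinInt hP ha hab.le hb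
  refine ⟨C * C', by positivity, fun m k u hu => ?_⟩
  refine (h (u 0) (hu.ac 0) (hu.intervalIntegrable_deriv_zero hP)).trans ?_
  rw [mul_assoc]
  have h1 := hu.integral_deriv_zero_le hP
  have h2 := h' m k u hu 0
  gcongr

theorem exists_integral_sq_one_le (hP : P.Admissible) (m k : ℤ) :
    ∃ C : ℝ, 0 ≤ C ∧ ∀ u : Fin 3 → ℝ → ℝ, P.FinEnergy m k u →
      ∫ r in (0 : ℝ)..P.r₀, u 1 r ^ 2 ≤ C * (P.strainInt m k u + P.kinInt u) := by
  obtain ⟨a, b, C, ha, hab, hb, hC, h⟩ := exists_integral_sq_le hP.r₀_pos one_pos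
  obtain ⟨C', hC', h'⟩ := exists_integral_sq_le_kinInt hP ha hab.le hb
  obtain ⟨C₂, hC₂, h₂⟩ := exists_integral_sq_zero_le hP one_pos
  have hR := hP.r₀_pos
  refine ⟨2 + 2 * k ^ 2 * P.r₀ * (1 + C₂) + C * C', by positivity, fun u hu => ?_⟩
  have h3 := h (u 1) (hu.ac 1) (hu.intervalIntegrable_deriv_one hP)
  have h4 := hu.integral_deriv_one_le hP
  have h5 := mul_le_mul_of_nonneg_left (h' m k u hu 1) hC
  have h6 := mul_le_mul_of_nonneg_left (h₂ m k u hu)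
    (show (0 : ℝ) ≤ 2 * k ^ 2 * P.r₀ by positivity)
  have h7 := strainInt_nonneg (P := P) m k u
  have h8 := kinInt_nonneg hP u
  have h9 : 0 ≤ (2 * k ^ 2 * P.r₀ * C₂) * P.strainInt m k u := by positivity
  have h10 : 0 ≤ (C * C') * P.strainInt m k u := by positivity
  have h11 : 0 ≤ (2 + 2 * k ^ 2 * P.r₀) * P.kinInt u := by positivity
  linarith

theorem abs_mul_le_half_add (p q : ℝ) : |p * q| ≤ p ^ 2 / 2 + q ^ 2 / 2 := by
  rw [abs_le]
  constructor <;> nlinarith [sq_nonneg (p + q), sq_nonneg (p - q)]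

/-- Here n plays the role of k or m. The hypothesis says that nχξ² equals ψξu_i' up to terms that
strain and masses control; integration by parts moves the derivative from u_i to ψξ, so the left
side is bounded by a constant that no longer contains n. -/
theorem exists_mul_integral_le (hP : P.Admissible) {a b A : ℝ} (ha : 0 < a) (hab : a < b)
    (hb : b < P.r₀) (hA : 0 ≤ A) {χ ψ : ℝ → ℝ} (hχ : Continuous χ) (hψ : ContDiff ℝ 1 ψ)
    (hψa : ψ a = 0) (hψb : ψ b = 0) (i : Fin 3) :
    ∃ D : ℝ, 0 ≤ D ∧ ∀ (m k : ℤ) (u : Fin 3 → ℝ → ℝ), P.FinEnergy m k u → ∀ n : ℝ,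
      (∀ r ∈ Ioo a b, |n * (χ r * u 0 r ^ 2) - ψ r * u 0 r * deriv (u i) r| ≤
        A * (u 0 r ^ 2 + u i r ^ 2
          + strainSq m k r (fun i => u i r) (fun i => deriv (u i) r) * r)) →
      |n * ∫ r in a..b, χ r * u 0 r ^ 2| ≤ D * (P.strainInt m k u + P.kinInt u) := by
  obtain ⟨C, hC, h⟩ := abs_integral_mul_mul_deriv_le hab.le hψ hψa hψb
  obtain ⟨C', hC', h'⟩ := exists_integral_sq_le_kinInt hP ha hab.le hb
  refine ⟨C * (2 * C' + 1 / a) + A * (2 * C' + 1), by positivity, fun m k u hu n hn => ?_⟩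
  set S : ℝ → ℝ := fun r => strainSq m k r (fun i => u i r) (fun i => deriv (u i) r) * r with hS
  have hsub : Ioo a b ⊆ Ioo 0 P.r₀ := Ioo_subset_Ioo ha.le hb.le
  have hac : ∀ j, AbsolutelyContinuousOnInterval (u j) a b := fun j =>
    (hu.ac j a ⟨ha, hab.trans hb⟩).mono (by
      rw [uIcc_of_le hab.le, uIcc_of_le (hab.trans hb).le]
      exact Icc_subset_Icc_right hb.le)
  have hsq := fun j => intervalIntegrable_sq_of_locAC (hu.ac j) ha hab.le hb.le
  have hSi : IntervalIntegrable S volume a b :=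
    (intervalIntegrable_iff_integrableOn_Ioo_of_le hab.le).2 (hu.strain.mono_set hsub)
  have hST : ∫ r in a..b, S r ≤ P.strainInt m k u := by
    rw [intervalIntegral_eq_integral_Ioo hab.le]
    apply setIntegral_mono_set hu.strain _ (Eventually.of_forall hsub)
    filter_upwards [ae_restrict_mem measurableSet_Ioo] with r hr
    exact mul_nonneg (strainSq_nonneg _ _ _ _ _) hr.1.le
  have hdle : ∀ r ∈ Ioo a b, deriv (u 0) r ^ 2 ≤ 1 / a * S r := by
    intro r hr
    have h1 : deriv (u 0) r ^ 2 ≤ strainSq m k r (fun i => u i r) (fun i => deriv (u i) r) := by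
      exact sq_radial_le_strainSq (x := fun i => u i r) (y := fun i => deriv (u i) r)
    have h2 : 0 ≤ strainSq m k r (fun i => u i r) (fun i => deriv (u i) r) :=
      strainSq_nonneg _ _ _ _ _
    rw [div_mul_eq_mul_div, one_mul, le_div_iff₀ ha]
    exact mul_le_mul h1 hr.1.le ha.le h2
  have hdi : IntervalIntegrable (fun r => deriv (u 0) r ^ 2) volume a b := by
    rw [intervalIntegrable_iff_integrableOn_Ioo_of_le hab.le]
    refine Integrable.mono' ((hu.strain.mono_set hsub).const_mul (1 / a))
      ((measurable_deriv _).pow_const 2).aestronglyMeasurable ?_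
    filter_upwards [ae_restrict_mem measurableSet_Ioo] with r hr
    rw [Real.norm_of_nonneg (sq_nonneg _)]
    exact hdle r hr
  have hd : ∫ r in a..b, deriv (u 0) r ^ 2 ≤ 1 / a * P.strainInt m k u := by
    have h1 : ∫ r in a..b, deriv (u 0) r ^ 2 ≤ ∫ r in a..b, 1 / a * S r :=
      intervalIntegral.integral_mono_on_of_le_Ioo hab.le hdi (hSi.const_mul _) hdle
    rw [intervalIntegral.integral_const_mul] at h1
    refine h1.trans ?_
    gcongr
  have hχi : IntervalIntegrable (fun r => n * (χ r * u 0 r ^ 2)) volume a b :=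
    ((hsq 0).continuousOn_mul hχ.continuousOn).const_mul n
  have hψi : IntervalIntegrable (fun r => ψ r * u 0 r * deriv (u i) r) volume a b :=
    (hac i).intervalIntegrable_deriv.continuousOn_mul
      (hψ.continuous.continuousOn.mul (hac 0).continuousOn)
  have h1 := h (u 0) (u i) (hac 0) (hac i) hdi
  have h2 : |∫ r in a..b, (n * (χ r * u 0 r ^ 2) - ψ r * u 0 r * deriv (u i) r)| ≤
      A * ((∫ r in a..b, u 0 r ^ 2) + (∫ r in a..b, u i r ^ 2) + ∫ r in a..b, S r) := by
    rw [← intervalIntegral.integral_add (hsq 0) (hsq i),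
      ← intervalIntegral.integral_add ((hsq 0).add (hsq i)) hSi,
      ← intervalIntegral.integral_const_mul]
    refine (intervalIntegral.abs_integral_le_integral_abs hab.le).trans ?_
    exact intervalIntegral.integral_mono_on_of_le_Ioo hab.le (hχi.sub hψi).abs
      ((((hsq 0).add (hsq i)).add hSi).const_mul A) hn
  rw [intervalIntegral.integral_sub hχi hψi, intervalIntegral.integral_const_mul] at h2
  have h3 := h' m k u hu 0
  have h4 := h' m k u hu i
  have hT0 := strainInt_nonneg (P := P) m k u
  have hK0 := kinInt_nonneg hP u
  set I := n * ∫ r in a..b, χ r * u 0 r ^ 2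
  set I' := ∫ r in a..b, ψ r * u 0 r * deriv (u i) r
  set T := P.strainInt m k u
  set K := P.kinInt u
  have h5 : |I| ≤ |I - I'| + |I'| := by
    have := abs_add_le (I - I') I'
    rwa [sub_add_cancel] at this
  have h6 : |I'| ≤ C * (2 * C' * K + 1 / a * T) := by
    exact h1.trans (mul_le_mul_of_nonneg_left (by linarith) hC)
  have h7 : |I - I'| ≤ A * (2 * C' * K + T) := by
    exact h2.trans (mul_le_mul_of_nonneg_left (by linarith) hA)
  have h8 : 0 ≤ C * (2 * C' * T + 1 / a * K) + A * (2 * C' * T + K) := by positivity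
  linarith

set_option maxHeartbeats 1000000 in
/-- For large `|m|` or `|k|` the strain and the kinetic energy control `ξ` in `L²` with a small
constant. -/
theorem exists_integral_sq_zero_le_of_large (hP : P.Admissible) {δ : ℝ} (hδ : 0 < δ) :
    ∃ N : ℕ, ∀ m k : ℤ, ((N : ℤ) ≤ |m| ∨ (N : ℤ) ≤ |k|) → ∀ u : Fin 3 → ℝ → ℝ,
      P.FinEnergy m k u →
      ∫ r in (0 : ℝ)..P.r₀, u 0 r ^ 2 ≤ δ * (P.strainInt m k u + P.kinInt u) := by
  obtain ⟨a, b, C, ha, hab, hb, hC, h⟩ := exists_integral_sq_le hP.r₀_pos (half_pos hδ)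
  set a' := a / 2 with ha'
  set b' := (b + P.r₀) / 2 with hb'
  have ha0 : 0 < a' := by positivity
  have hab' : a' < b' := by linarith
  have hb0 : b' < P.r₀ := by linarith
  have hR := hP.r₀_pos
  -- A parabola serves as cutoff: it vanishes at the ends of the enlarged interval [a', b'], which
  -- is still compact in (0, r₀), and it is at least (a - a')(b' - b) on [a, b].
  set χ : ℝ → ℝ := fun r => (r - a') * (b' - r) with hχ
  set A := (b' - a') ^ 2 with hA
  have hχA : ∀ r ∈ Ioo a' b', 0 ≤ χ r ∧ χ r ≤ A := by
    intro r hr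
    have h1 : 0 < r - a' := sub_pos.2 hr.1
    have h2 : 0 < b' - r := sub_pos.2 hr.2
    refine ⟨mul_nonneg h1.le h2.le, ?_⟩
    change (r - a') * (b' - r) ≤ (b' - a') ^ 2
    rw [sq]
    apply mul_le_mul <;> linarith [hr.1, hr.2]
  -- The axial strain L = η' + kξ gives kχξ² + χξη' = χξL, hence the sign in ψ = -χ.
  obtain ⟨D₁, hD₁, h₁⟩ := exists_mul_integral_le hP (A := A * (1 + 1 / a')) ha0 hab' hb0
    (by positivity) (χ := χ) (ψ := fun r => -χ r) (by fun_prop) (by fun_prop) (by simp [hχ])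
    (by simp [hχ]) 1
  -- The azimuthal strain L = -ζ' + ζ/r + mξ/r gives mξ = rL + rζ' - ζ, hence the factor r in ψ.
  obtain ⟨D₂, hD₂, h₂⟩ := exists_mul_integral_le hP (A := A * (1 + P.r₀)) ha0 hab' hb0
    (by positivity) (χ := χ) (ψ := fun r => χ r * r) (by fun_prop) (by fun_prop) (by simp [hχ])
    (by simp [hχ]) 2
  set c := (a - a') * (b' - b) with hc
  have hc0 : 0 < c := mul_pos (by linarith) (by linarith)
  -- Chosen so that the interior contribution C(D₁ + D₂)/((N + 1)c) is at most δ/2; the edges use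
  -- the other half.
  obtain ⟨N, hN⟩ := exists_nat_gt (2 * (C * (D₁ + D₂)) / (c * δ))
  refine ⟨N + 1, fun m k hmk u hu => ?_⟩
  set I := ∫ r in a'..b', χ r * u 0 r ^ 2 with hI
  have hT0 := strainInt_nonneg (P := P) m k u
  have hK0 := kinInt_nonneg hP u
  have hI0 : 0 ≤ I := by
    rw [hI, intervalIntegral_eq_integral_Ioo hab'.le]
    exact setIntegral_nonneg measurableSet_Ioo fun r hr =>
      mul_nonneg (hχA r hr).1 (sq_nonneg _)
  have hk : |(k : ℝ)| * I ≤ D₁ * (P.strainInt m k u + P.kinInt u) := by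
    have := h₁ m k u hu k fun r hr => by
      have hr0 : 0 < r := ha0.trans hr.1
      set L := deriv (u 1) r + k * u 0 r with hL
      set S := strainSq m k r (fun i => u i r) (fun i => deriv (u i) r) with hS
      have h3 : L ^ 2 ≤ S := by
        exact sq_axial_le_strainSq (x := fun i => u i r) (y := fun i => deriv (u i) r)
      have hS0 : 0 ≤ S := strainSq_nonneg _ _ _ _ _
      have h4 : S ≤ 1 / a' * (S * r) := by
        rw [div_mul_eq_mul_div, one_mul, le_div_iff₀ ha0]
        exact mul_le_mul_of_nonneg_left hr.1.le hS0
      have e : (k : ℝ) * (χ r * u 0 r ^ 2) - -χ r * u 0 r * deriv (u 1) r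
          = χ r * (u 0 r * L) := by rw [hL]; ring
      rw [e, abs_mul, abs_of_nonneg (hχA r hr).1, mul_assoc A]
      refine mul_le_mul (hχA r hr).2 ?_ (abs_nonneg _) (by positivity)
      refine (abs_mul_le_half_add _ _).trans ?_
      have h5 : 0 ≤ 1 / a' * (u 0 r ^ 2 + u 1 r ^ 2) := by positivity
      have h6 : 0 ≤ S * r := by positivity
      linarith [sq_nonneg (u 1 r), sq_nonneg (u 0 r)]
    rwa [abs_mul, abs_of_nonneg hI0] at this
  have hm : |(m : ℝ)| * I ≤ D₂ * (P.strainInt m k u + P.kinInt u) := by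
    have := h₂ m k u hu m fun r hr => by
      have hr0 : 0 < r := ha0.trans hr.1
      have hrR : r ≤ P.r₀ := (hr.2.trans hb0).le
      set L := -deriv (u 2) r + u 2 r / r + m / r * u 0 r with hL
      set S := strainSq m k r (fun i => u i r) (fun i => deriv (u i) r) with hS
      have h3 : L ^ 2 ≤ S := by
        exact sq_azimuthal_le_strainSq (x := fun i => u i r) (y := fun i => deriv (u i) r)
      have hS0 : 0 ≤ S := strainSq_nonneg _ _ _ _ _
      have h4 : (r * L) ^ 2 ≤ P.r₀ * (S * r) := by
        calc (r * L) ^ 2 = r * (L ^ 2 * r) := by ring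
          _ ≤ P.r₀ * (S * r) := by gcongr
      have e : (m : ℝ) * (χ r * u 0 r ^ 2) - χ r * r * u 0 r * deriv (u 2) r
          = χ r * (u 0 r * (r * L) - u 0 r * u 2 r) := by
        rw [hL]
        field_simp
        ring
      rw [e, abs_mul, abs_of_nonneg (hχA r hr).1, mul_assoc A]
      refine mul_le_mul (hχA r hr).2 ?_ (abs_nonneg _) (by positivity)
      have h5 := abs_mul_le_half_add (u 0 r) (r * L)
      have h6 := abs_mul_le_half_add (u 0 r) (u 2 r)
      have h7 := abs_sub (u 0 r * (r * L)) (u 0 r * u 2 r)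
      have h8 : 0 ≤ P.r₀ * (u 0 r ^ 2 + u 2 r ^ 2) := by positivity
      have h9 : 0 ≤ S * r := by positivity
      have h10 : 0 ≤ P.r₀ * (S * r) := by positivity
      linarith [sq_nonneg (u 2 r)]
    rwa [abs_mul, abs_of_nonneg hI0] at this
  have hNI : (N + 1 : ℝ) * I ≤ (D₁ + D₂) * (P.strainInt m k u + P.kinInt u) := by
    have h3 : 0 ≤ D₁ * (P.strainInt m k u + P.kinInt u) := by positivity
    have h4 : 0 ≤ D₂ * (P.strainInt m k u + P.kinInt u) := by positivity
    rcases hmk with hm' | hk'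
    · have : (N + 1 : ℝ) ≤ |(m : ℝ)| := by exact_mod_cast hm'
      have := mul_le_mul_of_nonneg_right this hI0
      linarith
    · have : (N + 1 : ℝ) ≤ |(k : ℝ)| := by exact_mod_cast hk'
      have := mul_le_mul_of_nonneg_right this hI0
      linarith
  have hcI : c * ∫ r in a..b, u 0 r ^ 2 ≤ I := by
    rw [← intervalIntegral.integral_const_mul]
    have hi : IntervalIntegrable (fun r => χ r * u 0 r ^ 2) volume a' b' :=
      (intervalIntegrable_sq_of_locAC (hu.ac 0) ha0 hab'.le hb0.le).continuousOn_mul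
        (by fun_prop)
    have hsub : uIcc a b ⊆ uIcc a' b' := by
      rw [uIcc_of_le hab.le, uIcc_of_le hab'.le]
      exact Icc_subset_Icc (by linarith) (by linarith)
    calc ∫ r in a..b, c * u 0 r ^ 2 ≤ ∫ r in a..b, χ r * u 0 r ^ 2 := by
          apply intervalIntegral.integral_mono_on hab.le
            ((intervalIntegrable_sq_of_locAC (hu.ac 0) ha hab.le hb.le).const_mul c)
            (hi.mono_set hsub)
          intro r hr
          apply mul_le_mul_of_nonneg_right _ (sq_nonneg _)
          change (a - a') * (b' - b) ≤ (r - a') * (b' - r)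
          apply mul_le_mul <;> linarith [hr.1, hr.2]
      _ ≤ I := by
          rw [hI]
          apply intervalIntegral.integral_mono_interval (by linarith) hab.le (by linarith) _ hi
          rw [← restrict_Ioo_eq_restrict_Ioc]
          filter_upwards [ae_restrict_mem measurableSet_Ioo] with r hr
          exact mul_nonneg (hχA r hr).1 (sq_nonneg _)
  set J := ∫ r in a..b, u 0 r ^ 2 with hJ
  have hJ0 : 0 ≤ J := intervalIntegral.integral_nonneg hab.le fun r _ => sq_nonneg _
  refine (h (u 0) (hu.ac 0) (hu.intervalIntegrable_deriv_zero hP)).trans ?_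
  have h1 := hu.integral_deriv_zero_le hP
  set T := P.strainInt m k u
  set K := P.kinInt u
  have hCJ : C * J ≤ δ / 2 * (T + K) := by
    rw [div_lt_iff₀ (by positivity)] at hN
    have h3 : (N + 1 : ℝ) * c * (C * J) ≤ C * (D₁ + D₂) * (T + K) := by
      calc (N + 1 : ℝ) * c * (C * J) = C * ((N + 1 : ℝ) * (c * J)) := by ring
        _ ≤ C * ((N + 1 : ℝ) * I) := by gcongr
        _ ≤ C * ((D₁ + D₂) * (T + K)) := by gcongr
        _ = _ := by ring
    have h4 : C * (D₁ + D₂) ≤ (N + 1 : ℝ) * c * (δ / 2) := by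
      have : 0 < c * δ := by positivity
      linarith
    have h5 := mul_le_mul_of_nonneg_right h4 (add_nonneg hT0 hK0)
    have h6 : 0 < (N + 1 : ℝ) * c := by positivity
    refine le_of_mul_le_mul_left ?_ h6
    linarith
  have h2 := mul_le_mul_of_nonneg_left h1 (half_pos hδ).le
  have h3 : 0 ≤ δ / 2 * K := by positivity
  linarith

namespace FinEnergy

variable {m k : ℤ} {u : Fin 3 → ℝ → ℝ}

theorem integrable_dissDens (hP : P.Admissible) (hu : P.FinEnergy m k u) : IntegrableOn
    (fun r => P.dissDens m k r (fun i => u i r) (fun i => deriv (u i) r)) (Ioo 0 P.r₀) := by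
  refine Integrable.mono' (hu.strain.const_mul (2 * P.ε + 3 * P.δ))
    (aemeasurable_dissDens hu.ac m k).aestronglyMeasurable ?_
  filter_upwards [ae_restrict_mem measurableSet_Ioo] with r hr
  rw [Real.norm_of_nonneg (dissDens_nonneg hP.ε_pos.le hP.δ_pos.le hr.1.le)]
  exact dissDens_le hP.ε_pos.le hP.δ_pos.le hr.1.le

theorem integrable_idealDens (hP : P.Admissible) (hu : P.FinEnergy m k u) : IntegrableOn
    (fun r => P.idealDens m k r (fun i => u i r) (fun i => deriv (u i) r)) (Ioo 0 P.r₀) := by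
  obtain ⟨M, hM, h1, h2, h3⟩ := hP.exists_bound
  refine Integrable.mono' (((hu.strain.add (hu.integrable_sq_zero hP)).add
    (hu.integrable_sq_one hP)).const_mul
      ((8 + 2 * m ^ 2 + 2 * k ^ 2 * P.r₀ ^ 2 + 6 * P.r₀ + 3 * P.γ) * M))
    (aemeasurable_idealDens hu.ac m k hP).aestronglyMeasurable ?_
  filter_upwards [ae_restrict_mem measurableSet_Ioo] with r hr
  have hr' : r ∈ Icc 0 P.r₀ := Ioo_subset_Icc_self hr
  exact abs_idealDens_le hM (hP.p_nonneg r hr') (h1 r hr') (h2 r hr') (h3 r ⟨hr.1, hr.2.le⟩)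
    (zero_le_one.trans hP.one_lt_γ.le) hr.1 hr.2.le

end FinEnergy

end ZPinch

namespace ZPinch

variable {P : ZPinch} {m k : ℤ}

/-! ### Displacements of finite energy -/

theorem FinEnergy.ae_differentiableAt {u : Fin 3 → ℝ → ℝ} (hu : P.FinEnergy m k u) (i : Fin 3) :
    ∀ᵐ r ∂volume.restrict (Ioo 0 P.r₀), DifferentiableAt ℝ (u i) r :=
  ae_differentiableAt_of_locAC (hu.ac i)

theorem FinEnergy.add (hP : P.Admissible) {u v : Fin 3 → ℝ → ℝ} (hu : P.FinEnergy m k u)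
    (hv : P.FinEnergy m k v) : P.FinEnergy m k (u + v) := by
  have hac : ∀ i, P.LocAC ((u + v) i) := fun i a ha => (hu.ac i a ha).add (hv.ac i a ha)
  refine ⟨hac, ?_, ?_⟩
  · refine Integrable.mono' ((hu.strain.const_mul 2).add (hv.strain.const_mul 2))
      (aemeasurable_strainSq hac m k).aestronglyMeasurable ?_
    filter_upwards [ae_restrict_mem measurableSet_Ioo, ae_all_iff.2 hu.ae_differentiableAt,
      ae_all_iff.2 hv.ae_differentiableAt] with r hr hur hvr
    rw [Real.norm_of_nonneg (mul_nonneg (strainSq_nonneg _ _ _ _ _) hr.1.le)]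
    have h1 : (fun i => deriv ((u + v) i) r)
        = (fun i => deriv (u i) r) + fun i => deriv (v i) r := by
      funext i
      exact deriv_add (hur i) (hvr i)
    have h2 : (fun i => (u + v) i r) = (fun i => u i r) + fun i => v i r := rfl
    rw [h1, h2]
    have h3 := mul_le_mul_of_nonneg_right (strainSq_add_le m k r (fun i => u i r)
      (fun i => deriv (u i) r) (fun i => v i r) fun i => deriv (v i) r) hr.1.le
    simp only [Pi.add_apply]
    linarith
  · refine Integrable.mono' ((hu.kin.const_mul 2).add (hv.kin.const_mul 2))
      (aemeasurable_kin hac hP).aestronglyMeasurable ?_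
    filter_upwards [ae_restrict_mem measurableSet_Ioo] with r hr
    have h1 := hP.ρ_nonneg (r := r) ⟨hr.1.le, hr.2.le⟩
    have h2 := hr.1.le
    rw [Real.norm_of_nonneg (by positivity)]
    have key : ∀ a b : ℝ, (a + b) ^ 2 ≤ 2 * a ^ 2 + 2 * b ^ 2 := fun a b => by
      nlinarith [sq_nonneg (a - b)]
    have h3 : (u 0 r + v 0 r) ^ 2 + (u 1 r + v 1 r) ^ 2 + (u 2 r + v 2 r) ^ 2 ≤
        2 * (u 0 r ^ 2 + u 1 r ^ 2 + u 2 r ^ 2) + 2 * (v 0 r ^ 2 + v 1 r ^ 2 + v 2 r ^ 2) := by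
      linarith [key (u 0 r) (v 0 r), key (u 1 r) (v 1 r), key (u 2 r) (v 2 r)]
    have h4 := mul_le_mul_of_nonneg_right (mul_le_mul_of_nonneg_left h3 h1) h2
    simp only [Pi.add_apply]
    linarith

theorem FinEnergy.smul {u : Fin 3 → ℝ → ℝ} (hu : P.FinEnergy m k u) (c : ℝ) :
    P.FinEnergy m k (c • u) := by
  refine ⟨fun i a ha => (hu.ac i a ha).const_mul c, ?_, ?_⟩
  · refine (hu.strain.const_mul (c ^ 2)).congr ?_
    filter_upwards [ae_all_iff.2 hu.ae_differentiableAt] with r hur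
    have h1 : ∀ i, deriv (c • u i) r = c * deriv (u i) r := fun i =>
      deriv_const_mul c (hur i)
    simp only [strainSq, Pi.smul_apply, h1, smul_eq_mul]
    ring
  · refine (hu.kin.const_mul (c ^ 2)).congr (Eventually.of_forall fun r => ?_)
    simp only [Pi.smul_apply, smul_eq_mul]
    ring

theorem FinEnergy.zero : P.FinEnergy m k 0 := by
  refine ⟨fun i a ha => ?_, ?_, ?_⟩
  · exact (contDiffOn_const (c := (0 : ℝ)) (n := 1)).absolutelyContinuousOnInterval
  · have h1 : ∀ r, deriv (0 : ℝ → ℝ) r = 0 := fun r => deriv_const r 0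
    simp [strainSq, h1]
  · simp

/-- The displacements of finite energy form a vector space. -/
def finSubmodule (P : ZPinch) (hP : P.Admissible) (m k : ℤ) : Submodule ℝ (Fin 3 → ℝ → ℝ) where
  carrier := {u | P.FinEnergy m k u}
  add_mem' hu hv := hu.add hP hv
  zero_mem' := FinEnergy.zero
  smul_mem' c _ hu := hu.smul c

theorem FinEnergy.sub (hP : P.Admissible) {u v : Fin 3 → ℝ → ℝ} (hu : P.FinEnergy m k u)
    (hv : P.FinEnergy m k v) : P.FinEnergy m k (u - v) :=
  (P.finSubmodule hP m k).sub_mem hu hv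

theorem isQuadFun_strainInt (hP : P.Admissible) :
    IsQuadFun fun u : P.finSubmodule hP m k => P.strainInt m k u :=
  isQuadFun_integral (P.finSubmodule hP m k).subtype
    (q := fun r x y => strainSq m k r x y * r) (isQuadFun_strainSq m k)
    (fun u i => u.2.ae_differentiableAt i) (fun u => u.2.strain)

theorem isQuadFun_kinInt (hP : P.Admissible) :
    IsQuadFun fun u : P.finSubmodule hP m k => P.kinInt u :=
  isQuadFun_integral (P.finSubmodule hP m k).subtype
    (q := fun r x _ => P.ρ r * (x 0 ^ 2 + x 1 ^ 2 + x 2 ^ 2) * r)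
    (fun r => .of_forall fun a b t => by
      simp only [Prod.fst_add, Prod.smul_fst, Pi.add_apply, Pi.smul_apply, smul_eq_mul]
      ring)
    (fun u i => u.2.ae_differentiableAt i) (fun u => u.2.kin)

/-- The squared norm on displacements of finite energy. -/
def normInt (P : ZPinch) (m k : ℤ) (u : Fin 3 → ℝ → ℝ) : ℝ := P.strainInt m k u + P.kinInt u

theorem normInt_nonneg (hP : P.Admissible) (u : Fin 3 → ℝ → ℝ) : 0 ≤ P.normInt m k u :=
  add_nonneg (strainInt_nonneg m k u) (kinInt_nonneg hP u)

theorem isQuadFun_normInt (hP : P.Admissible) :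
    IsQuadFun fun u : P.finSubmodule hP m k => P.normInt m k u :=
  (isQuadFun_strainInt hP).add (isQuadFun_kinInt hP)

theorem normInt_add_le (hP : P.Admissible) {u v : Fin 3 → ℝ → ℝ} (hu : P.FinEnergy m k u)
    (hv : P.FinEnergy m k v) :
    P.normInt m k (u + v) ≤ 2 * P.normInt m k u + 2 * P.normInt m k v := by
  have h : P.normInt m k (u + v) + P.normInt m k (u - v)
      = 2 * P.normInt m k u + 2 * P.normInt m k v :=
    (isQuadFun_normInt hP).parallelogram (⟨u, hu⟩ : P.finSubmodule hP m k) ⟨v, hv⟩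
  have h2 := normInt_nonneg (m := m) (k := k) hP (u - v)
  linarith

theorem normInt_smul (hP : P.Admissible) {u : Fin 3 → ℝ → ℝ} (hu : P.FinEnergy m k u) (c : ℝ) :
    P.normInt m k (c • u) = c ^ 2 * P.normInt m k u :=
  (isQuadFun_normInt hP).map_smul c (⟨u, hu⟩ : P.finSubmodule hP m k)

/-! ### The norm of the space and the smooth core -/

/-- The displacement with given components. -/
def toDisp (u : Fin 3 → ℝ → ℝ) : Disp := ⟨u 0, u 1, u 2⟩

theorem normSq_toDisp (u : Fin 3 → ℝ → ℝ) : P.normSq m k (toDisp u) =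
    ∫⁻ r in Ioo 0 P.r₀, ENNReal.ofReal
      (P.normDens m k r (fun i => u i r) fun i => deriv (u i) r) := rfl

theorem strainSq_add_kin_nonneg (hP : P.Admissible) (u : Fin 3 → ℝ → ℝ) {r : ℝ}
    (hr : r ∈ Ioo 0 P.r₀) :
    0 ≤ strainSq m k r (fun i => u i r) (fun i => deriv (u i) r) * r
      ∧ 0 ≤ P.ρ r * (u 0 r ^ 2 + u 1 r ^ 2 + u 2 r ^ 2) * r := by
  have h1 := hP.ρ_nonneg (r := r) ⟨hr.1.le, hr.2.le⟩
  have h2 := hr.1.le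
  exact ⟨mul_nonneg (strainSq_nonneg _ _ _ _ _) h2, by positivity⟩

theorem finEnergy_of_normSq_lt_top (hP : P.Admissible) {u : Fin 3 → ℝ → ℝ}
    (hu : ∀ i, P.LocAC (u i)) (h : P.normSq m k (toDisp u) < ⊤) : P.FinEnergy m k u := by
  rw [normSq_toDisp] at h
  refine ⟨hu, ?_, ?_⟩
  · rw [IntegrableOn, ← lintegral_ofReal_ne_top_iff_integrable
      (aemeasurable_strainSq hu m k).aestronglyMeasurable]
    · refine (lt_of_le_of_lt (lintegral_mono_ae ?_) h).ne
      filter_upwards [ae_restrict_mem measurableSet_Ioo] with r hr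
      apply ENNReal.ofReal_le_ofReal
      have h1 := strainSq_le_normDens (P := P) (m := m) (k := k) (x := fun i => u i r)
        (y := fun i => deriv (u i) r) hr.1.le
      have h2 := strainSq_add_kin_nonneg (m := m) (k := k) hP u hr
      linarith [h2.2]
    · filter_upwards [ae_restrict_mem measurableSet_Ioo] with r hr
      exact (strainSq_add_kin_nonneg hP u hr).1
  · rw [IntegrableOn, ← lintegral_ofReal_ne_top_iff_integrable
      (aemeasurable_kin hu hP).aestronglyMeasurable]
    · refine (lt_of_le_of_lt (lintegral_mono_ae ?_) h).ne
      filter_upwards [ae_restrict_mem measurableSet_Ioo] with r hr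
      apply ENNReal.ofReal_le_ofReal
      have h1 := strainSq_le_normDens (P := P) (m := m) (k := k) (x := fun i => u i r)
        (y := fun i => deriv (u i) r) hr.1.le
      have h2 := strainSq_add_kin_nonneg (m := m) (k := k) hP u hr
      linarith [h2.1]
    · filter_upwards [ae_restrict_mem measurableSet_Ioo] with r hr
      exact (strainSq_add_kin_nonneg (m := m) (k := k) hP u hr).2

theorem ofReal_normInt_eq (hP : P.Admissible) {u : Fin 3 → ℝ → ℝ} (hu : P.FinEnergy m k u) :
    ENNReal.ofReal (P.normInt m k u) = ∫⁻ r in Ioo 0 P.r₀, ENNReal.ofReal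
      (strainSq m k r (fun i => u i r) (fun i => deriv (u i) r) * r
        + P.ρ r * (u 0 r ^ 2 + u 1 r ^ 2 + u 2 r ^ 2) * r) := by
  rw [normInt, strainInt, kinInt, ← integral_add hu.strain hu.kin]
  apply ofReal_integral_eq_lintegral_ofReal (hu.strain.add hu.kin)
  filter_upwards [ae_restrict_mem measurableSet_Ioo] with r hr
  have h2 := strainSq_add_kin_nonneg (m := m) (k := k) hP u hr
  exact add_nonneg h2.1 h2.2

theorem ofReal_normInt_le_normSq (hP : P.Admissible) {u : Fin 3 → ℝ → ℝ}
    (hu : P.FinEnergy m k u) : ENNReal.ofReal (P.normInt m k u) ≤ P.normSq m k (toDisp u) := by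
  rw [ofReal_normInt_eq hP hu, normSq_toDisp]
  apply lintegral_mono_ae
  filter_upwards [ae_restrict_mem measurableSet_Ioo] with r hr
  exact ENNReal.ofReal_le_ofReal (strainSq_le_normDens (x := fun i => u i r)
    (y := fun i => deriv (u i) r) hr.1.le)

/-- Stated for arbitrary u with a lower integral, because it is also needed for a limit whose energy
is not yet known to be finite. -/
theorem normSq_le_lintegral (hP : P.Admissible) (u : Fin 3 → ℝ → ℝ) :
    P.normSq m k (toDisp u) ≤ ENNReal.ofReal 9 * ∫⁻ r in Ioo 0 P.r₀, ENNReal.ofReal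
      (strainSq m k r (fun i => u i r) (fun i => deriv (u i) r) * r
        + P.ρ r * (u 0 r ^ 2 + u 1 r ^ 2 + u 2 r ^ 2) * r) := by
  rw [normSq_toDisp, ← lintegral_const_mul' _ _ ENNReal.ofReal_ne_top]
  apply lintegral_mono_ae
  filter_upwards [ae_restrict_mem measurableSet_Ioo] with r hr
  rw [← ENNReal.ofReal_mul (by norm_num)]
  apply ENNReal.ofReal_le_ofReal
  have h1 := normDens_le (P := P) (m := m) (k := k) (x := fun i => u i r)
    (y := fun i => deriv (u i) r) hr.1.le
  have h2 := strainSq_add_kin_nonneg (m := m) (k := k) hP u hr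
  linarith [h2.2]

theorem normSq_le_ofReal_normInt (hP : P.Admissible) {u : Fin 3 → ℝ → ℝ}
    (hu : P.FinEnergy m k u) :
    P.normSq m k (toDisp u) ≤ ENNReal.ofReal 9 * ENNReal.ofReal (P.normInt m k u) := by
  rw [ofReal_normInt_eq hP hu]
  exact normSq_le_lintegral hP u

/-- A function that is C¹ up to the axis and vanishes there is bounded by a multiple of r, so the
1/r terms of the strain stay bounded on the core. -/
theorem exists_bound_of_contDiffOn {R : ℝ} (hR : 0 < R) {f : ℝ → ℝ}
    (hf : ContDiffOn ℝ ∞ f (Icc 0 R)) : ∃ C : ℝ, 0 ≤ C ∧ ∀ r ∈ Ioo 0 R,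
      |f r| ≤ C ∧ |deriv f r| ≤ C ∧ (f 0 = 0 → |f r / r| ≤ C) := by
  obtain ⟨K, hK⟩ := (hf.of_le (m := 1) (by exact_mod_cast le_top)).exists_lipschitzOnWith
    one_ne_zero (convex_Icc _ _) isCompact_Icc
  obtain ⟨B, hB⟩ := isCompact_Icc.exists_bound_of_continuousOn hf.continuousOn
  have h0 : (0 : ℝ) ∈ Icc 0 R := ⟨le_rfl, hR.le⟩
  have hB0 : 0 ≤ B := (norm_nonneg _).trans (hB 0 h0)
  have hK0 : (0 : ℝ) ≤ K := K.2
  refine ⟨B + K, by positivity, fun r hr => ⟨?_, ?_, fun hf0 => ?_⟩⟩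
  · have := hB r (Ioo_subset_Icc_self hr)
    rw [Real.norm_eq_abs] at this
    linarith
  · have := norm_deriv_le_of_lipschitzOn (Icc_mem_nhds hr.1 hr.2) hK
    rw [Real.norm_eq_abs] at this
    linarith
  · have := hK.dist_le_mul r (Ioo_subset_Icc_self hr) 0 h0
    rw [hf0, Real.dist_eq, Real.dist_eq, sub_zero, sub_zero, abs_of_pos hr.1] at this
    rw [abs_div, abs_of_pos hr.1, div_le_iff₀ hr.1]
    nlinarith [hr.1]

theorem finEnergy_of_smoothCore (hP : P.Admissible) {u : Fin 3 → ℝ → ℝ}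
    (hu : P.SmoothCore m (toDisp u)) : P.FinEnergy m k u := by
  obtain ⟨h0, h1, h2, hx0, hz0, hy0⟩ := hu
  simp only [toDisp] at h0 h1 h2 hx0 hz0 hy0
  have hcd : ∀ i, ContDiffOn ℝ ∞ (u i) (Icc 0 P.r₀) := by
    intro i
    fin_cases i
    · exact h0
    · exact h1
    · exact h2
  have hac : ∀ i, P.LocAC (u i) := by
    intro i a ha
    apply ContDiffOn.absolutelyContinuousOnInterval
    rw [uIcc_of_le ha.2.le]
    exact ((hcd i).of_le (by exact_mod_cast le_top)).mono (Icc_subset_Icc_left ha.1.le)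
  refine ⟨hac, ?_, ?_⟩
  · obtain ⟨C0, hC0, b0⟩ := exists_bound_of_contDiffOn hP.r₀_pos h0
    obtain ⟨C1, hC1, b1⟩ := exists_bound_of_contDiffOn hP.r₀_pos h1
    obtain ⟨C2, hC2, b2⟩ := exists_bound_of_contDiffOn hP.r₀_pos h2
    set C := C0 + C1 + C2
    set M : ℝ := 1 + |(m : ℝ)| + |(k : ℝ)| with hM
    have hM1 : 1 ≤ M := by
      have := abs_nonneg (m : ℝ)
      have := abs_nonneg (k : ℝ)
      linarith
    have hC : 0 ≤ C := by positivity
    have hbd : ∀ r ∈ Ioo 0 P.r₀,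
        ‖strainSq m k r (fun i => u i r) (fun i => deriv (u i) r) * r‖
          ≤ 6 * (3 * M * C) ^ 2 * P.r₀ := by
      intro r hr
      obtain ⟨a1, a2, a3⟩ := b0 r hr
      obtain ⟨a4, a5, a6⟩ := b1 r hr
      obtain ⟨a7, a8, a9⟩ := b2 r hr
      have hmul : ∀ z c : ℝ, |c| ≤ M → |z| ≤ C → |c * z| ≤ M * C := by
        intro z c hc hz
        rw [abs_mul]
        exact mul_le_mul hc hz (abs_nonneg _) (by linarith)
      have hm : |(m : ℝ)| ≤ M := by linarith [abs_nonneg (k : ℝ)]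
      have hk : |(k : ℝ)| ≤ M := by linarith [abs_nonneg (m : ℝ)]
      have h1 : |(1 : ℝ)| ≤ M := by rwa [abs_one]
      have hMC : 0 ≤ M * C := by positivity
      have hsq : ∀ z : ℝ, |z| ≤ 3 * (M * C) → z ^ 2 ≤ (3 * M * C) ^ 2 := by
        intro z hz
        rw [mul_assoc]
        exact sq_le_sq' (abs_le.1 hz).1 (abs_le.1 hz).2
      have e1 := hmul _ 1 h1 (show |deriv (u 0) r| ≤ C by linarith)
      have e2 := hmul _ 1 h1 (show |u 0 r / r| ≤ C by linarith [a3 hx0])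
      have e3 := hmul _ m hm (show |u 2 r / r| ≤ C by linarith [a9 hz0])
      have e4 := hmul _ k hk (show |u 1 r| ≤ C by linarith)
      have e5 := hmul _ 1 h1 (show |deriv (u 2) r| ≤ C by linarith)
      have e6 := hmul _ 1 h1 (show |u 2 r / r| ≤ C by linarith [a9 hz0])
      have e7 := hmul _ m hm (show |u 0 r / r| ≤ C by linarith [a3 hx0])
      have e8 := hmul _ 1 h1 (show |deriv (u 1) r| ≤ C by linarith)
      have e9 := hmul _ k hk (show |u 0 r| ≤ C by linarith)
      -- For m = 0 the quotient η/r is multiplied by zero, which is why the core needs η(0) = 0 only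
      -- for m ≠ 0.
      have e10 : |m * (u 1 r / r)| ≤ M * C := by
        by_cases hm0 : m = 0
        · simpa [hm0] using hMC
        · exact hmul _ m hm (show |u 1 r / r| ≤ C by linarith [a6 (hy0 hm0)])
      have e11 := hmul _ k hk (show |u 2 r| ≤ C by linarith)
      rw [one_mul] at e1 e2 e5 e6 e8
      rw [abs_le] at e1 e2 e3 e4 e5 e6 e7 e8 e9 e10 e11
      have hS : strainSq m k r (fun i => u i r) (fun i => deriv (u i) r)
          = deriv (u 0) r ^ 2 + (u 0 r / r + m * (u 2 r / r)) ^ 2 + (k * u 1 r) ^ 2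
            + (-deriv (u 2) r + u 2 r / r + m * (u 0 r / r)) ^ 2 + (deriv (u 1) r + k * u 0 r) ^ 2
            + (m * (u 1 r / r) - k * u 2 r) ^ 2 := by
        simp only [strainSq]
        ring
      rw [Real.norm_of_nonneg (mul_nonneg (strainSq_nonneg _ _ _ _ _) hr.1.le), hS]
      have g1 := hsq (deriv (u 0) r) (abs_le.2 ⟨by linarith, by linarith⟩)
      have g2 := hsq (u 0 r / r + m * (u 2 r / r)) (abs_le.2 ⟨by linarith, by linarith⟩)
      have g3 := hsq (k * u 1 r) (abs_le.2 ⟨by linarith, by linarith⟩)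
      have g4 := hsq (-deriv (u 2) r + u 2 r / r + m * (u 0 r / r))
        (abs_le.2 ⟨by linarith, by linarith⟩)
      have g5 := hsq (deriv (u 1) r + k * u 0 r) (abs_le.2 ⟨by linarith, by linarith⟩)
      have g6 := hsq (m * (u 1 r / r) - k * u 2 r) (abs_le.2 ⟨by linarith, by linarith⟩)
      apply mul_le_mul _ hr.2.le hr.1.le (by positivity)
      linarith
    refine Integrable.mono' (g := fun _ => 6 * (3 * M * C) ^ 2 * P.r₀)
      (integrable_const _)
      (aemeasurable_strainSq hac m k).aestronglyMeasurable ?_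
    filter_upwards [ae_restrict_mem measurableSet_Ioo] with r hr
    exact hbd r hr
  · have hc : ContinuousOn (fun r => P.ρ r * (u 0 r ^ 2 + u 1 r ^ 2 + u 2 r ^ 2) * r)
        (Icc 0 P.r₀) :=
      (hP.ρ_continuousOn.mul ((((hcd 0).continuousOn.pow 2).add
        ((hcd 1).continuousOn.pow 2)).add ((hcd 2).continuousOn.pow 2))).mul continuousOn_id
    exact (hc.integrableOn_compact isCompact_Icc).mono_set Ioo_subset_Icc_self

theorem SmoothCore.add {u v : Fin 3 → ℝ → ℝ} (hu : P.SmoothCore m (toDisp u))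
    (hv : P.SmoothCore m (toDisp v)) : P.SmoothCore m (toDisp (u + v)) := by
  obtain ⟨h0, h1, h2, h3, h4, h5⟩ := hu
  obtain ⟨g0, g1, g2, g3, g4, g5⟩ := hv
  refine ⟨h0.add g0, h1.add g1, h2.add g2, ?_, ?_, fun hm => ?_⟩
  · simp only [toDisp, Pi.add_apply] at *
    rw [h3, g3, add_zero]
  · simp only [toDisp, Pi.add_apply] at *
    rw [h4, g4, add_zero]
  · have h6 := h5 hm
    have g6 := g5 hm
    simp only [toDisp, Pi.add_apply] at *
    rw [h6, g6, add_zero]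

theorem SmoothCore.smul {u : Fin 3 → ℝ → ℝ} (hu : P.SmoothCore m (toDisp u)) (c : ℝ) :
    P.SmoothCore m (toDisp (c • u)) := by
  obtain ⟨h0, h1, h2, h3, h4, h5⟩ := hu
  refine ⟨contDiffOn_const.mul h0, contDiffOn_const.mul h1, contDiffOn_const.mul h2, ?_, ?_,
    fun hm => ?_⟩
  · simp only [toDisp, Pi.smul_apply, smul_eq_mul] at *
    rw [h3, mul_zero]
  · simp only [toDisp, Pi.smul_apply, smul_eq_mul] at *
    rw [h4, mul_zero]
  · have h6 := h5 hm
    simp only [toDisp, Pi.smul_apply, smul_eq_mul] at *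
    rw [h6, mul_zero]

/-- The elements of the completion are the displacements of finite energy that can be approximated
by elements of the core. -/
theorem toDisp_mem_Space_iff (hP : P.Admissible) {u : Fin 3 → ℝ → ℝ} :
    toDisp u ∈ P.Space m k ↔ P.FinEnergy m k u ∧ ∀ ε : ℝ, 0 < ε →
      ∃ v : Fin 3 → ℝ → ℝ, P.SmoothCore m (toDisp v) ∧ P.normInt m k (u - v) < ε := by
  constructor
  · rintro ⟨h0, h1, h2, w, hw, hlim⟩
    have hac : ∀ i, P.LocAC (u i) := by
      intro i
      fin_cases i
      · exact h0
      · exact h1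
      · exact h2
    have key : ∀ ε : ℝ, 0 < ε → ∃ v : Fin 3 → ℝ → ℝ, P.SmoothCore m (toDisp v) ∧
        P.FinEnergy m k (u - v) ∧ P.normInt m k (u - v) < ε := by
      intro ε hε
      obtain ⟨n, hn⟩ := (hlim.eventually (gt_mem_nhds (ENNReal.ofReal_pos.2 hε))).exists
      set v : Fin 3 → ℝ → ℝ := ![(w n).ξ, (w n).η, (w n).ζ] with hv
      have hvw : toDisp v = w n := rfl
      have hsub : toDisp (u - v) = (toDisp u).sub (w n) := rfl
      rw [← hsub] at hn
      have hvc : P.SmoothCore m (toDisp v) := hvw ▸ hw n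
      have hvf : P.FinEnergy m k v := finEnergy_of_smoothCore hP hvc
      have hf : P.FinEnergy m k (u - v) :=
        finEnergy_of_normSq_lt_top hP (fun i a ha => (hac i a ha).sub (hvf.ac i a ha))
          (hn.trans ENNReal.ofReal_lt_top)
      refine ⟨v, hvc, hf, ?_⟩
      exact (ENNReal.ofReal_lt_ofReal_iff hε).1
        (lt_of_le_of_lt (ofReal_normInt_le_normSq hP hf) hn)
    refine ⟨?_, fun ε hε => ?_⟩
    -- Finite distance to a single core element suffices: u = (u - v) + v.
    · obtain ⟨v, hv, hf, -⟩ := key 1 one_pos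
      have := hf.add hP (finEnergy_of_smoothCore hP hv)
      rwa [sub_add_cancel] at this
    · obtain ⟨v, hv, -, h⟩ := key ε hε
      exact ⟨v, hv, h⟩
  · rintro ⟨hu, happ⟩
    refine ⟨hu.ac 0, hu.ac 1, hu.ac 2, ?_⟩
    choose v hv hlt using fun n : ℕ => happ (1 / (n + 1)) (by positivity)
    refine ⟨fun n => toDisp (v n), hv, ?_⟩
    have h1 : ∀ n, P.normSq m k ((toDisp u).sub (toDisp (v n)))
        ≤ ENNReal.ofReal 9 * ENNReal.ofReal (1 / (n + 1)) := by
      intro n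
      have h2 := normSq_le_ofReal_normInt hP
        (hu.sub hP (finEnergy_of_smoothCore (k := k) hP (hv n)))
      refine h2.trans (mul_le_mul_right (ENNReal.ofReal_le_ofReal (hlt n).le) _)
    refine tendsto_of_tendsto_of_tendsto_of_le_of_le tendsto_const_nhds ?_ (fun _ => zero_le) h1
    have h3 := ENNReal.tendsto_ofReal (tendsto_one_div_add_atTop_nhds_zero_nat (𝕜 := ℝ))
    rw [ENNReal.ofReal_zero] at h3
    simpa using ENNReal.Tendsto.const_mul (a := ENNReal.ofReal 9) h3
      (Or.inr ENNReal.ofReal_ne_top)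

/-- The space of the mode `(m, k)` as a submodule. -/
def spaceSubmodule (P : ZPinch) (hP : P.Admissible) (m k : ℤ) :
    Submodule ℝ (Fin 3 → ℝ → ℝ) where
  carrier := {u | toDisp u ∈ P.Space m k}
  add_mem' := by
    intro u v hu hv
    rw [mem_ofPred_eq, toDisp_mem_Space_iff hP] at *
    refine ⟨hu.1.add hP hv.1, fun ε hε => ?_⟩
    obtain ⟨u', hu', h1⟩ := hu.2 (ε / 4) (by positivity)
    obtain ⟨v', hv', h2⟩ := hv.2 (ε / 4) (by positivity)
    refine ⟨u' + v', SmoothCore.add hu' hv', ?_⟩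
    rw [add_sub_add_comm]
    have := normInt_add_le hP (hu.1.sub hP (finEnergy_of_smoothCore hP hu'))
      (hv.1.sub hP (finEnergy_of_smoothCore hP hv'))
    linarith
  zero_mem' := by
    rw [mem_ofPred_eq, toDisp_mem_Space_iff hP]
    have h0 : P.SmoothCore m (toDisp 0) :=
      ⟨contDiffOn_const (c := (0 : ℝ)), contDiffOn_const (c := (0 : ℝ)),
        contDiffOn_const (c := (0 : ℝ)), rfl, rfl, fun _ => rfl⟩
    refine ⟨FinEnergy.zero, fun ε hε => ⟨0, h0, ?_⟩⟩
    rw [sub_zero, show P.normInt m k 0 = 0 from (isQuadFun_normInt hP).map_zero]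
    exact hε
  smul_mem' := by
    intro c u hu
    rw [mem_ofPred_eq, toDisp_mem_Space_iff hP] at *
    refine ⟨hu.1.smul c, fun ε hε => ?_⟩
    obtain ⟨v, hv, h1⟩ := hu.2 (ε / (c ^ 2 + 1)) (by positivity)
    refine ⟨c • v, SmoothCore.smul hv c, ?_⟩
    rw [← smul_sub, normInt_smul hP (hu.1.sub hP (finEnergy_of_smoothCore hP hv))]
    rw [lt_div_iff₀ (by positivity)] at h1
    have := normInt_nonneg (m := m) (k := k) hP (u - v)
    linarith

theorem toDisp_mem_Space_of_smoothCore (hP : P.Admissible) {u : Fin 3 → ℝ → ℝ}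
    (hu : P.SmoothCore m (toDisp u)) : toDisp u ∈ P.Space m k := by
  rw [toDisp_mem_Space_iff hP]
  refine ⟨finEnergy_of_smoothCore hP hu, fun ε hε => ⟨u, hu, ?_⟩⟩
  rw [sub_self, show P.normInt m k 0 = 0 from (isQuadFun_normInt hP).map_zero]
  exact hε

end ZPinch

namespace ZPinch

variable {P : ZPinch} {m k : ℤ}

/-! ### The energies as integrals of quadratic densities -/

theorem deriv_id_mul {f : ℝ → ℝ} {r : ℝ} (hf : DifferentiableAt ℝ f r) :
    deriv (fun x => x * f x) r = f r + r * deriv f r := by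
  have h : HasDerivAt (fun x => x * f x) (1 * f r + r * deriv f r) r :=
    (hasDerivAt_id r).mul hf.hasDerivAt
  rw [h.deriv, one_mul]

theorem J_toDisp (hP : P.Admissible) (u : Fin 3 → ℝ → ℝ) :
    P.J (toDisp u) = 2 * Real.pi ^ 2 * P.kinInt u := by
  rw [J, kinInt, intervalIntegral_eq_integral_Ioo hP.r₀_pos.le]
  rfl

/-- The integrated dissipation. -/
def dissInt (P : ZPinch) (m k : ℤ) (u : Fin 3 → ℝ → ℝ) : ℝ :=
  2 * Real.pi ^ 2 *
    ∫ r in Ioo 0 P.r₀, P.dissDens m k r (fun i => u i r) (fun i => deriv (u i) r)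

/-- The integrated ideal energy of the plasma. -/
def idealInt (P : ZPinch) (m k : ℤ) (u : Fin 3 → ℝ → ℝ) : ℝ :=
  2 * Real.pi ^ 2 *
    ∫ r in Ioo 0 P.r₀, P.idealDens m k r (fun i => u i r) (fun i => deriv (u i) r)

/-- The energy of the vacuum. -/
def vacInt (P : ZPinch) (m k : ℤ) (Q : Fin 1 → ℝ → ℝ) : ℝ :=
  2 * Real.pi ^ 2 *
    ∫ r in Ioo P.r₀ P.rw, vacDens m k r (fun i => Q i r) (fun i => deriv (Q i) r)

theorem dissipation_toDisp (hP : P.Admissible) {u : Fin 3 → ℝ → ℝ} (hu : P.FinEnergy m k u) :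
    P.dissipation m k (toDisp u) = P.dissInt m k u := by
  rw [dissipation, dissInt, intervalIntegral_eq_integral_Ioo hP.r₀_pos.le,
    intervalIntegral_eq_integral_Ioo hP.r₀_pos.le, ← mul_add]
  congr 1
  have h0 := aemeasurable_of_locAC hu.ac 0
  have h1 := aemeasurable_of_locAC hu.ac 1
  have h2 := aemeasurable_of_locAC hu.ac 2
  have h3 := (measurable_deriv (u 0)).aemeasurable (μ := volume.restrict (Ioo 0 P.r₀))
  have h4 := (measurable_deriv (u 1)).aemeasurable (μ := volume.restrict (Ioo 0 P.r₀))
  have h5 := (measurable_deriv (u 2)).aemeasurable (μ := volume.restrict (Ioo 0 P.r₀))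
  have hε := hP.ε_pos
  have hδ := hP.δ_pos
  rw [← integral_add]
  · rfl
  · refine Integrable.mono' (hu.integrable_dissDens hP)
      (AEMeasurable.aestronglyMeasurable (by simp only [toDisp]; fun_prop)) ?_
    filter_upwards [ae_restrict_mem measurableSet_Ioo] with r hr
    have hr0 := hr.1.le
    rw [Real.norm_of_nonneg (by positivity)]
    simp only [dissDens, toDisp]
    exact le_add_of_nonneg_right (by positivity)
  · refine Integrable.mono' (hu.integrable_dissDens hP)
      (AEMeasurable.aestronglyMeasurable (by simp only [toDisp]; fun_prop)) ?_
    filter_upwards [ae_restrict_mem measurableSet_Ioo] with r hr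
    have hr0 := hr.1.le
    rw [Real.norm_of_nonneg (by positivity)]
    simp only [dissDens, toDisp]
    exact le_add_of_nonneg_left (by positivity)

theorem FinEnergy.ae_deriv_id_mul {u : Fin 3 → ℝ → ℝ} (hu : P.FinEnergy m k u) :
    ∀ᵐ r ∂volume.restrict (Ioo 0 P.r₀),
      deriv (fun x => x * u 0 x) r = u 0 r + r * deriv (u 0) r := by
  filter_upwards [hu.ae_differentiableAt 0] with r hr
  exact deriv_id_mul hr

theorem energyZero_toDisp (hP : P.Admissible) {u : Fin 3 → ℝ → ℝ} (hu : P.FinEnergy 0 k u)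
    (s : ℝ) : P.energyZero k s (toDisp u) = P.idealInt 0 k u + s * P.dissInt 0 k u := by
  rw [energyZero, dissipation_toDisp hP hu, idealInt,
    intervalIntegral_eq_integral_Ioo hP.r₀_pos.le]
  congr 2
  apply integral_congr_ae
  filter_upwards [hu.ae_deriv_id_mul] with r hr
  simp only [idealDens, toDisp, if_pos, hr]

/-- The energy is a sum of separate integrals, and merging them into one density requires each of
them to be integrable. -/
theorem energyNonzero_toDisp (hP : P.Admissible) (hm : m ≠ 0) {u : Fin 3 → ℝ → ℝ}
    (hu : P.FinEnergy m k u) {Q : Fin 1 → ℝ → ℝ}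
    (hQ : AbsolutelyContinuousOnInterval (Q 0) P.r₀ P.rw) (s : ℝ) :
    P.energyNonzero m k s (toDisp u) (Q 0)
      = P.idealInt m k u + s * P.dissInt m k u + P.vacInt m k Q := by
  have h0 := aemeasurable_of_locAC hu.ac 0
  have h1 := aemeasurable_of_locAC hu.ac 1
  have h2 := aemeasurable_of_locAC hu.ac 2
  have h3 := (measurable_deriv (u 0)).aemeasurable (μ := volume.restrict (Ioo 0 P.r₀))
  have h6 := (hP.Bθ_continuousOn.mono Ioo_subset_Ioc_self).aemeasurable
    (μ := volume) measurableSet_Ioo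
  have h7 := (hP.p_continuousOn.mono Ioo_subset_Icc_self).aemeasurable
    (μ := volume) measurableSet_Ioo
  have h8 := (hP.dp_continuousOn.mono Ioo_subset_Icc_self).aemeasurable
    (μ := volume) measurableSet_Ioo
  set F1 : ℝ → ℝ := fun r => ((m ^ 2 + k ^ 2 * r ^ 2) * (P.Bθ r / r * u 1 r
          + (-k * P.Bθ r * (u 0 r + r * deriv (u 0) r) + 2 * k * P.Bθ r * u 0 r)
            / (m ^ 2 + k ^ 2 * r ^ 2)) ^ 2
      + P.γ * P.p r
          * (1 / r * (u 0 r + r * deriv (u 0) r) - k * u 1 r + m * u 2 r / r) ^ 2) * r with hF1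
  set F2 : ℝ → ℝ := fun r => m ^ 2 * P.Bθ r ^ 2 / (r * (m ^ 2 + k ^ 2 * r ^ 2))
    * (u 0 r - r * deriv (u 0) r) ^ 2 with hF2
  set F3 : ℝ → ℝ := fun r => (2 * P.dp r + m ^ 2 * P.Bθ r ^ 2 / r) * u 0 r ^ 2 with hF3
  have hγ : 0 ≤ P.γ := zero_le_one.trans hP.one_lt_γ.le
  have hsum : ∀ r, F1 r + F2 r + F3 r
      = P.idealDens m k r (fun i => u i r) (fun i => deriv (u i) r) := by
    intro r
    simp only [idealDens, if_neg hm, hF1, hF2, hF3]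
  have hi3 : IntegrableOn F3 (Ioo 0 P.r₀) := by
    obtain ⟨M, hM, -, b2, b3⟩ := hP.exists_bound
    refine Integrable.mono' ((hu.integrable_sq_zero hP).const_mul (2 * M + m ^ 2 * M))
      (AEMeasurable.aestronglyMeasurable (by fun_prop)) ?_
    filter_upwards [ae_restrict_mem measurableSet_Ioo] with r hr
    rw [hF3, norm_mul, Real.norm_of_nonneg (sq_nonneg (u 0 r)), Real.norm_eq_abs]
    apply mul_le_mul_of_nonneg_right _ (sq_nonneg _)
    refine (abs_add_le _ _).trans (add_le_add ?_ ?_)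
    · rw [abs_mul, abs_two]
      have := b2 r (Ioo_subset_Icc_self hr)
      linarith
    · have := hr.1
      rw [abs_of_nonneg (by positivity), mul_div_assoc]
      apply mul_le_mul_of_nonneg_left _ (sq_nonneg _)
      rw [div_le_iff₀ hr.1]
      exact b3 r ⟨hr.1, hr.2.le⟩
  -- F3 is integrable by the bound on B_θ²/r, so F1 + F2 is integrable by subtraction; each summand
  -- is nonnegative and hence dominated by the sum.
  have hi12 : IntegrableOn (fun r => F1 r + F2 r) (Ioo 0 P.r₀) := by
    refine ((hu.integrable_idealDens hP).sub hi3).congr (Eventually.of_forall fun r => ?_)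
    simp only [Pi.sub_apply, ← hsum]
    ring
  have hpos : ∀ r ∈ Ioo 0 P.r₀, 0 ≤ F1 r ∧ 0 ≤ F2 r := by
    intro r hr
    have h9 := hr.1
    have h10 := hP.p_nonneg r (Ioo_subset_Icc_self hr)
    constructor
    · simp only [hF1]
      positivity
    · simp only [hF2]
      positivity
  have hi1 : IntegrableOn F1 (Ioo 0 P.r₀) := by
    refine Integrable.mono' hi12 (AEMeasurable.aestronglyMeasurable (by fun_prop)) ?_
    filter_upwards [ae_restrict_mem measurableSet_Ioo] with r hr
    rw [Real.norm_of_nonneg (hpos r hr).1]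
    exact le_add_of_nonneg_right (hpos r hr).2
  have hi2 : IntegrableOn F2 (Ioo 0 P.r₀) := by
    refine Integrable.mono' hi12 (AEMeasurable.aestronglyMeasurable (by fun_prop)) ?_
    filter_upwards [ae_restrict_mem measurableSet_Ioo] with r hr
    rw [Real.norm_of_nonneg (hpos r hr).2]
    exact le_add_of_nonneg_left (hpos r hr).1
  have hideal : P.idealInt m k u = 2 * Real.pi ^ 2 * (∫ r in Ioo 0 P.r₀, F1 r)
      + 2 * Real.pi ^ 2 * (∫ r in Ioo 0 P.r₀, F2 r)
      + 2 * Real.pi ^ 2 * (∫ r in Ioo 0 P.r₀, F3 r) := by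
    rw [idealInt, ← mul_add, ← mul_add, ← integral_add hi1 hi2, ← integral_add hi12 hi3]
    simp_rw [hsum]
  have e1 : ∫ r in Ioo 0 P.r₀,
      ((m ^ 2 + k ^ 2 * r ^ 2) * (P.Bθ r / r * (toDisp u).η r
          + (-k * P.Bθ r * deriv (fun x => x * (toDisp u).ξ x) r + 2 * k * P.Bθ r * (toDisp u).ξ r)
            / (m ^ 2 + k ^ 2 * r ^ 2)) ^ 2
      + P.γ * P.p r
          * (1 / r * deriv (fun x => x * (toDisp u).ξ x) r - k * (toDisp u).η r
            + m * (toDisp u).ζ r / r) ^ 2) * r = ∫ r in Ioo 0 P.r₀, F1 r := by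
    apply integral_congr_ae
    filter_upwards [hu.ae_deriv_id_mul] with r hr
    simp only [toDisp, hF1, hr]
  have e2 : ∫ r in Ioo P.r₀ P.rw,
      (Q 0 r ^ 2 + 1 / (m ^ 2 + k ^ 2 * r ^ 2) * deriv (fun x => x * Q 0 x) r ^ 2) * r
      = ∫ r in Ioo P.r₀ P.rw, vacDens m k r (fun i => Q i r) (fun i => deriv (Q i) r) := by
    apply setIntegral_congr_ae measurableSet_Ioo
    filter_upwards [hQ.ae_differentiableAt] with r hr hr'
    rw [uIcc_of_le hP.r₀_lt_rw.le] at hr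
    rw [deriv_id_mul (hr (Ioo_subset_Icc_self hr'))]
    rfl
  rw [energyNonzero, dissipation_toDisp hP hu, hideal, vacInt,
    intervalIntegral_eq_integral_Ioo hP.r₀_pos.le, intervalIntegral_eq_integral_Ioo hP.r₀_pos.le,
    intervalIntegral_eq_integral_Ioo hP.r₀_pos.le, intervalIntegral_eq_integral_Ioo
    hP.r₀_lt_rw.le, e1, e2]
  simp only [hF2, hF3, toDisp]
  ring

theorem isQuadFun_dissInt (hP : P.Admissible) :
    IsQuadFun fun u : P.finSubmodule hP m k => P.dissInt m k u :=
  (isQuadFun_integral (P.finSubmodule hP m k).subtype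
    (q := fun r x y => P.dissDens m k r x y) (P.isQuadFun_dissDens m k)
    (fun u i => u.2.ae_differentiableAt i) (fun u => u.2.integrable_dissDens hP)).const_mul _

theorem isQuadFun_idealInt (hP : P.Admissible) :
    IsQuadFun fun u : P.finSubmodule hP m k => P.idealInt m k u :=
  (isQuadFun_integral (P.finSubmodule hP m k).subtype
    (q := fun r x y => P.idealDens m k r x y) (P.isQuadFun_idealDens m k)
    (fun u i => u.2.ae_differentiableAt i) (fun u => u.2.integrable_idealDens hP)).const_mul _

theorem dissInt_nonneg (hP : P.Admissible) (u : Fin 3 → ℝ → ℝ) : 0 ≤ P.dissInt m k u :=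
  mul_nonneg (by positivity) (setIntegral_nonneg measurableSet_Ioo fun _ hr =>
    dissDens_nonneg hP.ε_pos.le hP.δ_pos.le hr.1.le)

/-- The dissipation controls the strain. -/
theorem exists_mul_strainInt_le_dissInt (hP : P.Admissible) :
    ∃ κ : ℝ, 0 < κ ∧ ∀ (m k : ℤ) (u : Fin 3 → ℝ → ℝ), P.FinEnergy m k u →
      κ * P.strainInt m k u ≤ P.dissInt m k u := by
  have hκ : 0 < min P.ε P.δ := lt_min hP.ε_pos hP.δ_pos
  refine ⟨2 * Real.pi ^ 2 * min P.ε P.δ, by positivity, fun m k u hu => ?_⟩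
  rw [mul_assoc, dissInt]
  apply mul_le_mul_of_nonneg_left _ (by positivity)
  rw [strainInt, ← integral_const_mul]
  exact setIntegral_mono_on (hu.strain.const_mul _) (hu.integrable_dissDens hP) measurableSet_Ioo
    fun r hr => le_dissDens (min_le_left _ _) (min_le_right _ _) hκ.le hr.1.le

/-- The negative part of the ideal energy is controlled by the mass of `ξ`. -/
theorem exists_neg_le_idealInt (hP : P.Admissible) :
    ∃ M : ℝ, 0 < M ∧ ∀ (m k : ℤ) (u : Fin 3 → ℝ → ℝ), P.FinEnergy m k u →
      -(M * ∫ r in (0 : ℝ)..P.r₀, u 0 r ^ 2) ≤ P.idealInt m k u := by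
  obtain ⟨M, hM, -, b2, -⟩ := hP.exists_bound
  refine ⟨2 * Real.pi ^ 2 * (2 * (M + 1)), by positivity, fun m k u hu => ?_⟩
  rw [mul_assoc, ← mul_neg, idealInt]
  apply mul_le_mul_of_nonneg_left _ (by positivity)
  rw [intervalIntegral_eq_integral_Ioo hP.r₀_pos.le, ← neg_mul, ← integral_const_mul]
  apply setIntegral_mono_on ((hu.integrable_sq_zero hP).const_mul _) (hu.integrable_idealDens hP)
    measurableSet_Ioo
  intro r hr
  have hr' : r ∈ Icc 0 P.r₀ := Ioo_subset_Icc_self hr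
  exact le_idealDens (x := fun i => u i r) (y := fun i => deriv (u i) r) (hP.p_nonneg r hr')
    ((b2 r hr').trans (by linarith)) (zero_le_one.trans hP.one_lt_γ.le) hr.1

theorem exists_idealInt_add_le (hP : P.Admissible) (m k : ℤ) (s : ℝ) :
    ∃ C : ℝ, 0 ≤ C ∧ ∀ u : Fin 3 → ℝ → ℝ, P.FinEnergy m k u →
      P.idealInt m k u + |s| * P.dissInt m k u ≤ C * P.normInt m k u := by
  obtain ⟨M, hM, b1, b2, b3⟩ := hP.exists_bound
  obtain ⟨C₀, hC₀, h₀⟩ := exists_integral_sq_zero_le hP one_pos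
  obtain ⟨C₁, hC₁, h₁⟩ := exists_integral_sq_one_le hP m k
  have hR := hP.r₀_pos
  have hγ : 0 ≤ P.γ := zero_le_one.trans hP.one_lt_γ.le
  have hε := hP.ε_pos
  have hδ := hP.δ_pos
  set A := (8 + 2 * m ^ 2 + 2 * k ^ 2 * P.r₀ ^ 2 + 6 * P.r₀ + 3 * P.γ) * M with hA
  have hA0 : 0 ≤ A := by positivity
  refine ⟨2 * Real.pi ^ 2 * (A * (2 + C₀ + C₁)) + |s| * (2 * Real.pi ^ 2 * (2 * P.ε + 3 * P.δ)),
    by positivity, fun u hu => ?_⟩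
  have hT := strainInt_nonneg (P := P) m k u
  have hK := kinInt_nonneg hP u
  have i1 : P.idealInt m k u ≤ 2 * Real.pi ^ 2 * (A * (2 + C₀ + C₁)) * P.normInt m k u := by
    rw [idealInt, mul_assoc (2 * Real.pi ^ 2)]
    apply mul_le_mul_of_nonneg_left _ (by positivity)
    have h2 : ∫ r in Ioo 0 P.r₀, P.idealDens m k r (fun i => u i r) (fun i => deriv (u i) r)
        ≤ ∫ r in Ioo 0 P.r₀, A * (strainSq m k r (fun i => u i r) (fun i => deriv (u i) r) * r
          + u 0 r ^ 2 + u 1 r ^ 2) := by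
      apply setIntegral_mono_on (hu.integrable_idealDens hP) (((hu.strain.add
        (hu.integrable_sq_zero hP)).add (hu.integrable_sq_one hP)).const_mul A) measurableSet_Ioo
      intro r hr
      have hr' : r ∈ Icc 0 P.r₀ := Ioo_subset_Icc_self hr
      exact (le_abs_self _).trans (abs_idealDens_le hM (hP.p_nonneg r hr') (b1 r hr') (b2 r hr')
        (b3 r ⟨hr.1, hr.2.le⟩) hγ hr.1 hr.2.le)
    have h3 : ∫ r in Ioo 0 P.r₀, A * (strainSq m k r (fun i => u i r) (fun i => deriv (u i) r) * r
          + u 0 r ^ 2 + u 1 r ^ 2) = A * (P.strainInt m k u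
          + (∫ r in (0 : ℝ)..P.r₀, u 0 r ^ 2) + ∫ r in (0 : ℝ)..P.r₀, u 1 r ^ 2) := by
      have h4 : IntegrableOn (fun r => strainSq m k r (fun i => u i r) (fun i => deriv (u i) r) * r
          + u 0 r ^ 2) (Ioo 0 P.r₀) := hu.strain.add (hu.integrable_sq_zero hP)
      rw [integral_const_mul, integral_add h4 (hu.integrable_sq_one hP), integral_add hu.strain (hu.integrable_sq_zero hP),
        intervalIntegral_eq_integral_Ioo hR.le, intervalIntegral_eq_integral_Ioo hR.le]
      rfl
    rw [h3] at h2
    refine h2.trans ?_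
    rw [mul_assoc A]
    apply mul_le_mul_of_nonneg_left _ hA0
    have h4 := h₀ m k u hu
    have h5 := h₁ u hu
    rw [normInt]
    have h6 : 0 ≤ C₀ * P.strainInt m k u := by positivity
    linarith
  have i2 : P.dissInt m k u ≤ 2 * Real.pi ^ 2 * (2 * P.ε + 3 * P.δ) * P.normInt m k u := by
    rw [dissInt, mul_assoc (2 * Real.pi ^ 2)]
    apply mul_le_mul_of_nonneg_left _ (by positivity)
    have h2 : ∫ r in Ioo 0 P.r₀, P.dissDens m k r (fun i => u i r) (fun i => deriv (u i) r)
        ≤ (2 * P.ε + 3 * P.δ) * P.strainInt m k u := by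
      rw [strainInt, ← integral_const_mul]
      exact setIntegral_mono_on (hu.integrable_dissDens hP) (hu.strain.const_mul _)
        measurableSet_Ioo fun r hr => dissDens_le hε.le hδ.le hr.1.le
    refine h2.trans ?_
    apply mul_le_mul_of_nonneg_left _ (by positivity)
    rw [normInt]
    linarith
  have i3 := mul_le_mul_of_nonneg_left i2 (abs_nonneg s)
  linarith

end ZPinch

namespace ZPinch

variable {P : ZPinch} {m k : ℤ}

/-! ### Completeness of the energy space -/

/-- The components of `u`, rescaled so that their derivatives are controlled by the strain. -/
def scaledComp (u : Fin 3 → ℝ → ℝ) : Fin 3 → ℝ → ℝ := ![u 0, u 1, fun r => r⁻¹ * u 2 r]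

theorem scaledComp_sub (u v : Fin 3 → ℝ → ℝ) (i : Fin 3) :
    scaledComp (u - v) i = scaledComp u i - scaledComp v i := by
  fin_cases i
  · rfl
  · rfl
  · funext r
    simp [scaledComp]
    ring

theorem locAC_scaledComp {u : Fin 3 → ℝ → ℝ} (hu : ∀ i, P.LocAC (u i)) (i : Fin 3) :
    P.LocAC (scaledComp u i) := by
  fin_cases i
  · exact hu 0
  · exact hu 1
  · intro a ha
    have h1 : ContDiffOn ℝ 1 (fun r : ℝ => r⁻¹) (uIcc a P.r₀) := by
      rw [uIcc_of_le ha.2.le]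
      exact contDiffOn_id.inv fun r hr => (ha.1.trans_le hr.1).ne'
    exact h1.absolutelyContinuousOnInterval.fun_mul (hu 2 a ha)


/-- The strain controls ζ' only in the combination ζ' - ζ/r = r (ζ/r)'. With L the azimuthal strain,
r² (ζ/r)' = mξ - rL, which is where the weight r⁴ comes from; for ξ and η this weight is weaker than
needed but harmless. -/
theorem deriv_scaledComp_le {u : Fin 3 → ℝ → ℝ} (i : Fin 3) {r : ℝ} (hr : r ∈ Ioo 0 P.r₀)
    (hd : DifferentiableAt ℝ (u 2) r) :
    deriv (scaledComp u i) r ^ 2 * r ^ 4 ≤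
      (P.r₀ ^ 3 * (2 + 2 * k ^ 2 * P.r₀) + 2 * P.r₀ + 2 * m ^ 2) *
      (strainSq m k r (fun i => u i r) (fun i => deriv (u i) r) * r + u 0 r ^ 2) := by
  set S := strainSq m k r (fun i => u i r) (fun i => deriv (u i) r) with hS
  have hr0 := hr.1
  have hR : 0 < P.r₀ := hr.1.trans hr.2
  have hS0 : 0 ≤ S := strainSq_nonneg _ _ _ _ _
  have hSr : 0 ≤ S * r := mul_nonneg hS0 hr0.le
  have hr3 : r ^ 3 ≤ P.r₀ ^ 3 := pow_le_pow_left₀ hr0.le hr.2.le 3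
  have hc0 : 0 ≤ 2 * P.r₀ + 2 * (m : ℝ) ^ 2 := by positivity
  have hc1 : 0 ≤ P.r₀ ^ 3 * (2 + 2 * (k : ℝ) ^ 2 * P.r₀) := by positivity
  have key : ∀ y : ℝ, y ^ 2 * r ≤ (2 + 2 * k ^ 2 * P.r₀) * (S * r + u 0 r ^ 2) →
      y ^ 2 * r ^ 4 ≤ (P.r₀ ^ 3 * (2 + 2 * k ^ 2 * P.r₀) + 2 * P.r₀ + 2 * m ^ 2) *
        (S * r + u 0 r ^ 2) := by
    intro y hy
    have h1 : y ^ 2 * r * r ^ 3 ≤ (2 + 2 * k ^ 2 * P.r₀) * (S * r + u 0 r ^ 2) * P.r₀ ^ 3 :=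
      mul_le_mul hy hr3 (by positivity) (by positivity)
    have h2 : 0 ≤ (2 * P.r₀ + 2 * (m : ℝ) ^ 2) * (S * r + u 0 r ^ 2) :=
      mul_nonneg hc0 (by positivity)
    linarith
  have hk : 0 ≤ 2 * (k : ℝ) ^ 2 * P.r₀ := by positivity
  fin_cases i
  · apply key
    have h1 : deriv (u 0) r ^ 2 ≤ S := sq_radial_le_strainSq (m := m) (k := k) (r := r) (x := fun i => u i r)
      (y := fun i => deriv (u i) r)
    have h2 := mul_le_mul_of_nonneg_right h1 hr0.le
    have h3 : 0 ≤ (1 + 2 * (k : ℝ) ^ 2 * P.r₀) * (S * r + u 0 r ^ 2) := by positivity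
    change deriv (u 0) r ^ 2 * r ≤ _
    linarith [sq_nonneg (u 0 r)]
  · apply key
    have h1 := FinEnergy.deriv_one_le (m := m) (k := k) (u := u) hr
    have h3 : 0 ≤ 2 * (k : ℝ) ^ 2 * P.r₀ * (S * r) := by positivity
    change deriv (u 1) r ^ 2 * r ≤ _
    linarith [sq_nonneg (u 0 r)]
  · have h1 : deriv (scaledComp u 2) r = (deriv (u 2) r - u 2 r / r) / r := by
      have := ((hasDerivAt_inv hr0.ne').mul hd.hasDerivAt).deriv
      change deriv (fun x => x⁻¹ * u 2 x) r = _
      refine Eq.trans this ?_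
      field_simp
      ring
    change deriv (scaledComp u 2) r ^ 2 * r ^ 4 ≤ _
    have h2 : (-deriv (u 2) r + u 2 r / r + m / r * u 0 r) ^ 2 ≤ S :=
      sq_azimuthal_le_strainSq (m := m) (k := k) (r := r) (x := fun i => u i r)
        (y := fun i => deriv (u i) r)
    have h3 : deriv (scaledComp u 2) r ^ 2 * r ^ 4
        = ((-deriv (u 2) r + u 2 r / r + m / r * u 0 r) * r - m * u 0 r) ^ 2 := by
      rw [h1]
      field_simp
      ring
    rw [h3]
    have h4 : ((-deriv (u 2) r + u 2 r / r + m / r * u 0 r) * r - m * u 0 r) ^ 2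
        ≤ 2 * ((-deriv (u 2) r + u 2 r / r + m / r * u 0 r) ^ 2 * r ^ 2)
          + 2 * (m ^ 2 * u 0 r ^ 2) := by
      generalize (-deriv (u 2) r + u 2 r / r + m / r * u 0 r) = z
      linarith [sq_nonneg (z * r + m * u 0 r)]
    have h5 : (-deriv (u 2) r + u 2 r / r + m / r * u 0 r) ^ 2 * r ^ 2 ≤ P.r₀ * (S * r) := by
      calc _ ≤ S * r ^ 2 := mul_le_mul_of_nonneg_right h2 (sq_nonneg r)
        _ = r * (S * r) := by ring
        _ ≤ _ := mul_le_mul_of_nonneg_right hr.2.le hSr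
    have h6 : 0 ≤ P.r₀ ^ 3 * (2 + 2 * (k : ℝ) ^ 2 * P.r₀) * (S * r + u 0 r ^ 2) := by positivity
    have h7 : 0 ≤ P.r₀ * u 0 r ^ 2 := by positivity
    have h8 : 0 ≤ (m : ℝ) ^ 2 * (S * r) := by positivity
    linarith

theorem exists_scaledComp_bound (hP : P.Admissible) (m k : ℤ) :
    ∃ C : ℝ, 0 ≤ C ∧ ∀ u : Fin 3 → ℝ → ℝ, P.FinEnergy m k u → ∀ i,
      IntegrableOn (fun r => deriv (scaledComp u i) r ^ 2 * r ^ 4) (Ioo 0 P.r₀) ∧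
      ∫ r in Ioo 0 P.r₀, deriv (scaledComp u i) r ^ 2 * r ^ 4 ≤ C * P.normInt m k u ∧
      ∫ r in (P.r₀ / 3)..(P.r₀ / 2), scaledComp u i r ^ 2 ≤ C * P.normInt m k u := by
  have hR := hP.r₀_pos
  obtain ⟨C₀, hC₀, h0⟩ := exists_integral_sq_zero_le hP one_pos
  obtain ⟨C₁, hC₁, h1⟩ := exists_integral_sq_le_kinInt hP (a := P.r₀ / 3) (b := P.r₀ / 2)
    (by positivity) (by linarith) (by linarith)
  set D := P.r₀ ^ 3 * (2 + 2 * (k : ℝ) ^ 2 * P.r₀) + 2 * P.r₀ + 2 * (m : ℝ) ^ 2 with hD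
  have hD0 : 0 ≤ D := by positivity
  refine ⟨D * (2 + C₀) + C₁ * (1 + (3 / P.r₀) ^ 2), by positivity, fun u hu i => ?_⟩
  have hS := P.strainInt_nonneg m k u
  have hK := kinInt_nonneg hP u
  have hN : P.normInt m k u = P.strainInt m k u + P.kinInt u := rfl
  have hdom := (hu.strain.add (hu.integrable_sq_zero hP)).const_mul D
  have hle : ∀ᵐ r ∂volume.restrict (Ioo 0 P.r₀), deriv (scaledComp u i) r ^ 2 * r ^ 4 ≤
      D * (strainSq m k r (fun i => u i r) (fun i => deriv (u i) r) * r + u 0 r ^ 2) := by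
    filter_upwards [ae_restrict_mem measurableSet_Ioo, hu.ae_differentiableAt 2] with r hr hd
    exact deriv_scaledComp_le i hr hd
  have hint : IntegrableOn (fun r => deriv (scaledComp u i) r ^ 2 * r ^ 4) (Ioo 0 P.r₀) := by
    refine Integrable.mono' hdom
      (((measurable_deriv _).pow_const 2).mul (measurable_id'.pow_const 4)).aestronglyMeasurable ?_
    filter_upwards [hle] with r hr
    rw [Real.norm_of_nonneg (by positivity)]
    exact hr
  refine ⟨hint, ?_, ?_⟩
  · have h2 := integral_mono_ae hint hdom hle
    have h3 : ∫ r in Ioo 0 P.r₀, D *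
        (strainSq m k r (fun i => u i r) (fun i => deriv (u i) r) * r + u 0 r ^ 2)
        = D * (P.strainInt m k u + ∫ r in (0 : ℝ)..P.r₀, u 0 r ^ 2) := by
      rw [integral_const_mul, integral_add hu.strain (hu.integrable_sq_zero hP),
        intervalIntegral_eq_integral_Ioo hR.le, strainInt]
    have h4 := h0 m k u hu
    have h5 : D * (P.strainInt m k u + ∫ r in (0 : ℝ)..P.r₀, u 0 r ^ 2)
        ≤ D * ((2 + C₀) * P.normInt m k u) := by
      apply mul_le_mul_of_nonneg_left _ hD0
      rw [hN]
      nlinarith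
    have h6 : 0 ≤ C₁ * (1 + (3 / P.r₀) ^ 2) * P.normInt m k u := by
      rw [hN]
      positivity
    refine h2.trans (h3.le.trans (h5.trans ?_))
    linarith
  · have hab : P.r₀ / 3 ≤ P.r₀ / 2 := by linarith
    have key : ∫ r in (P.r₀ / 3)..(P.r₀ / 2), scaledComp u i r ^ 2
        ≤ (1 + (3 / P.r₀) ^ 2) * ∫ r in (P.r₀ / 3)..(P.r₀ / 2), u i r ^ 2 := by
      have hc : ∀ {f : ℝ → ℝ}, P.LocAC f → IntervalIntegrable (fun r => f r ^ 2) volume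
          (P.r₀ / 3) (P.r₀ / 2) := by
        intro f hf
        refine ContinuousOn.intervalIntegrable (ContinuousOn.pow ?_ 2)
        have h8 := (hf (P.r₀ / 3) ⟨by positivity, by linarith⟩).continuousOn
        refine h8.mono ?_
        rw [uIcc_of_le hab, uIcc_of_le (by linarith)]
        exact Icc_subset_Icc_right (by linarith)
      rw [← intervalIntegral.integral_const_mul]
      apply intervalIntegral.integral_mono_on hab (hc (locAC_scaledComp hu.ac i))
        ((hc (hu.ac i)).const_mul _)
      intro r hr
      have h9 : 0 ≤ (3 / P.r₀) ^ 2 * u i r ^ 2 := by positivity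
      have hrp : 0 < r := lt_of_lt_of_le (by positivity) hr.1
      fin_cases i
      · change u 0 r ^ 2 ≤ (1 + (3 / P.r₀) ^ 2) * u 0 r ^ 2
        change 0 ≤ (3 / P.r₀) ^ 2 * u 0 r ^ 2 at h9
        linarith
      · change u 1 r ^ 2 ≤ (1 + (3 / P.r₀) ^ 2) * u 1 r ^ 2
        change 0 ≤ (3 / P.r₀) ^ 2 * u 1 r ^ 2 at h9
        linarith
      · change (r⁻¹ * u 2 r) ^ 2 ≤ (1 + (3 / P.r₀) ^ 2) * u 2 r ^ 2
        have h10 : r⁻¹ ≤ 3 / P.r₀ := by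
          rw [show 3 / P.r₀ = (P.r₀ / 3)⁻¹ by rw [inv_div]]
          exact inv_anti₀ (by positivity) hr.1
        rw [mul_pow]
        have h11 : r⁻¹ ^ 2 ≤ (3 / P.r₀) ^ 2 := pow_le_pow_left₀ (by positivity) h10 2
        have h12 := mul_le_mul_of_nonneg_right h11 (sq_nonneg (u 2 r))
        linarith [sq_nonneg (u 2 r)]
    refine key.trans ?_
    have h2 := mul_le_mul_of_nonneg_left (h1 m k u hu i)
      (show 0 ≤ 1 + (3 / P.r₀) ^ 2 by positivity)
    have h3 : 0 ≤ D * (2 + C₀) * P.normInt m k u := by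
      rw [hN]
      positivity
    have h4 : (1 + (3 / P.r₀) ^ 2) * (C₁ * P.kinInt u)
        ≤ (1 + (3 / P.r₀) ^ 2) * (C₁ * P.normInt m k u) := by
      rw [hN]
      gcongr
      linarith
    linarith

/-- Completeness is applied to each rescaled component, with three nested extractions giving one
subsequence along which all derivatives converge. The third limit is multiplied by r to undo the
rescaling. -/
theorem exists_tendsto_deriv (hP : P.Admissible) {u : ℕ → Fin 3 → ℝ → ℝ}
    (hu : ∀ n, P.FinEnergy m k (u n))
    (hc : Tendsto (fun p : ℕ × ℕ => P.normInt m k (u p.1 - u p.2)) (atTop ×ˢ atTop) (𝓝 0)) :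
    ∃ w : Fin 3 → ℝ → ℝ, (∀ i, P.LocAC (w i)) ∧
      (∀ i, ∀ x ∈ Ioc 0 P.r₀, Tendsto (fun n => u n i x) atTop (𝓝 (w i x))) ∧
      ∃ ψ : ℕ → ℕ, Tendsto ψ atTop atTop ∧ ∀ᵐ r ∂volume.restrict (Ioo 0 P.r₀), ∀ i,
        Tendsto (fun n => deriv (u (ψ n) i) r) atTop (𝓝 (deriv (w i) r)) := by
  have hR := hP.r₀_pos
  obtain ⟨C, hC, hb⟩ := exists_scaledComp_bound hP m k
  have hd : ∀ p : ℕ × ℕ, P.FinEnergy m k (u p.1 - u p.2) := fun p => (hu p.1).sub hP (hu p.2)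
  have hc' := hc.const_mul C
  rw [mul_zero] at hc'
  have hex := fun i => exists_locAC_limit hR (f := fun n => scaledComp (u n) i)
    (fun n => locAC_scaledComp (hu n).ac i) (fun n => (hb _ (hu n) i).1)
    (squeeze_zero (fun p => setIntegral_nonneg measurableSet_Ioo fun r hr => by
      have := hr.1
      positivity) (fun p => by
      rw [← scaledComp_sub]
      exact (hb _ (hd p) i).2.1) hc')
    (a := P.r₀ / 3) (b := P.r₀ / 2) (by positivity) (by linarith) (by linarith)
    (squeeze_zero (fun p => intervalIntegral.integral_nonneg (by linarith) fun r _ =>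
      sq_nonneg _) (fun p => by
      have := (hb _ (hd p) i).2.2
      rw [scaledComp_sub] at this
      exact this) hc')
  choose g hgac hglim hgae using hex
  obtain ⟨ψ₀, hψ₀, ha₀⟩ := hgae 0 id tendsto_id
  obtain ⟨ψ₁, hψ₁, ha₁⟩ := hgae 1 ψ₀ hψ₀.tendsto_atTop
  obtain ⟨ψ₂, hψ₂, ha₂⟩ := hgae 2 (ψ₀ ∘ ψ₁) (hψ₀.comp hψ₁).tendsto_atTop
  set ψ : ℕ → ℕ := fun n => ψ₀ (ψ₁ (ψ₂ n)) with hψ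
  have hψt : Tendsto ψ atTop atTop := ((hψ₀.comp hψ₁).comp hψ₂).tendsto_atTop
  set w : Fin 3 → ℝ → ℝ := ![g 0, g 1, fun r => r * g 2 r] with hw
  have hwac : ∀ i, P.LocAC (w i) := by
    intro i
    fin_cases i
    · exact hgac 0
    · exact hgac 1
    · intro a ha
      have h1 : ContDiffOn ℝ 1 (fun r : ℝ => r) (uIcc a P.r₀) := contDiffOn_id
      exact h1.absolutelyContinuousOnInterval.fun_mul (hgac 2 a ha)
  have hwlim : ∀ i, ∀ x ∈ Ioc 0 P.r₀, Tendsto (fun n => u n i x) atTop (𝓝 (w i x)) := by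
    intro i x hx
    fin_cases i
    · exact hglim 0 x hx
    · exact hglim 1 x hx
    · have h1 := (hglim 2 x hx).const_mul x
      refine h1.congr fun n => ?_
      change x * (x⁻¹ * u n 2 x) = u n 2 x
      rw [mul_inv_cancel_left₀ hx.1.ne']
  have hdiff : ∀ᵐ r ∂volume.restrict (Ioo 0 P.r₀), (∀ i, DifferentiableAt ℝ (w i) r) ∧
      (∀ n i, DifferentiableAt ℝ (u n i) r) ∧ DifferentiableAt ℝ (g 2) r := by
    have h1 := ae_all_iff.2 fun i => ae_differentiableAt_of_locAC (hwac i)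
    have h2 := ae_all_iff.2 fun n => ae_all_iff.2 fun i => (hu n).ae_differentiableAt i
    filter_upwards [h1, h2, ae_differentiableAt_of_locAC (hgac 2)] with r h1 h2 h3
    exact ⟨h1, h2, h3⟩
  refine ⟨w, hwac, hwlim, ψ, hψt, ?_⟩
  filter_upwards [ae_restrict_mem measurableSet_Ioo, hdiff, ha₀, ha₁, ha₂]
    with r hr hd h0 h1 h2 i
  fin_cases i
  · exact h0.comp (hψ₁.comp hψ₂).tendsto_atTop
  · exact h1.comp hψ₂.tendsto_atTop
  · have h3 : deriv (w 2) r = g 2 r + r * deriv (g 2) r := deriv_id_mul hd.2.2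
    have h4 : ∀ n, deriv (u n 2) r
        = scaledComp (u n) 2 r + r * deriv (scaledComp (u n) 2) r := by
      intro n
      have h5 : u n 2 =ᶠ[𝓝 r] fun x => x * scaledComp (u n) 2 x := by
        filter_upwards [lt_mem_nhds hr.1] with x hx
        change u n 2 x = x * (x⁻¹ * u n 2 x)
        rw [mul_inv_cancel_left₀ (ne_of_gt hx)]
      rw [h5.deriv_eq]
      exact deriv_id_mul ((differentiableAt_inv hr.1.ne').mul (hd.2.1 n 2))
    change Tendsto (fun n => deriv (u (ψ n) 2) r) atTop (𝓝 (deriv (w 2) r))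
    rw [h3]
    simp only [h4]
    exact ((hglim 2 r ⟨hr.1, hr.2.le⟩).comp hψt).add (h2.const_mul r)

theorem tendsto_strain_add_kin {ι : Type*} {L : Filter ι} {x y : ι → Fin 3 → ℝ}
    {x₀ y₀ : Fin 3 → ℝ} (r : ℝ) (hx : ∀ i, Tendsto (fun l => x l i) L (𝓝 (x₀ i)))
    (hy : ∀ i, Tendsto (fun l => y l i) L (𝓝 (y₀ i))) :
    Tendsto (fun l => strainSq m k r (x l) (y l) * r
      + P.ρ r * (x l 0 ^ 2 + x l 1 ^ 2 + x l 2 ^ 2) * r) L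
      (𝓝 (strainSq m k r x₀ y₀ * r + P.ρ r * (x₀ 0 ^ 2 + x₀ 1 ^ 2 + x₀ 2 ^ 2) * r)) := by
  have hcont : Continuous fun z : (Fin 3 → ℝ) × (Fin 3 → ℝ) => strainSq m k r z.1 z.2 * r
      + P.ρ r * (z.1 0 ^ 2 + z.1 1 ^ 2 + z.1 2 ^ 2) * r := by
    unfold strainSq
    fun_prop
  have hz : Tendsto (fun l => (x l, y l)) L (𝓝 (x₀, y₀)) :=
    (tendsto_pi_nhds.2 hx).prodMk_nhds (tendsto_pi_nhds.2 hy)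
  have h := (hcont.tendsto (x₀, y₀)).comp hz
  simp only [Function.comp_def] at h
  exact h

/-- A Cauchy sequence of finite energy converges. -/
theorem exists_tendsto_normInt (hP : P.Admissible) {u : ℕ → Fin 3 → ℝ → ℝ}
    (hu : ∀ n, P.FinEnergy m k (u n))
    (hc : Tendsto (fun p : ℕ × ℕ => P.normInt m k (u p.1 - u p.2)) (atTop ×ˢ atTop) (𝓝 0)) :
    ∃ w : Fin 3 → ℝ → ℝ, P.FinEnergy m k w ∧
      Tendsto (fun n => P.normInt m k (u n - w)) atTop (𝓝 0) ∧
      ∀ i, ∀ x ∈ Ioc 0 P.r₀, Tendsto (fun n => u n i x) atTop (𝓝 (w i x)) := by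
  obtain ⟨w, hwac, hwlim, ψ, hψt, hder⟩ := exists_tendsto_deriv hP hu hc
  have hd : ∀ p : ℕ × ℕ, P.FinEnergy m k (u p.1 - u p.2) := fun p => (hu p.1).sub hP (hu p.2)
  have hdw := ae_all_iff.2 fun i => ae_differentiableAt_of_locAC (hwac i)
  have hdu := ae_all_iff.2 fun n => ae_all_iff.2 fun i => (hu n).ae_differentiableAt i
  set D : (Fin 3 → ℝ → ℝ) → ℝ → ℝ≥0∞ := fun v r => ENNReal.ofReal
      (strainSq m k r (fun i => v i r) (fun i => deriv (v i) r) * r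
        + P.ρ r * (v 0 r ^ 2 + v 1 r ^ 2 + v 2 r ^ 2) * r) with hD
  -- Almost everywhere convergence of values and derivatives, combined with the Cauchy property
  -- through Fatou, gives convergence in norm.
  have hlint : Tendsto (fun n => ∫⁻ r in Ioo 0 P.r₀, D (u n - w) r) atTop (𝓝 0) := by
    apply tendsto_lintegral_of_cauchy (F := fun n l => D (u n - u l)) _ _ hψt
    · intro n
      filter_upwards [ae_restrict_mem measurableSet_Ioo, hdu, hdw, hder] with r hr hdu hdw hdr
      apply ENNReal.tendsto_ofReal
      have hx : ∀ i, Tendsto (fun l => (u n - u (ψ l)) i r) atTop (𝓝 ((u n - w) i r)) := fun i =>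
        tendsto_const_nhds.sub ((hwlim i r ⟨hr.1, hr.2.le⟩).comp hψt)
      have hy : ∀ i, Tendsto (fun l => deriv ((u n - u (ψ l)) i) r) atTop
          (𝓝 (deriv ((u n - w) i) r)) := by
        intro i
        have h1 : ∀ l, deriv ((u n - u (ψ l)) i) r = deriv (u n i) r - deriv (u (ψ l) i) r :=
          fun l => deriv_sub (hdu n i) (hdu _ i)
        have h2 : deriv ((u n - w) i) r = deriv (u n i) r - deriv (w i) r :=
          deriv_sub (hdu n i) (hdw i)
        simp only [h1, h2]
        exact tendsto_const_nhds.sub (hdr i)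
      exact tendsto_strain_add_kin r hx hy
    · intro n l
      exact ((aemeasurable_strainSq (hd (n, l)).ac m k).add
        (aemeasurable_kin (hd (n, l)).ac hP)).ennreal_ofReal
    · have h1 := ENNReal.tendsto_ofReal hc
      rw [ENNReal.ofReal_zero] at h1
      exact h1.congr fun p => ofReal_normInt_eq hP (hd p)
  -- A finite lower integral for one difference already shows that w has finite energy.
  have hev : ∀ᶠ n in atTop, P.FinEnergy m k (u n - w) := by
    filter_upwards [hlint.eventually_lt_const (show (0 : ℝ≥0∞) < 1 by norm_num)] with n hn
    refine finEnergy_of_normSq_lt_top hP (fun i a ha => ((hu n).ac i a ha).sub (hwac i a ha)) ?_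
    refine (normSq_le_lintegral hP _).trans_lt ?_
    exact ENNReal.mul_lt_top ENNReal.ofReal_lt_top (hn.trans ENNReal.one_lt_top)
  obtain ⟨N, hN⟩ := hev.exists
  have hwfin : P.FinEnergy m k w := by
    have := (hu N).sub hP hN
    rwa [sub_sub_cancel] at this
  refine ⟨w, hwfin, ?_, hwlim⟩
  have h1 : Tendsto (fun n => ENNReal.ofReal (P.normInt m k (u n - w))) atTop (𝓝 0) :=
    hlint.congr fun n => (ofReal_normInt_eq hP ((hu n).sub hP hwfin)).symm
  have h2 := (ENNReal.tendsto_toReal ENNReal.zero_ne_top).comp h1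
  refine (h2.congr fun n => ?_)
  exact ENNReal.toReal_ofReal (normInt_nonneg hP _)

/-- The energy space is closed in the functions of finite energy. -/
theorem toDisp_mem_Space_of_tendsto (hP : P.Admissible) {u : ℕ → Fin 3 → ℝ → ℝ}
    (hu : ∀ n, toDisp (u n) ∈ P.Space m k) {w : Fin 3 → ℝ → ℝ} (hw : P.FinEnergy m k w)
    (hlim : Tendsto (fun n => P.normInt m k (u n - w)) atTop (𝓝 0)) :
    toDisp w ∈ P.Space m k := by
  rw [toDisp_mem_Space_iff hP]
  refine ⟨hw, fun ε hε => ?_⟩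
  obtain ⟨n, hn⟩ := (hlim.eventually_lt_const (show 0 < ε / 4 by positivity)).exists
  obtain ⟨hun, happ⟩ := (toDisp_mem_Space_iff hP).1 (hu n)
  obtain ⟨v, hv, hv'⟩ := happ (ε / 4) (by positivity)
  refine ⟨v, hv, ?_⟩
  have h1 := normInt_add_le hP ((hun.sub hP hw).smul (-1))
    (hun.sub hP (finEnergy_of_smoothCore hP hv))
  rw [normInt_smul hP (hun.sub hP hw)] at h1
  have h2 : (-1 : ℝ) • (u n - w) + (u n - v) = w - v := by
    rw [neg_one_smul]
    abel
  rw [h2] at h1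
  linarith

end ZPinch

theorem IsQuadFun.comp {V W : Type*} [AddCommGroup V] [Module ℝ V] [AddCommGroup W] [Module ℝ W]
    {q : V → ℝ} (hq : IsQuadFun q) {f : W → V} (hf : ∀ a b (t : ℝ), f (a + t • b) = f a + t • f b) :
    IsQuadFun fun w => q (f w) := by
  intro a b
  obtain ⟨c, hc⟩ := hq (f a) (f b)
  exact ⟨c, fun t => by simp only [hf, hc]⟩

namespace ZPinch

variable {P : ZPinch} {m k : ℤ}

/-! ### The vacuum field -/

theorem vacDens_nonneg {r : ℝ} (hr : 0 ≤ r) (x y : Fin 1 → ℝ) : 0 ≤ vacDens m k r x y := by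
  unfold vacDens
  positivity

theorem one_div_sq_add_le {R r : ℝ} (hR : 0 < R) (hr : R ≤ r) (m k : ℤ) :
    1 / ((m : ℝ) ^ 2 + k ^ 2 * r ^ 2) ≤ 1 + 1 / R ^ 2 := by
  have hR2 : R ^ 2 ≤ r ^ 2 := pow_le_pow_left₀ hR.le hr 2
  have h0 : 0 ≤ 1 / R ^ 2 := by positivity
  have hsq : ∀ n : ℤ, n ≠ 0 → (1 : ℝ) ≤ (n : ℝ) ^ 2 := by
    intro n hn
    have : 1 ≤ n ^ 2 := by
      have := sq_pos_of_ne_zero hn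
      lia
    exact_mod_cast this
  by_cases hm : m = 0
  · by_cases hk : k = 0
    -- For m = k = 0 the quotient is 1/0, which is 0, so the bound persists.
    · simp [hm, hk]
      positivity
    · have h1 : R ^ 2 ≤ (m : ℝ) ^ 2 + k ^ 2 * r ^ 2 := by
        have := mul_le_mul (hsq k hk) hR2 (by positivity) (by positivity)
        linarith [sq_nonneg (m : ℝ)]
      have := one_div_le_one_div_of_le (by positivity) h1
      linarith
  · have h1 : 1 ≤ (m : ℝ) ^ 2 + k ^ 2 * r ^ 2 := by
      have : 0 ≤ (k : ℝ) ^ 2 * r ^ 2 := by positivity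
      linarith [hsq m hm]
    have := one_div_le_one_div_of_le one_pos h1
    linarith

theorem vacDens_le (hP : P.Admissible) (m k : ℤ) : ∃ C : ℝ, ∀ r ∈ Ioo P.r₀ P.rw,
    ∀ x y : Fin 1 → ℝ, vacDens m k r x y ≤ C * (x 0 ^ 2 + y 0 ^ 2) := by
  have hR := hP.r₀_pos
  have hw := hP.r₀_lt_rw
  refine ⟨(1 + (1 + 1 / P.r₀ ^ 2) * (2 + 2 * P.rw ^ 2)) * P.rw, fun r hr x y => ?_⟩
  have hr0 : 0 < r := hR.trans hr.1
  have h1 := one_div_sq_add_le hR hr.1.le m k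
  have h2 : (x 0 + r * y 0) ^ 2 ≤ (2 + 2 * P.rw ^ 2) * (x 0 ^ 2 + y 0 ^ 2) := by
    have h3 : r ^ 2 * y 0 ^ 2 ≤ P.rw ^ 2 * y 0 ^ 2 :=
      mul_le_mul_of_nonneg_right (pow_le_pow_left₀ hr0.le hr.2.le 2) (sq_nonneg _)
    have h4 : 0 ≤ P.rw ^ 2 * x 0 ^ 2 := by positivity
    linarith [sq_nonneg (x 0 - r * y 0), sq_nonneg (y 0)]
  have h3 : 1 / ((m : ℝ) ^ 2 + k ^ 2 * r ^ 2) * (x 0 + r * y 0) ^ 2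
      ≤ (1 + 1 / P.r₀ ^ 2) * ((2 + 2 * P.rw ^ 2) * (x 0 ^ 2 + y 0 ^ 2)) :=
    mul_le_mul h1 h2 (sq_nonneg _) (by positivity)
  unfold vacDens
  calc _ ≤ ((1 + (1 + 1 / P.r₀ ^ 2) * (2 + 2 * P.rw ^ 2)) * (x 0 ^ 2 + y 0 ^ 2)) * P.rw := by
        refine mul_le_mul ?_ hr.2.le hr0.le (by positivity)
        linarith [sq_nonneg (y 0)]
    _ = _ := by ring

/-- Since rQ' = (rQ)' - Q, both parts occur in the density. For m ≠ 0 the denominator is positive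
and at most its value at the wall, so the weight of ((rQ)')² is bounded below. -/
theorem le_vacDens (hP : P.Admissible) (hm : m ≠ 0) (k : ℤ) : ∃ C : ℝ, 0 ≤ C ∧
    ∀ r ∈ Ioo P.r₀ P.rw, ∀ x y : Fin 1 → ℝ, y 0 ^ 2 ≤ C * vacDens m k r x y := by
  have hR := hP.r₀_pos
  have hw := hP.r₀_lt_rw
  set q := (m : ℝ) ^ 2 + k ^ 2 * P.rw ^ 2 with hq
  have hm2 : 0 < (m : ℝ) ^ 2 := by positivity
  have hq0 : 0 < q := by positivity
  refine ⟨2 * (q + 1) / P.r₀ ^ 3, by positivity, fun r hr x y => ?_⟩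
  have hr0 : 0 < r := hR.trans hr.1
  have h1 : (m : ℝ) ^ 2 + k ^ 2 * r ^ 2 ≤ q := by
    have := pow_le_pow_left₀ hr0.le hr.2.le 2
    rw [hq]
    gcongr
  have h0 : 0 < (m : ℝ) ^ 2 + k ^ 2 * r ^ 2 := by positivity
  have h2 : 1 ≤ q * (1 / ((m : ℝ) ^ 2 + k ^ 2 * r ^ 2)) := by
    rw [mul_one_div, one_le_div h0]
    exact h1
  rw [div_mul_eq_mul_div, le_div_iff₀ (by positivity)]
  set i := 1 / ((m : ℝ) ^ 2 + k ^ 2 * r ^ 2) with hi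
  have hi0 : 0 < i := by positivity
  have h3 : P.r₀ ^ 3 ≤ r ^ 3 := pow_le_pow_left₀ hR.le hr.1.le 3
  have h4 := mul_le_mul_of_nonneg_left h3 (sq_nonneg (y 0))
  have h5 : y 0 ^ 2 * r ^ 3 ≤ 2 * ((x 0 + r * y 0) ^ 2 + x 0 ^ 2) * r := by
    have := mul_nonneg (sq_nonneg (x 0 + (x 0 + r * y 0))) hr0.le
    nlinarith
  have h6 : (x 0 + r * y 0) ^ 2 ≤ q * (i * (x 0 + r * y 0) ^ 2) := by
    rw [← mul_assoc]
    exact le_mul_of_one_le_left (sq_nonneg _) h2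
  have h7 : (x 0 + r * y 0) ^ 2 + x 0 ^ 2 ≤ (q + 1) * (x 0 ^ 2 + i * (x 0 + r * y 0) ^ 2) := by
    have h8 : 0 ≤ q * x 0 ^ 2 := by positivity
    have h9 : 0 ≤ i * (x 0 + r * y 0) ^ 2 := by positivity
    linarith
  have h8 := mul_le_mul_of_nonneg_right h7 hr0.le
  unfold vacDens
  rw [← hi]
  linarith

theorem ae_differentiableAt_vacuum {Q : ℝ → ℝ} (hP : P.Admissible)
    (hQ : AbsolutelyContinuousOnInterval Q P.r₀ P.rw) :
    ∀ᵐ r ∂volume.restrict (Ioo P.r₀ P.rw), DifferentiableAt ℝ Q r := by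
  filter_upwards [ae_restrict_mem measurableSet_Ioo, ae_restrict_of_ae hQ.ae_differentiableAt]
    with r hr h
  exact h (by rw [uIcc_of_le hP.r₀_lt_rw.le]; exact Ioo_subset_Icc_self hr)

/-- The vacuum fields that vanish at the wall. -/
def vacSubmodule (P : ZPinch) (hP : P.Admissible) : Submodule ℝ (Fin 1 → ℝ → ℝ) where
  carrier := {Q | Q 0 ∈ P.VacuumH1 ∧ Q 0 P.rw = 0}
  add_mem' := by
    rintro Q Q' ⟨⟨h1, h2⟩, h3⟩ ⟨⟨h1', h2'⟩, h3'⟩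
    refine ⟨⟨h1.add h1', (h2.add h2').ae_eq ?_⟩, ?_⟩
    · filter_upwards [ae_differentiableAt_vacuum hP h1, ae_differentiableAt_vacuum hP h1']
        with r h h'
      exact (deriv_add h h').symm
    · change Q 0 P.rw + Q' 0 P.rw = 0
      rw [h3, h3', add_zero]
  zero_mem' := by
    refine ⟨⟨?_, ?_⟩, rfl⟩
    · exact (contDiffOn_const (c := (0 : ℝ)) (n := 1)).absolutelyContinuousOnInterval
    · change MemLp (deriv fun _ : ℝ => (0 : ℝ)) 2 _
      rw [deriv_const']
      exact MemLp.zero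
  smul_mem' := by
    rintro c Q ⟨⟨h1, h2⟩, h3⟩
    refine ⟨⟨h1.const_mul c, (h2.const_mul c).ae_eq ?_⟩, ?_⟩
    · filter_upwards [ae_differentiableAt_vacuum hP h1] with r h
      exact (deriv_const_mul c h).symm
    · change c * Q 0 P.rw = 0
      rw [h3, mul_zero]

theorem aemeasurable_vacDens {Q : Fin 1 → ℝ → ℝ} (hP : P.Admissible)
    (hQ : AbsolutelyContinuousOnInterval (Q 0) P.r₀ P.rw) (m k : ℤ) : AEMeasurable
      (fun r => vacDens m k r (fun i => Q i r) fun i => deriv (Q i) r)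
      (volume.restrict (Ioo P.r₀ P.rw)) := by
  have h0 : AEMeasurable (Q 0) (volume.restrict (Ioo P.r₀ P.rw)) := by
    refine (hQ.continuousOn.mono ?_).aemeasurable measurableSet_Ioo
    rw [uIcc_of_le hP.r₀_lt_rw.le]
    exact Ioo_subset_Icc_self
  have h1 : Measurable (deriv (Q 0)) := measurable_deriv _
  unfold vacDens
  fun_prop

theorem integrable_vacDens {Q : Fin 1 → ℝ → ℝ} (hP : P.Admissible) (hQ : Q 0 ∈ P.VacuumH1)
    (m k : ℤ) : IntegrableOn (fun r => vacDens m k r (fun i => Q i r) fun i => deriv (Q i) r)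
      (Ioo P.r₀ P.rw) := by
  obtain ⟨C, hC⟩ := vacDens_le hP m k
  have h0 : IntegrableOn (fun r => Q 0 r ^ 2) (Ioo P.r₀ P.rw) := by
    have h1 := (hQ.1.continuousOn.pow 2).intervalIntegrable (μ := volume)
    exact (intervalIntegrable_iff_integrableOn_Ioo_of_le hP.r₀_lt_rw.le).1 h1
  refine Integrable.mono' ((h0.add hQ.2.integrable_sq).const_mul C)
    (aemeasurable_vacDens hP hQ.1 m k).aestronglyMeasurable ?_
  filter_upwards [ae_restrict_mem measurableSet_Ioo] with r hr
  rw [Real.norm_of_nonneg (vacDens_nonneg (hP.r₀_pos.trans hr.1).le _ _)]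
  exact hC r hr _ _

theorem isQuadFun_vacInt (hP : P.Admissible) (m k : ℤ) :
    IsQuadFun fun Q : P.vacSubmodule hP => P.vacInt m k Q :=
  (isQuadFun_integral (P.vacSubmodule hP).subtype
    (q := fun r x y => vacDens m k r x y) (isQuadFun_vacDens m k)
    (fun Q i => by
      rw [Subsingleton.elim i 0]
      exact ae_differentiableAt_vacuum hP Q.2.1.1)
    (fun Q => integrable_vacDens hP Q.2.1 m k)).const_mul _

theorem vacInt_nonneg (hP : P.Admissible) (m k : ℤ) (Q : Fin 1 → ℝ → ℝ) :
    0 ≤ P.vacInt m k Q :=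
  mul_nonneg (by positivity) (setIntegral_nonneg measurableSet_Ioo fun _ hr =>
    vacDens_nonneg (hP.r₀_pos.trans hr.1).le _ _)

theorem ofReal_vacInt_eq (hP : P.Admissible) {Q : Fin 1 → ℝ → ℝ} (hQ : Q 0 ∈ P.VacuumH1)
    (m k : ℤ) : ENNReal.ofReal (P.vacInt m k Q) = ENNReal.ofReal (2 * Real.pi ^ 2) *
      ∫⁻ r in Ioo P.r₀ P.rw, ENNReal.ofReal
        (vacDens m k r (fun i => Q i r) fun i => deriv (Q i) r) := by
  rw [vacInt, ENNReal.ofReal_mul (by positivity),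
    ofReal_integral_eq_lintegral_ofReal (integrable_vacDens hP hQ m k)]
  filter_upwards [ae_restrict_mem measurableSet_Ioo] with r hr
  exact vacDens_nonneg (hP.r₀_pos.trans hr.1).le _ _

theorem memLp_deriv_of_vacDens (hP : P.Admissible) (hm : m ≠ 0) {Q : Fin 1 → ℝ → ℝ}
    (hQ : IntegrableOn (fun r => vacDens m k r (fun i => Q i r) fun i => deriv (Q i) r)
      (Ioo P.r₀ P.rw)) : MemLp (deriv (Q 0)) 2 (volume.restrict (Ioo P.r₀ P.rw)) := by
  obtain ⟨C, -, hC⟩ := le_vacDens hP hm k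
  refine (memLp_two_iff_integrable_sq (measurable_deriv _).aestronglyMeasurable).2 ?_
  refine Integrable.mono' (hQ.const_mul C)
    ((measurable_deriv _).pow_const 2).aestronglyMeasurable ?_
  filter_upwards [ae_restrict_mem measurableSet_Ioo] with r hr
  rw [Real.norm_of_nonneg (sq_nonneg _)]
  exact hC r hr (fun i => Q i r) fun i => deriv (Q i) r

theorem exists_vacuum_deriv_tendsto (hP : P.Admissible) (hm : m ≠ 0) {Q : ℕ → Fin 1 → ℝ → ℝ}
    (hQ : ∀ n, Q n ∈ P.vacSubmodule hP)
    (hc : Tendsto (fun p : ℕ × ℕ => P.vacInt m k (Q p.1 - Q p.2)) (atTop ×ˢ atTop) (𝓝 0)) :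
    ∃ g : ℝ → ℝ, AbsolutelyContinuousOnInterval g P.r₀ P.rw ∧
      (∀ x ∈ Icc P.r₀ P.rw, Tendsto (fun n => Q n 0 x) atTop (𝓝 (g x))) ∧
      ∃ ψ : ℕ → ℕ, StrictMono ψ ∧ ∀ᵐ r ∂volume.restrict (Ioo P.r₀ P.rw),
        Tendsto (fun n => deriv (Q (ψ n) 0) r) atTop (𝓝 (deriv g r)) := by
  have hR := hP.r₀_pos
  have hw := hP.r₀_lt_rw
  obtain ⟨C, hC0, hC⟩ := le_vacDens hP hm k
  have hrw : 0 < P.rw := hR.trans hw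
  have hd : ∀ p : ℕ × ℕ, Q p.1 - Q p.2 ∈ P.vacSubmodule hP := fun p => sub_mem (hQ _) (hQ _)
  have hmem : ∀ {F : Fin 1 → ℝ → ℝ}, F ∈ P.vacSubmodule hP →
      MemLp (fun r => deriv (F 0) r * r ^ 2) 2 (volume.restrict (Ioo P.r₀ P.rw)) ∧
      ∫ r in Ioo P.r₀ P.rw, (deriv (F 0) r * r ^ 2) ^ 2 ≤
        P.rw ^ 4 * C * ∫ r in Ioo P.r₀ P.rw, vacDens m k r (fun i => F i r)
          fun i => deriv (F i) r := by
    intro F hF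
    have hmeas : Measurable fun r => deriv (F 0) r * r ^ 2 :=
      (measurable_deriv _).mul (measurable_id'.pow_const 2)
    have hdom := (integrable_vacDens hP hF.1 m k).const_mul (P.rw ^ 4 * C)
    have hle : ∀ᵐ r ∂volume.restrict (Ioo P.r₀ P.rw), (deriv (F 0) r * r ^ 2) ^ 2 ≤
        P.rw ^ 4 * C * vacDens m k r (fun i => F i r) fun i => deriv (F i) r := by
      filter_upwards [ae_restrict_mem measurableSet_Ioo] with r hr
      have hr0 : 0 < r := hR.trans hr.1
      have h1 := hC r hr (fun i => F i r) fun i => deriv (F i) r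
      have h2 : r ^ 4 ≤ P.rw ^ 4 := pow_le_pow_left₀ hr0.le hr.2.le 4
      calc (deriv (F 0) r * r ^ 2) ^ 2 = r ^ 4 * deriv (F 0) r ^ 2 := by ring
        _ ≤ P.rw ^ 4 * (C * vacDens m k r (fun i => F i r) fun i => deriv (F i) r) :=
          mul_le_mul h2 h1 (sq_nonneg _) (by positivity)
        _ = _ := by ring
    have hint : IntegrableOn (fun r => (deriv (F 0) r * r ^ 2) ^ 2) (Ioo P.r₀ P.rw) := by
      refine Integrable.mono' hdom (hmeas.pow_const 2).aestronglyMeasurable ?_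
      filter_upwards [hle] with r hr
      rw [Real.norm_of_nonneg (sq_nonneg _)]
      exact hr
    refine ⟨(memLp_two_iff_integrable_sq hmeas.aestronglyMeasurable).2 hint, ?_⟩
    rw [← integral_const_mul]
    exact integral_mono_ae hint hdom hle
  have hae : ∀ p : ℕ × ℕ, ∀ᵐ r ∂volume.restrict (Ioo P.r₀ P.rw),
      deriv ((Q p.1 - Q p.2) 0) r = deriv (Q p.1 0) r - deriv (Q p.2 0) r := by
    intro p
    filter_upwards [ae_differentiableAt_vacuum hP (hQ p.1).1.1,
      ae_differentiableAt_vacuum hP (hQ p.2).1.1] with r h1 h2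
    exact deriv_sub h1 h2
  have hc' : Tendsto (fun p : ℕ × ℕ => ∫ r in Ioo P.r₀ P.rw,
      (deriv (Q p.1 0) r * r ^ 2 - deriv (Q p.2 0) r * r ^ 2) ^ 2) (atTop ×ˢ atTop) (𝓝 0) := by
    have h1 := hc.const_mul (P.rw ^ 4 * C * (1 / (2 * Real.pi ^ 2)))
    rw [mul_zero] at h1
    refine squeeze_zero (fun p => integral_nonneg fun r => sq_nonneg _) (fun p => ?_) h1
    have h2 := (hmem (hd p)).2
    have h3 : ∫ r in Ioo P.r₀ P.rw, (deriv ((Q p.1 - Q p.2) 0) r * r ^ 2) ^ 2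
        = ∫ r in Ioo P.r₀ P.rw,
          (deriv (Q p.1 0) r * r ^ 2 - deriv (Q p.2 0) r * r ^ 2) ^ 2 := by
      apply integral_congr_ae
      filter_upwards [hae p] with r hr
      rw [hr, sub_mul]
    rw [← h3]
    refine h2.trans (le_of_eq ?_)
    rw [vacInt]
    field_simp
  obtain ⟨g, h1, h2, h3⟩ := exists_ac_limit hR.le hw (f := fun n => Q n 0)
    (fun n a ha0 ha => (hQ n).1.1.mono (by
      rw [uIcc_of_le ha.2.le, uIcc_of_le hw.le]
      exact Icc_subset_Icc_left ha.1)) (fun n => (hmem (hQ n)).1)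
    (tendsto_eLpNorm_two_of_tendsto_integral_sq
      (fun p => (hmem (hQ p.1)).1.sub (hmem (hQ p.2)).1) hc')
    -- The anchor at the right end is free of charge: all fields vanish at the wall.
    (l := 0) (by
      simp only [(hQ _).2]
      exact tendsto_const_nhds)
  obtain ⟨ψ, hψ, h4⟩ := h3 id tendsto_id
  exact ⟨g, h1 P.r₀ hR ⟨le_rfl, hw⟩, fun x hx => h2 x (hR.trans_le hx.1) hx, ψ, hψ, h4⟩

/-- A Cauchy sequence of vacuum fields converges. -/
theorem exists_tendsto_vacInt (hP : P.Admissible) (hm : m ≠ 0) {Q : ℕ → Fin 1 → ℝ → ℝ}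
    (hQ : ∀ n, Q n ∈ P.vacSubmodule hP)
    (hc : Tendsto (fun p : ℕ × ℕ => P.vacInt m k (Q p.1 - Q p.2)) (atTop ×ˢ atTop) (𝓝 0)) :
    ∃ G ∈ P.vacSubmodule hP, Tendsto (fun n => P.vacInt m k (Q n - G)) atTop (𝓝 0) ∧
      Tendsto (fun n => Q n 0 P.r₀) atTop (𝓝 (G 0 P.r₀)) := by
  have hR := hP.r₀_pos
  have hw := hP.r₀_lt_rw
  obtain ⟨g, hgac, hglim, ψ, hψ, hder⟩ := exists_vacuum_deriv_tendsto hP hm hQ hc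
  have hd : ∀ p : ℕ × ℕ, Q p.1 - Q p.2 ∈ P.vacSubmodule hP := fun p => sub_mem (hQ _) (hQ _)
  have hdQ := ae_all_iff.2 fun n => ae_differentiableAt_vacuum hP (hQ n).1.1
  have hdg := ae_differentiableAt_vacuum hP hgac
  set G : Fin 1 → ℝ → ℝ := fun _ => g with hG
  have h2pi : (0 : ℝ) < 2 * Real.pi ^ 2 := by positivity
  have hlint : Tendsto (fun n => ∫⁻ r in Ioo P.r₀ P.rw, ENNReal.ofReal
      (vacDens m k r (fun i => (Q n - G) i r) fun i => deriv ((Q n - G) i) r))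
      atTop (𝓝 0) := by
    apply tendsto_lintegral_of_cauchy (F := fun n l r => ENNReal.ofReal
      (vacDens m k r (fun i => (Q n - Q l) i r) fun i => deriv ((Q n - Q l) i) r))
      _ _ hψ.tendsto_atTop
    · intro n
      filter_upwards [ae_restrict_mem measurableSet_Ioo, hdQ, hdg, hder] with r hr hdQ hdg hdr
      apply ENNReal.tendsto_ofReal
      have hx : Tendsto (fun l => (Q n - Q (ψ l)) 0 r) atTop (𝓝 ((Q n - G) 0 r)) :=
        tendsto_const_nhds.sub ((hglim r (Ioo_subset_Icc_self hr)).comp hψ.tendsto_atTop)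
      have hy : Tendsto (fun l => deriv ((Q n - Q (ψ l)) 0) r) atTop
          (𝓝 (deriv ((Q n - G) 0) r)) := by
        have h1 : ∀ l, deriv ((Q n - Q (ψ l)) 0) r = deriv (Q n 0) r - deriv (Q (ψ l) 0) r :=
          fun l => deriv_sub (hdQ n) (hdQ _)
        have h2 : deriv ((Q n - G) 0) r = deriv (Q n 0) r - deriv g r := deriv_sub (hdQ n) hdg
        simp only [h1, h2]
        exact tendsto_const_nhds.sub hdr
      exact ((hx.pow 2).add (((hx.add (hy.const_mul r)).pow 2).const_mul _)).mul_const r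
    · intro n l
      exact (aemeasurable_vacDens hP (hd (n, l)).1.1 m k).ennreal_ofReal
    · have h1 := ENNReal.Tendsto.const_mul (a := ENNReal.ofReal (1 / (2 * Real.pi ^ 2)))
        (ENNReal.tendsto_ofReal hc) (Or.inr ENNReal.ofReal_ne_top)
      rw [ENNReal.ofReal_zero, mul_zero] at h1
      refine h1.congr fun p => ?_
      rw [ofReal_vacInt_eq hP (hd p).1, ← mul_assoc, ← ENNReal.ofReal_mul (by positivity),
        one_div_mul_cancel h2pi.ne', ENNReal.ofReal_one, one_mul]
  have hGmem : G ∈ P.vacSubmodule hP := by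
    obtain ⟨n, hn⟩ := (hlint.eventually_lt_const (show (0 : ℝ≥0∞) < 1 by norm_num)).exists
    have hac : AbsolutelyContinuousOnInterval ((Q n - G) 0) P.r₀ P.rw := (hQ n).1.1.sub hgac
    have hint : IntegrableOn (fun r => vacDens m k r (fun i => (Q n - G) i r)
        fun i => deriv ((Q n - G) i) r) (Ioo P.r₀ P.rw) := by
      rw [IntegrableOn, ← lintegral_ofReal_ne_top_iff_integrable
        (aemeasurable_vacDens hP hac m k).aestronglyMeasurable]
      · exact (hn.trans ENNReal.one_lt_top).ne
      · filter_upwards [ae_restrict_mem measurableSet_Ioo] with r hr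
        exact vacDens_nonneg (hR.trans hr.1).le _ _
    refine ⟨⟨hgac, ?_⟩, ?_⟩
    · refine ((hQ n).1.2.sub (memLp_deriv_of_vacDens hP hm hint)).ae_eq ?_
      filter_upwards [hdQ, hdg] with r h1 h2
      have h3 : deriv ((Q n - G) 0) r = deriv (Q n 0) r - deriv g r := deriv_sub (h1 n) h2
      simp only [Pi.sub_apply (deriv (Q n 0)), h3]
      ring
    · have h1 := hglim P.rw ⟨hw.le, le_rfl⟩
      simp only [(hQ _).2] at h1
      exact tendsto_nhds_unique h1 tendsto_const_nhds
  refine ⟨G, hGmem, ?_, hglim P.r₀ ⟨le_rfl, hw.le⟩⟩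
  have h1 := ENNReal.Tendsto.const_mul (a := ENNReal.ofReal (2 * Real.pi ^ 2)) hlint
    (Or.inr ENNReal.ofReal_ne_top)
  rw [mul_zero] at h1
  have h2 : Tendsto (fun n => ENNReal.ofReal (P.vacInt m k (Q n - G))) atTop (𝓝 0) :=
    h1.congr fun n => (ofReal_vacInt_eq hP (sub_mem (hQ n) hGmem).1 m k).symm
  have h3 := (ENNReal.tendsto_toReal ENNReal.zero_ne_top).comp h2
  exact h3.congr fun n => ENNReal.toReal_ofReal (vacInt_nonneg hP m k _)

/-! ### Admissible pairs of a displacement and a vacuum field -/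

/-- The displacements and vacuum fields over which the energy is minimized, without the
normalization. For `m = 0` there is no vacuum field. -/
def pairs (P : ZPinch) (hP : P.Admissible) (m k : ℤ) :
    Submodule ℝ ((Fin 3 → ℝ → ℝ) × (Fin 1 → ℝ → ℝ)) where
  carrier := {w | w.1 ∈ P.spaceSubmodule hP m k ∧ w.2 ∈ P.vacSubmodule hP ∧
    m * P.Bvac P.r₀ * w.1 0 P.r₀ = P.r₀ * w.2 0 P.r₀ ∧ (m = 0 → w.2 = 0)}
  add_mem' := by
    rintro v w ⟨h1, h2, h3, h4⟩ ⟨h1', h2', h3', h4'⟩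
    refine ⟨add_mem h1 h1', add_mem h2 h2', ?_, fun hm => ?_⟩
    · change m * P.Bvac P.r₀ * (v.1 0 P.r₀ + w.1 0 P.r₀) = P.r₀ * (v.2 0 P.r₀ + w.2 0 P.r₀)
      rw [mul_add, mul_add, h3, h3']
    · rw [Prod.snd_add, h4 hm, h4' hm, add_zero]
  zero_mem' := by
    refine ⟨zero_mem _, zero_mem _, ?_, fun _ => rfl⟩
    change m * P.Bvac P.r₀ * 0 = P.r₀ * 0
    rw [mul_zero, mul_zero]
  smul_mem' := by
    rintro c w ⟨h1, h2, h3, h4⟩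
    refine ⟨Submodule.smul_mem _ c h1, Submodule.smul_mem _ c h2, ?_, fun hm => ?_⟩
    · change m * P.Bvac P.r₀ * (c * w.1 0 P.r₀) = P.r₀ * (c * w.2 0 P.r₀)
      linear_combination c * h3
    · rw [Prod.smul_snd, h4 hm, smul_zero]

theorem finEnergy_of_mem_pairs (hP : P.Admissible) {w : (Fin 3 → ℝ → ℝ) × (Fin 1 → ℝ → ℝ)}
    (hw : w ∈ P.pairs hP m k) : P.FinEnergy m k w.1 :=
  ((toDisp_mem_Space_iff hP).1 hw.1).1

/-- The part of the modified energy that does not involve the viscosity. -/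
def pairIdeal (P : ZPinch) (m k : ℤ) (w : (Fin 3 → ℝ → ℝ) × (Fin 1 → ℝ → ℝ)) : ℝ :=
  P.idealInt m k w.1 + P.vacInt m k w.2

theorem isQuadFun_pairs_vacInt (hP : P.Admissible) :
    IsQuadFun fun w : P.pairs hP m k => P.vacInt m k w.1.2 :=
  (isQuadFun_vacInt hP m k).comp (W := P.pairs hP m k) (f := fun w => ⟨w.1.2, w.2.2.1⟩)
    fun _ _ _ => rfl

theorem isQuadFun_pairs_dissInt (hP : P.Admissible) :
    IsQuadFun fun w : P.pairs hP m k => P.dissInt m k w.1.1 :=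
  (isQuadFun_dissInt hP).comp (W := P.pairs hP m k)
    (f := fun w => ⟨w.1.1, finEnergy_of_mem_pairs hP w.2⟩) fun _ _ _ => rfl

theorem isQuadFun_pairs_kinInt (hP : P.Admissible) :
    IsQuadFun fun w : P.pairs hP m k => P.kinInt w.1.1 :=
  (isQuadFun_kinInt hP).comp (W := P.pairs hP m k)
    (f := fun w => ⟨w.1.1, finEnergy_of_mem_pairs (m := m) (k := k) hP w.2⟩) fun _ _ _ => rfl

theorem isQuadFun_pairIdeal (hP : P.Admissible) :
    IsQuadFun fun w : P.pairs hP m k => P.pairIdeal m k w.1 :=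
  ((isQuadFun_idealInt hP).comp (W := P.pairs hP m k)
    (f := fun w => ⟨w.1.1, finEnergy_of_mem_pairs hP w.2⟩) fun _ _ _ => rfl).add
    (isQuadFun_pairs_vacInt hP)

/-- The normalized admissible pairs. -/
def unitPairs (P : ZPinch) (hP : P.Admissible) (m k : ℤ) :
    Set ((Fin 3 → ℝ → ℝ) × (Fin 1 → ℝ → ℝ)) :=
  {w | w ∈ P.pairs hP m k ∧ 2 * Real.pi ^ 2 * P.kinInt w.1 = 1}

theorem vacInt_zero : P.vacInt m k 0 = 0 := by
  have : ∀ r, vacDens m k r (fun i => (0 : Fin 1 → ℝ → ℝ) i r)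
      (fun i => deriv ((0 : Fin 1 → ℝ → ℝ) i) r) = 0 := by
    intro r
    simp [vacDens]
  simp only [vacInt, this, integral_zero, mul_zero]

/-- Both cases become the image of one set, independent of s, under functions affine in s with slope
`dissInt`. From here on m = 0 and m ≠ 0 are treated together. -/
theorem energyValues_eq (hP : P.Admissible) (m k : ℤ) (s : ℝ) : P.energyValues m k s =
    (fun w => P.pairIdeal m k w + s * P.dissInt m k w.1) '' P.unitPairs hP m k := by
  unfold energyValues
  ext e
  split_ifs with hm
  · subst hm
    constructor
    · rintro ⟨u, ⟨hu, hJ⟩, rfl⟩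
      have hu' : toDisp ![u.ξ, u.η, u.ζ] ∈ P.Space 0 k := hu
      refine ⟨(![u.ξ, u.η, u.ζ], 0), ⟨⟨hu', zero_mem _, ?_, fun _ => rfl⟩, ?_⟩, ?_⟩
      · simp
      · exact (J_toDisp hP _).symm.trans hJ
      · have := energyZero_toDisp hP ((toDisp_mem_Space_iff hP).1 hu').1 s
        refine Eq.trans ?_ this.symm
        simp only [pairIdeal, vacInt_zero, add_zero]
    · rintro ⟨w, ⟨hw, hJ⟩, rfl⟩
      refine ⟨toDisp w.1, ⟨hw.1, (J_toDisp hP _).trans hJ⟩, ?_⟩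
      rw [energyZero_toDisp hP (finEnergy_of_mem_pairs hP hw) s]
      simp only [pairIdeal, hw.2.2.2 rfl, vacInt_zero, add_zero]
  · constructor
    · rintro ⟨⟨u, Q⟩, ⟨hu, hQ, hJ, h1, h2⟩, rfl⟩
      have hu' : toDisp ![u.ξ, u.η, u.ζ] ∈ P.Space m k := hu
      refine ⟨(![u.ξ, u.η, u.ζ], fun _ => Q), ⟨⟨hu', ⟨hQ, h2⟩, h1, fun h => absurd h hm⟩, ?_⟩, ?_⟩
      · exact (J_toDisp hP _).symm.trans hJ
      · have := energyNonzero_toDisp hP hm ((toDisp_mem_Space_iff hP).1 hu').1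
          (Q := fun _ => Q) hQ.1 s
        refine Eq.trans ?_ this.symm
        simp only [pairIdeal]
        ring
    · rintro ⟨w, ⟨hw, hJ⟩, rfl⟩
      refine ⟨(toDisp w.1, w.2 0), ⟨hw.1, hw.2.1.1, (J_toDisp hP _).trans hJ, hw.2.2.1,
        hw.2.1.2⟩, ?_⟩
      change P.energyNonzero m k s (toDisp w.1) (w.2 0) = _
      rw [energyNonzero_toDisp hP hm (finEnergy_of_mem_pairs hP hw) hw.2.1.1.1 s]
      simp only [pairIdeal]
      ring

end ZPinch

namespace ZPinch

variable {P : ZPinch} {m k : ℤ}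

/-! ### Bounds for the modified energy -/

/-- The uniform lower bound for the modified energy. -/
theorem exists_coercive (hP : P.Admissible) : ∃ κ M : ℝ, 0 < κ ∧ 0 < M ∧
    ∀ (m k : ℤ) (w : (Fin 3 → ℝ → ℝ) × (Fin 1 → ℝ → ℝ)), w ∈ P.pairs hP m k → ∀ s : ℝ, 0 < s →
      s * κ * P.strainInt m k w.1 + P.vacInt m k w.2 ≤
        P.pairIdeal m k w + s * P.dissInt m k w.1
          + M * ∫ r in (0 : ℝ)..P.r₀, w.1 0 r ^ 2 := by
  obtain ⟨κ, hκ, h1⟩ := exists_mul_strainInt_le_dissInt hP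
  obtain ⟨M, hM, h2⟩ := exists_neg_le_idealInt hP
  refine ⟨κ, M, hκ, hM, fun m k w hw s hs => ?_⟩
  have hf := finEnergy_of_mem_pairs hP hw
  have h3 := mul_le_mul_of_nonneg_left (h1 m k w.1 hf) hs.le
  have h4 := h2 m k w.1 hf
  unfold pairIdeal
  linarith

theorem exists_neg_mul_kinInt_le (hP : P.Admissible) {s : ℝ} (hs : 0 < s) : ∃ C : ℝ, 0 ≤ C ∧
    ∀ (m k : ℤ) (w : (Fin 3 → ℝ → ℝ) × (Fin 1 → ℝ → ℝ)), w ∈ P.pairs hP m k →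
      -(C * P.kinInt w.1) ≤ P.pairIdeal m k w + s * P.dissInt m k w.1 := by
  obtain ⟨κ, M, hκ, hM, h1⟩ := exists_coercive hP
  -- With this δ the strain part of M ∫ ξ² is exactly the coercive term sκT.
  obtain ⟨C, hC, h2⟩ := exists_integral_sq_zero_le hP (δ := s * κ / M) (by positivity)
  refine ⟨M * C, by positivity, fun m k w hw => ?_⟩
  have h3 := h1 m k w hw s hs
  have h4 := mul_le_mul_of_nonneg_left (h2 m k w.1 (finEnergy_of_mem_pairs hP hw)) hM.le
  have h5 : M * (s * κ / M * P.strainInt m k w.1 + C * P.kinInt w.1)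
      = s * κ * P.strainInt m k w.1 + M * C * P.kinInt w.1 := by
    field_simp
  have h6 := vacInt_nonneg hP m k w.2
  linarith

theorem bddBelow_energyValues (hP : P.Admissible) (m k : ℤ) {s : ℝ} (hs : 0 < s) :
    BddBelow (P.energyValues m k s) := by
  obtain ⟨C, hC, h1⟩ := exists_neg_mul_kinInt_le hP hs
  rw [energyValues_eq hP]
  refine ⟨-(C * (1 / (2 * Real.pi ^ 2))), ?_⟩
  rintro _ ⟨w, ⟨hw, hJ⟩, rfl⟩
  have h2 := h1 m k w hw
  rwa [show P.kinInt w.1 = 1 / (2 * Real.pi ^ 2) by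
    rw [eq_div_iff (by positivity), mul_comm]; exact hJ] at h2

theorem pairEnergy_smul (hP : P.Admissible) {w : (Fin 3 → ℝ → ℝ) × (Fin 1 → ℝ → ℝ)}
    (hw : w ∈ P.pairs hP m k) (s c : ℝ) :
    P.pairIdeal m k (c • w) + s * P.dissInt m k (c • w).1
      = c ^ 2 * (P.pairIdeal m k w + s * P.dissInt m k w.1) :=
  ((isQuadFun_pairIdeal hP).add ((isQuadFun_pairs_dissInt hP).const_mul s)).map_smul c
    (⟨w, hw⟩ : P.pairs hP m k)

theorem exists_smul_mem_unitPairs (hP : P.Admissible) {w : (Fin 3 → ℝ → ℝ) × (Fin 1 → ℝ → ℝ)}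
    (hw : w ∈ P.pairs hP m k) (hK : 0 < P.kinInt w.1) :
    ∃ c : ℝ, c ^ 2 * (2 * Real.pi ^ 2 * P.kinInt w.1) = 1 ∧ c • w ∈ P.unitPairs hP m k := by
  have h0 : 0 < 2 * Real.pi ^ 2 * P.kinInt w.1 := by positivity
  have h1 : (√(1 / (2 * Real.pi ^ 2 * P.kinInt w.1))) ^ 2 * (2 * Real.pi ^ 2 * P.kinInt w.1)
      = 1 := by
    rw [Real.sq_sqrt (by positivity), one_div_mul_cancel h0.ne']
  refine ⟨_, h1, Submodule.smul_mem _ _ hw, ?_⟩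
  have h2 := (isQuadFun_pairs_kinInt hP).map_smul (√(1 / (2 * Real.pi ^ 2 * P.kinInt w.1)))
    (⟨w, hw⟩ : P.pairs hP m k)
  have h3 : P.kinInt ((√(1 / (2 * Real.pi ^ 2 * P.kinInt w.1))) • w).1
      = (√(1 / (2 * Real.pi ^ 2 * P.kinInt w.1))) ^ 2 * P.kinInt w.1 := h2
  rw [h3]
  linarith

/-! ### Test functions -/

theorem kinInt_pos (hP : P.Admissible) {u : Fin 3 → ℝ → ℝ} (hu : P.FinEnergy m k u) {a b : ℝ}
    (ha : 0 ≤ a) (hab : a < b) (hb : b ≤ P.r₀) (h : ∀ r ∈ Ioo a b, u 0 r ≠ 0) :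
    0 < P.kinInt u := by
  unfold kinInt
  rw [setIntegral_pos_iff_support_of_nonneg_ae ?_ hu.kin]
  · refine lt_of_lt_of_le ?_ (measure_mono (s := Ioo a b) fun r hr => ⟨?_, ?_⟩)
    · rw [Real.volume_Ioo]
      simpa using hab
    · have hr0 : 0 < r := ha.trans_lt hr.1
      have hρ := hP.ρ_pos ⟨hr0.le, hr.2.trans_le hb⟩
      have h1 : 0 < u 0 r ^ 2 := by
        have := h r hr
        positivity
      exact ne_of_gt (by positivity)
    · exact ⟨ha.trans_lt hr.1, hr.2.trans_le hb⟩
  · filter_upwards [ae_restrict_mem measurableSet_Ioo] with r hr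
    have := hP.ρ_nonneg (Ioo_subset_Icc_self hr)
    have := hr.1
    simp only [Pi.zero_apply]
    positivity

theorem exists_bump {a b : ℝ} (hab : a < b) : ∃ φ : ℝ → ℝ, ContDiff ℝ ∞ φ ∧
    (∀ r ∈ Ioo a b, φ r ≠ 0) ∧ ∀ r ∉ Ioo a b, φ r = 0 := by
  let f : ContDiffBump ((a + b) / 2) := ⟨(b - a) / 4, (b - a) / 2, by linarith, by linarith⟩
  have hs : Function.support f = Ioo a b := by
    rw [f.support_eq, Real.ball_eq_Ioo]
    congr 1
    · change (a + b) / 2 - (b - a) / 2 = a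
      ring
    · change (a + b) / 2 + (b - a) / 2 = b
      ring
  refine ⟨f, f.contDiff, fun r hr => ?_, fun r hr => ?_⟩
  · rw [← hs] at hr
    exact hr
  · rw [← hs] at hr
    exact Function.notMem_support.1 hr

theorem nonempty_energyValues (hP : P.Admissible) (m k : ℤ) (s : ℝ) :
    (P.energyValues m k s).Nonempty := by
  have hR := hP.r₀_pos
  -- A bump supported away from both ends lies in every core and has zero trace at r₀, so it pairs
  -- with the zero vacuum field.
  obtain ⟨φ, hφ, h1, h2⟩ := exists_bump (a := P.r₀ / 3) (b := P.r₀ / 2) (by linarith)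
  have hcore : P.SmoothCore m (toDisp ![φ, 0, 0]) :=
    ⟨hφ.contDiffOn, contDiffOn_const (c := (0 : ℝ)), contDiffOn_const (c := (0 : ℝ)),
      h2 0 (fun h => by linarith [h.1]), rfl, fun _ => rfl⟩
  have hw : (![φ, 0, 0], 0) ∈ P.pairs hP m k := by
    refine ⟨toDisp_mem_Space_of_smoothCore hP hcore, zero_mem _, ?_, fun _ => rfl⟩
    change m * P.Bvac P.r₀ * φ P.r₀ = P.r₀ * 0
    rw [h2 P.r₀ fun h => by linarith [h.2], mul_zero, mul_zero]
  obtain ⟨c, -, hc⟩ := exists_smul_mem_unitPairs hP hw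
    (kinInt_pos hP (finEnergy_of_mem_pairs hP hw) (by positivity) (by linarith) (by linarith) h1)
  rw [energyValues_eq hP]
  exact ⟨_, mem_image_of_mem _ hc⟩

theorem isGLB_lowest (hP : P.Admissible) (m k : ℤ) {s : ℝ} (hs : 0 < s) :
    IsGLB ((fun w => P.pairIdeal m k w + s * P.dissInt m k w.1) '' P.unitPairs hP m k)
      (P.lowest m k s) := by
  rw [← energyValues_eq hP]
  exact isGLB_csInf (nonempty_energyValues hP m k s) (bddBelow_energyValues hP m k hs)

theorem existsUnique_isGrowthRate (hP : P.Admissible) (h : (P.negSet m k).Nonempty) :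
    ∃! s : ℝ, P.IsGrowthRate m k s :=
  existsUnique_sqrt_neg_eq (fun w _ => dissInt_nonneg hP w.1)
    (fun _ hs => isGLB_lowest hP m k hs) h

/-- Near r₀ one has p ≤ (r₀/8γ)|p'| and r > r₀/2, hence 2rp' ≤ -r₀|p'| ≤ -8γp. The sum is at most
-4γp, and strictness comes from p > 0 inside. -/
theorem exists_Ioo_pressure_neg (hP : P.Admissible) : ∃ a, 0 ≤ a ∧ a < P.r₀ ∧
    ∀ r ∈ Ioo a P.r₀, 2 * r * P.dp r + 4 * P.γ * P.p r < 0 := by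
  have hR := hP.r₀_pos
  have hγ : 0 < P.γ := one_pos.trans hP.one_lt_γ
  obtain ⟨ϵ, hϵ, hdp⟩ := hP.dp_nonpos
  have h1 := hP.p_littleO.def (c := P.r₀ / (8 * P.γ)) (by positivity)
  obtain ⟨a, ha, h2⟩ := (mem_nhdsLT_iff_exists_Ioo_subset' (show P.r₀ / 2 < P.r₀ by linarith)).1 h1
  refine ⟨max (max a (P.r₀ / 2)) (P.r₀ - ϵ), ?_, ?_, fun r hr => ?_⟩
  · exact le_max_of_le_left (le_max_of_le_right (by positivity))
  · exact max_lt (max_lt ha (by linarith)) (by linarith)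
  · have hra : a < r := (le_max_left _ _).trans (le_max_left _ _) |>.trans_lt hr.1
    have hrh : P.r₀ / 2 < r := (le_max_right _ _).trans (le_max_left _ _) |>.trans_lt hr.1
    have hrϵ : P.r₀ - ϵ < r := (le_max_right _ _).trans_lt hr.1
    have h3 : ‖P.p r‖ ≤ P.r₀ / (8 * P.γ) * ‖P.dp r‖ := h2 ⟨hra, hr.2⟩
    have h4 := hdp r ⟨hrϵ, hr.2.le⟩
    have h5 := hP.p_pos ⟨by linarith, hr.2⟩
    rw [Real.norm_of_nonneg h5.le, Real.norm_of_nonpos h4, div_mul_eq_mul_div,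
      le_div_iff₀ (by positivity)] at h3
    have h6 : 0 < P.γ * P.p r := by positivity
    have h7 : 0 ≤ (r - P.r₀ / 2) * -P.dp r := mul_nonneg (by linarith) (by linarith)
    linarith

/-- With ξ = rφ and kη = rφ' the magnetic square vanishes and the divergence (rξ)'/r - kη reduces to
2φ. The density becomes φ² r (2rp' + 4γp), and φ is supported where the bracket is negative. -/
theorem exists_idealInt_neg (hP : P.Admissible) (hk : k ≠ 0) :
    ∃ w ∈ P.pairs hP 0 k, 0 < P.kinInt w.1 ∧ P.pairIdeal 0 k w < 0 := by
  have hR := hP.r₀_pos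
  have hkR : (k : ℝ) ≠ 0 := by exact_mod_cast hk
  obtain ⟨a, ha0, har, hneg⟩ := exists_Ioo_pressure_neg hP
  obtain ⟨φ, hφ, h1, h2⟩ := exists_bump har
  have hφ' : ContDiff ℝ ∞ (deriv φ) := (contDiff_infty_iff_deriv.1 hφ).2
  set u : Fin 3 → ℝ → ℝ := ![fun r => r * φ r, fun r => r * deriv φ r / k, 0] with hu
  have hcore : P.SmoothCore 0 (toDisp u) :=
    ⟨(contDiff_id.mul hφ).contDiffOn, ((contDiff_id.mul hφ').div_const _).contDiffOn,
      contDiffOn_const (c := (0 : ℝ)), zero_mul _, rfl, fun h => absurd rfl h⟩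
  have hw : (u, 0) ∈ P.pairs hP 0 k :=
    ⟨toDisp_mem_Space_of_smoothCore hP hcore, zero_mem _, by simp, fun _ => rfl⟩
  have hf := finEnergy_of_mem_pairs hP hw
  refine ⟨_, hw, kinInt_pos hP hf ha0 har le_rfl fun r hr =>
    mul_ne_zero (ha0.trans_lt hr.1).ne' (h1 r hr), ?_⟩
  have hdens : ∀ r ∈ Ioo 0 P.r₀, P.idealDens 0 k r (fun i => u i r) (fun i => deriv (u i) r)
      = φ r ^ 2 * r * (2 * r * P.dp r + 4 * P.γ * P.p r) := by
    intro r hr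
    have hr0 := hr.1.ne'
    have hd : deriv (u 0) r = φ r + r * deriv φ r :=
      deriv_id_mul ((hφ.differentiable (by simp)).differentiableAt)
    have e0 : u 0 r = r * φ r := rfl
    have e1 : u 1 r = r * deriv φ r / k := rfl
    have e2 : u 2 r = 0 := rfl
    simp only [idealDens, hd, e0, e1, e2]
    push_cast
    field_simp
    ring
  have hint : IntegrableOn (fun r => -P.idealDens 0 k r (fun i => u i r)
      fun i => deriv (u i) r) (Ioo 0 P.r₀) := (hf.integrable_idealDens hP).neg
  have hpos : 0 < ∫ r in Ioo 0 P.r₀,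
      -P.idealDens 0 k r (fun i => u i r) (fun i => deriv (u i) r) := by
    rw [setIntegral_pos_iff_support_of_nonneg_ae ?_ hint]
    · refine lt_of_lt_of_le ?_ (measure_mono (s := Ioo a P.r₀) fun r hr => ⟨?_, ?_⟩)
      · rw [Real.volume_Ioo]
        simpa using har
      · have hr0 : 0 < r := ha0.trans_lt hr.1
        rw [Function.mem_support, neg_ne_zero, hdens r ⟨hr0, hr.2⟩]
        exact mul_ne_zero (mul_ne_zero (pow_ne_zero 2 (h1 r hr)) hr0.ne') (hneg r hr).ne
      · exact ⟨ha0.trans_lt hr.1, hr.2⟩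
    · filter_upwards [ae_restrict_mem measurableSet_Ioo] with r hr
      rw [Pi.zero_apply, hdens r hr, neg_nonneg]
      by_cases hra : r ∈ Ioo a P.r₀
      · exact mul_nonpos_of_nonneg_of_nonpos (mul_nonneg (sq_nonneg _) hr.1.le) (hneg r hra).le
      · rw [h2 r hra]
        simp
  rw [integral_neg] at hpos
  simp only [pairIdeal, vacInt_zero, add_zero, idealInt]
  exact mul_neg_of_pos_of_neg (by positivity) (by linarith)

theorem nonempty_negSet (hP : P.Admissible) (hk : k ≠ 0) : (P.negSet 0 k).Nonempty := by
  obtain ⟨w, hw, hK, hI⟩ := exists_idealInt_neg hP hk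
  have hD := dissInt_nonneg (m := 0) (k := k) hP w.1
  -- So small that the dissipation uses at most half of the negative ideal energy; the +1 covers
  -- vanishing dissipation.
  set s := -P.pairIdeal 0 k w / (2 * (P.dissInt 0 k w.1 + 1)) with hs
  have hs0 : 0 < s := div_pos (by linarith) (by positivity)
  have hneg : P.pairIdeal 0 k w + s * P.dissInt 0 k w.1 < 0 := by
    have h1 : s * (2 * (P.dissInt 0 k w.1 + 1)) = -P.pairIdeal 0 k w :=
      div_mul_cancel₀ _ (by positivity)
    have h2 : 0 ≤ s * P.dissInt 0 k w.1 := mul_nonneg hs0.le hD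
    linarith
  refine ⟨s, hs0, ?_⟩
  obtain ⟨c, hc, hcw⟩ := exists_smul_mem_unitPairs hP hw hK
  have h1 := (isGLB_lowest hP 0 k hs0).1 (mem_image_of_mem _ hcw)
  simp only [pairEnergy_smul hP hw s c] at h1
  have hc2 : 0 < c ^ 2 := by
    refine lt_of_le_of_ne (sq_nonneg c) fun h => ?_
    rw [← h, zero_mul] at hc
    exact zero_ne_one hc
  exact h1.trans_lt (mul_neg_of_pos_of_neg hc2 hneg)

/-! ### Decay of the growth rates -/

theorem IsGrowthRate.lowest_eq {s : ℝ} (h : P.IsGrowthRate m k s) : P.lowest m k s = -s ^ 2 := by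
  have h1 := Real.sq_sqrt (show 0 ≤ -P.lowest m k s by linarith [h.1.2])
  have h2 : Real.sqrt (-P.lowest m k s) = s := h.2
  rw [h2] at h1
  linarith

theorem exists_isGrowthRate_lt (hP : P.Admissible) {c : ℝ} (hc : 0 < c) :
    ∃ N : ℕ, ∀ (m k : ℤ) (s : ℝ), P.IsGrowthRate m k s →
      ((N : ℤ) ≤ |m| ∨ (N : ℤ) ≤ |k|) → s < c := by
  obtain ⟨κ, M, hκ, hM, h1⟩ := exists_coercive hP
  -- For s ≥ c the first entry lets sκT absorb the strain part of M ∫ ξ², and the second bounds the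
  -- kinetic remainder by c²K.
  set δ := min (c * κ / M) (c ^ 2 / M) with hδ
  have hδ0 : 0 < δ := lt_min (by positivity) (by positivity)
  obtain ⟨N, hN⟩ := exists_integral_sq_zero_le_of_large hP hδ0
  refine ⟨N, fun m k s hs hmk => ?_⟩
  by_contra! hcs
  have hs0 : 0 < s := hs.1.1
  have hMδ : M * δ ≤ c * κ := by
    have := min_le_left (c * κ / M) (c ^ 2 / M)
    rw [← hδ, le_div_iff₀ hM] at this
    linarith
  have hMδ' : M * δ ≤ c ^ 2 := by
    have := min_le_right (c * κ / M) (c ^ 2 / M)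
    rw [← hδ, le_div_iff₀ hM] at this
    linarith
  have h2 : -(c ^ 2 * (1 / (2 * Real.pi ^ 2))) ≤ P.lowest m k s := by
    refine (isGLB_lowest hP m k hs0).2 ?_
    rintro _ ⟨w, ⟨hw, hJ⟩, rfl⟩
    have hK : P.kinInt w.1 = 1 / (2 * Real.pi ^ 2) := by
      rw [eq_div_iff (by positivity), mul_comm]
      exact hJ
    have h3 := h1 m k w hw s hs0
    have h4 := mul_le_mul_of_nonneg_left (hN m k hmk w.1 (finEnergy_of_mem_pairs hP hw)) hM.le
    have h5 := vacInt_nonneg hP m k w.2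
    have hT := P.strainInt_nonneg m k w.1
    have h6 : M * δ * P.strainInt m k w.1 ≤ s * κ * P.strainInt m k w.1 :=
      mul_le_mul_of_nonneg_right (hMδ.trans (mul_le_mul_of_nonneg_right hcs hκ.le)) hT
    have h7 : M * δ * P.kinInt w.1 ≤ c ^ 2 * P.kinInt w.1 :=
      mul_le_mul_of_nonneg_right hMδ' (kinInt_nonneg hP w.1)
    rw [← hK]
    simp only
    linarith
  rw [hs.lowest_eq] at h2
  -- The normalization is 2π²K = 1, and 2π² > 1 makes the bound strict: λ(s) > -c² ≥ -s², contrary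
  -- to λ(s) = -s².
  have h8 : 1 / (2 * Real.pi ^ 2) < 1 := by
    rw [div_lt_one (by positivity)]
    nlinarith [Real.pi_gt_three]
  have h9 : c ^ 2 ≤ s ^ 2 := pow_le_pow_left₀ hc.le hcs 2
  have h10 := mul_lt_mul_of_pos_left h8 (show 0 < c ^ 2 by positivity)
  linarith

theorem finite_modes (hP : P.Admissible) {c : ℝ} (hc : 0 < c) :
    {mk : ℤ × ℤ | ∃ s : ℝ, c ≤ s ∧ P.IsGrowthRate mk.1 mk.2 s}.Finite := by
  obtain ⟨N, hN⟩ := exists_isGrowthRate_lt hP hc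
  refine ((finite_Ioo (-(N : ℤ)) N).prod (finite_Ioo (-(N : ℤ)) N)).subset ?_
  rintro ⟨m, k⟩ ⟨s, hcs, hs⟩
  by_contra h
  refine (hN m k s hs ?_).not_ge hcs
  by_contra! h'
  exact h ⟨abs_lt.1 h'.1, abs_lt.1 h'.2⟩

/-- The unstable mode (0, 1) supplies a rate s₁ > 0. Only finitely many modes have a rate at least
s₁, each with a single rate, so the maximum is taken over a finite nonempty set. -/
theorem exists_isGreatest_growthRate (hP : P.Admissible) :
    ∃ Λ : ℝ, 0 < Λ ∧ IsGreatest {s : ℝ | ∃ m k : ℤ, P.IsGrowthRate m k s} Λ := by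
  obtain ⟨s₁, hs₁, -⟩ := existsUnique_isGrowthRate hP (nonempty_negSet hP one_ne_zero)
  have h0 : 0 < s₁ := hs₁.1.1
  have hfin : {s : ℝ | s₁ ≤ s ∧ ∃ m k : ℤ, P.IsGrowthRate m k s}.Finite := by
    refine ((finite_modes hP h0).biUnion (t := fun mk => {s | P.IsGrowthRate mk.1 mk.2 s})
      fun mk _ => ?_).subset ?_
    · refine Set.Subsingleton.finite fun s hs t ht => ?_
      exact (existsUnique_isGrowthRate hP ⟨s, (hs : P.IsGrowthRate mk.1 mk.2 s).1⟩).unique hs ht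
    · rintro s ⟨h1, m, k, h2⟩
      exact mem_biUnion (x := (m, k)) ⟨s, h1, h2⟩ h2
  obtain ⟨Λ, ⟨h1, h2⟩, h3⟩ := exists_max_image _ id hfin ⟨s₁, le_rfl, 0, 1, hs₁⟩
  refine ⟨Λ, h0.trans_le h1, h2, fun s hs => ?_⟩
  by_cases h : s₁ ≤ s
  · exact h3 s ⟨h, hs⟩
  · exact (not_le.1 h).le.trans h1

end ZPinch

namespace ZPinch

variable {P : ZPinch} {m k : ℤ}

/-! ### Attainment of the infimum -/

theorem isQuadFun_pairs_integral_sq (hP : P.Admissible) :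
    IsQuadFun fun w : P.pairs hP m k => ∫ r in (0 : ℝ)..P.r₀, w.1.1 0 r ^ 2 := by
  have h : IsQuadFun fun u : P.finSubmodule hP m k => ∫ r in Ioo 0 P.r₀, u.1 0 r ^ 2 :=
    isQuadFun_integral (P.finSubmodule hP m k).subtype (q := fun _ x _ => x 0 ^ 2)
      (fun r => .of_forall fun a b t => by
        simp only [Prod.fst_add, Prod.smul_fst, Pi.add_apply, Pi.smul_apply, smul_eq_mul]
        ring)
      (fun u i => u.2.ae_differentiableAt i) (fun u => u.2.integrable_sq_zero hP)
  simp only [intervalIntegral_eq_integral_Ioo hP.r₀_pos.le]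
  exact h.comp (W := P.pairs hP m k) (f := fun w => ⟨w.1.1, finEnergy_of_mem_pairs hP w.2⟩)
    fun _ _ _ => rfl

/-- A Cauchy sequence of admissible pairs converges to an admissible pair. -/
theorem exists_pairs_tendsto (hP : P.Admissible) (u : ℕ → P.pairs hP m k)
    (h1 : Tendsto (fun p : ℕ × ℕ => P.normInt m k (u p.1 - u p.2).1.1) (atTop ×ˢ atTop) (𝓝 0))
    (h2 : Tendsto (fun p : ℕ × ℕ => P.vacInt m k (u p.1 - u p.2).1.2) (atTop ×ˢ atTop) (𝓝 0)) :
    ∃ w : P.pairs hP m k, Tendsto (fun n => P.normInt m k (u n - w).1.1) atTop (𝓝 0) ∧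
      Tendsto (fun n => P.vacInt m k (u n - w).1.2) atTop (𝓝 0) := by
  have hR := hP.r₀_pos
  obtain ⟨w, hw, hlim, hpt⟩ := exists_tendsto_normInt hP (u := fun n => (u n).1.1)
    (fun n => finEnergy_of_mem_pairs hP (u n).2) h1
  have hwS : w ∈ P.spaceSubmodule hP m k :=
    toDisp_mem_Space_of_tendsto hP (fun n => (u n).2.1) hw hlim
  by_cases hm : m = 0
  · have hQ : ∀ n, (u n).1.2 = 0 := fun n => (u n).2.2.2.2 hm
    refine ⟨⟨(w, 0), hwS, zero_mem _, by simp [hm], fun _ => rfl⟩, hlim, ?_⟩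
    have h3 : ∀ n, (u n).1.2 - (0 : Fin 1 → ℝ → ℝ) = 0 := fun n => by rw [hQ, sub_zero]
    change Tendsto (fun n => P.vacInt m k ((u n).1.2 - (0 : Fin 1 → ℝ → ℝ))) atTop (𝓝 0)
    simp only [h3, vacInt_zero]
    exact tendsto_const_nhds
  · obtain ⟨G, hG, hGlim, hGpt⟩ := exists_tendsto_vacInt hP hm (Q := fun n => (u n).1.2)
      (fun n => (u n).2.2.1) h2
    refine ⟨⟨(w, G), hwS, hG, ?_, fun h => absurd h hm⟩, hlim, hGlim⟩
    -- Norm convergence is accompanied by convergence of the values at r₀ on both sides of the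
    -- interface, so the linking condition passes to the limit.
    refine tendsto_nhds_unique ((hpt 0 P.r₀ ⟨hR, le_rfl⟩).const_mul (m * P.Bvac P.r₀)) ?_
    exact (hGpt.const_mul P.r₀).congr fun n => (u n).2.2.2.1.symm

/-- Compactness is needed for ξ alone, since the negative part of the energy involves nothing else;
η, ζ and the vacuum field follow from the parallelogram argument. -/
theorem exists_subseq_pairs (hP : P.Admissible) {u : ℕ → P.pairs hP m k} {M : ℝ}
    (hT : ∀ n, P.strainInt m k (u n).1.1 ≤ M) (hK : ∀ n, P.kinInt (u n).1.1 ≤ M) :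
    ∃ φ : ℕ → ℕ, StrictMono φ ∧ Tendsto (fun p : ℕ × ℕ =>
      ∫ r in (0 : ℝ)..P.r₀, (u (φ p.1) - u (φ p.2)).1.1 0 r ^ 2) (atTop ×ˢ atTop) (𝓝 0) := by
  have hR := hP.r₀_pos
  have hf := fun n => finEnergy_of_mem_pairs hP (u n).2
  obtain ⟨C, hC, h1⟩ := exists_integral_sq_le_kinInt hP (a := P.r₀ / 3) (b := P.r₀ / 2)
    (by positivity) (by linarith) (by linarith)
  exact exists_subseq_integral_sq_sub_tendsto hR (f := fun n => (u n).1.1 0)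
    (fun n => (hf n).ac 0) (fun n => (hf n).intervalIntegrable_deriv_zero hP)
    (fun n => ((hf n).integral_deriv_zero_le hP).trans (hT n)) (a := P.r₀ / 3) (b := P.r₀ / 2)
    (by positivity) (by linarith) (by linarith)
    (fun n => (h1 m k _ (hf n) 0).trans (mul_le_mul_of_nonneg_left (hK n) hC))

theorem lowest_mul_kinInt_le (hP : P.Admissible) {s : ℝ} (hs : 0 < s)
    {w : (Fin 3 → ℝ → ℝ) × (Fin 1 → ℝ → ℝ)} (hw : w ∈ P.pairs hP m k) :
    P.lowest m k s * (2 * Real.pi ^ 2 * P.kinInt w.1)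
      ≤ P.pairIdeal m k w + s * P.dissInt m k w.1 := by
  -- A pair with zero kinetic energy cannot be normalized; the bound -C·K shows directly that its
  -- energy is nonnegative.
  rcases (kinInt_nonneg hP w.1).eq_or_lt with hK | hK
  · obtain ⟨C, -, h⟩ := exists_neg_mul_kinInt_le hP hs
    have := h m k w hw
    rw [← hK] at this ⊢
    linarith
  · obtain ⟨c, hc, hcw⟩ := exists_smul_mem_unitPairs hP hw hK
    have h1 := (isGLB_lowest hP m k hs).1 (mem_image_of_mem _ hcw)
    simp only [pairEnergy_smul hP hw s c] at h1
    have h2 := mul_le_mul_of_nonneg_right h1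
      (show 0 ≤ 2 * Real.pi ^ 2 * P.kinInt w.1 by positivity)
    refine h2.trans (le_of_eq ?_)
    linear_combination (P.pairIdeal m k w + s * P.dissInt m k w.1) * hc

/-- This is `exists_minimizer` on the space of pairs, with S the scaled strain plus the vacuum
energy, N = M ∫ ξ² and J the normalized kinetic energy. Negativity of λ is what makes the J part
coercive there. -/
theorem isLeast_lowest (hP : P.Admissible) {s : ℝ} (hs : 0 < s) (hneg : P.lowest m k s < 0) :
    IsLeast (P.energyValues m k s) (P.lowest m k s) := by
  rw [energyValues_eq hP]
  have hglb := isGLB_lowest hP m k hs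
  refine ⟨?_, hglb.1⟩
  have hne : ((fun w => P.pairIdeal m k w + s * P.dissInt m k w.1) ''
      P.unitPairs hP m k).Nonempty := by
    rw [← energyValues_eq hP]
    exact nonempty_energyValues hP m k s
  obtain ⟨e, -, -, he, hmem⟩ := hglb.exists_seq_antitone_tendsto hne
  choose v hv hve using hmem
  obtain ⟨κ, M, hκ, hM, hco⟩ := exists_coercive hP
  obtain ⟨C₁, hC₁, hE⟩ := exists_idealInt_add_le hP m k s
  obtain ⟨C₂, hC₂, hN⟩ := exists_integral_sq_zero_le hP one_pos
  -- Half of the absorbing constant, so that N ≤ S/2 + C'J leaves half of S for the bound on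
  -- minimizing sequences.
  obtain ⟨C₃, hC₃, hN'⟩ := exists_integral_sq_zero_le hP
    (δ := s * κ / (2 * M)) (by positivity)
  have hsκ : 0 < s * κ := by positivity
  have hpi : (1 : ℝ) ≤ 2 * Real.pi ^ 2 := by nlinarith [Real.pi_gt_three]
  have hf := fun w : P.pairs hP m k => finEnergy_of_mem_pairs hP w.2
  have hT0 := fun w : P.pairs hP m k => P.strainInt_nonneg m k w.1.1
  have hK0 := fun w : P.pairs hP m k => kinInt_nonneg hP w.1.1
  have hV0 := fun w : P.pairs hP m k => vacInt_nonneg hP m k w.1.2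
  have hI0 : ∀ w : P.pairs hP m k, 0 ≤ ∫ r in (0 : ℝ)..P.r₀, w.1.1 0 r ^ 2 := fun w =>
    intervalIntegral.integral_nonneg hP.r₀_pos.le fun r _ => sq_nonneg _
  set S : P.pairs hP m k → ℝ := fun w => s * κ * P.strainInt m k w.1.1 + P.vacInt m k w.1.2
    with hS
  set J : P.pairs hP m k → ℝ := fun w => 2 * Real.pi ^ 2 * P.kinInt w.1.1 with hJ
  have hKJ : ∀ w, P.kinInt w.1.1 ≤ J w := fun w => le_mul_of_one_le_left (hK0 w) hpi
  have hTS : ∀ w, P.strainInt m k w.1.1 ≤ 1 / (s * κ) * S w := by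
    intro w
    rw [one_div_mul_eq_div, le_div_iff₀ hsκ, hS]
    linarith [hV0 w]
  have hVS : ∀ w, P.vacInt m k w.1.2 ≤ S w := fun w =>
    le_add_of_nonneg_left (mul_nonneg hsκ.le (hT0 w))
  have hS0 : ∀ w, 0 ≤ S w := fun w => add_nonneg (mul_nonneg hsκ.le (hT0 w)) (hV0 w)
  have hJ0 : ∀ w, 0 ≤ J w := fun w => (hK0 w).trans (hKJ w)
  set D := 1 / (s * κ) + 1 with hD
  have hD1 : 1 ≤ D := by
    have : 0 ≤ 1 / (s * κ) := by positivity
    linarith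
  have hnorm : ∀ w : P.pairs hP m k, P.normInt m k w.1.1 ≤ D * (S w + J w) := by
    intro w
    have h1 := hTS w
    have h2 := hKJ w
    have h3 : 0 ≤ 1 / (s * κ) * J w := mul_nonneg (by positivity) (hJ0 w)
    have h4 := hS0 w
    unfold normInt
    rw [hD]
    linarith
  have hNnorm : ∀ w : P.pairs hP m k,
      M * ∫ r in (0 : ℝ)..P.r₀, w.1.1 0 r ^ 2 ≤ M * (1 + C₂) * P.normInt m k w.1.1 := by
    intro w
    have h1 := mul_le_mul_of_nonneg_left (hN m k _ (hf w)) hM.le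
    have h2 : 0 ≤ M * P.kinInt w.1.1 := mul_nonneg hM.le (hK0 w)
    have h3 : 0 ≤ M * C₂ * P.strainInt m k w.1.1 := mul_nonneg (by positivity) (hT0 w)
    unfold normInt
    linarith
  set C := (C₁ + M * (1 + C₂)) * D + 1 with hC
  have hMC : 0 ≤ M * (1 + C₂) := by positivity
  have hSJ0 : ∀ w, 0 ≤ S w + J w := fun w => add_nonneg (hS0 w) (hJ0 w)
  obtain ⟨w, hw1, hw2⟩ := exists_minimizer
    (V := P.pairs hP m k) (E := fun w => P.pairIdeal m k w.1 + s * P.dissInt m k w.1.1)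
    (J := J) (N := fun w => M * ∫ r in (0 : ℝ)..P.r₀, w.1.1 0 r ^ 2) (S := S)
    ((isQuadFun_pairIdeal hP).add ((isQuadFun_pairs_dissInt hP).const_mul s))
    ((isQuadFun_pairs_kinInt hP).const_mul _)
    ((isQuadFun_pairs_integral_sq hP).const_mul _)
    hJ0 (fun w => mul_nonneg hM.le (hI0 w)) hS0 (fun w => hco m k w.1 w.2 s hs)
    (C := C)
    (fun w => by
      have h1 := hE _ (hf w)
      rw [abs_of_pos hs] at h1
      have h2 := hNnorm w
      have h3 := mul_le_mul_of_nonneg_left (hnorm w) (add_nonneg hC₁ hMC)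
      have h4 := hVS w
      have h5 := hJ0 w
      rw [hC]
      simp only [pairIdeal]
      linarith)
    (fun w => by
      have h2 := hNnorm w
      have h3 := mul_le_mul_of_nonneg_left (hnorm w) hMC
      have h4 : 0 ≤ C₁ * (D * (S w + J w)) :=
        mul_nonneg hC₁ (mul_nonneg (by linarith) (hSJ0 w))
      have h5 := hSJ0 w
      rw [hC]
      linarith)
    (C' := M * C₃)
    (fun w => by
      have h1 := mul_le_mul_of_nonneg_left (hN' m k _ (hf w)) hM.le
      have h2 : M * (s * κ / (2 * M) * P.strainInt m k w.1.1 + C₃ * P.kinInt w.1.1)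
          = 1 / 2 * (s * κ * P.strainInt m k w.1.1) + M * C₃ * P.kinInt w.1.1 := by
        field_simp
      have h3 : M * C₃ * P.kinInt w.1.1 ≤ M * C₃ * J w :=
        mul_le_mul_of_nonneg_left (hKJ w) (by positivity)
      have h4 := hV0 w
      simp only [hS]
      linarith)
    (fun u ⟨B, hB⟩ => by
      obtain ⟨φ, hφ, hφlim⟩ := exists_subseq_pairs hP (u := u) (M := D * B)
        (fun n => by
          have h1 := hnorm (u n)
          have h2 := mul_le_mul_of_nonneg_left (hB n) (show 0 ≤ D by linarith)
          have h3 := hK0 (u n)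
          unfold normInt at h1
          linarith)
        (fun n => by
          have h1 := hnorm (u n)
          have h2 := mul_le_mul_of_nonneg_left (hB n) (show 0 ≤ D by linarith)
          have h3 := hT0 (u n)
          unfold normInt at h1
          linarith)
      have h4 := hφlim.const_mul M
      rw [mul_zero] at h4
      exact ⟨φ, hφ, h4⟩)
    (fun u hu => by
      have hu' := hu.const_mul D
      rw [mul_zero] at hu'
      obtain ⟨w, h1, h2⟩ := exists_pairs_tendsto hP u
        (squeeze_zero (fun p => normInt_nonneg hP _) (fun p => hnorm _) hu')
        (squeeze_zero (fun p => hV0 _)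
          (fun p => (hVS (u p.1 - u p.2)).trans (le_add_of_nonneg_right (hJ0 _))) hu)
      refine ⟨w, ?_⟩
      have h3 := ((h1.const_mul (s * κ)).add h2).add (h1.const_mul (2 * Real.pi ^ 2))
      rw [mul_zero, mul_zero, add_zero, add_zero] at h3
      refine squeeze_zero (fun n => hSJ0 _) (fun n => ?_) h3
      have h4 := mul_nonneg hsκ.le (hK0 (u n - w))
      have h5 := mul_nonneg (show 0 ≤ 2 * Real.pi ^ 2 by positivity) (hT0 (u n - w))
      simp only [hS, hJ, normInt]
      linarith)
    hneg (fun w => lowest_mul_kinInt_le hP hs w.2)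
    (u := fun n => ⟨v n, (hv n).1⟩) (fun n => (hv n).2)
    (he.congr fun n => (hve n).symm)
  exact ⟨w.1, ⟨w.2, hw1⟩, hw2⟩

end ZPinch

end

/-- In order: the infima defining `λ_{m,k}(s)` are genuine; the sausage modes with `k ≠ 0` are
unstable; every unstable mode has exactly one growth rate `s_{m,k} = μ_{m,k}(s_{m,k}) > 0`; the
growth rates tend to `0` as `|m| → ∞` or `|k| → ∞`; only finitely many modes have a growth rate
above a given positive threshold; there is a largest growth rate `Λ`, and at a mode that has it
the infimum of the energy is attained. -/
theorem proposition4p3 (P : ZPinch) (hP : P.Admissible) :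
    (∀ (m k : ℤ) (s : ℝ), 0 < s →
      (P.energyValues m k s).Nonempty ∧ BddBelow (P.energyValues m k s)) ∧
    (∀ k : ℤ, k ≠ 0 → (P.negSet 0 k).Nonempty) ∧
    (∀ m k : ℤ, (P.negSet m k).Nonempty → ∃! s : ℝ, P.IsGrowthRate m k s) ∧
    (∀ c : ℝ, 0 < c → ∃ N : ℕ, ∀ (m k : ℤ) (s : ℝ), P.IsGrowthRate m k s →
      ((N : ℤ) ≤ |m| ∨ (N : ℤ) ≤ |k|) → s < c) ∧
    (∀ c : ℝ, 0 < c →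
      {mk : ℤ × ℤ | ∃ s : ℝ, c ≤ s ∧ P.IsGrowthRate mk.1 mk.2 s}.Finite) ∧
    (∃ Λ : ℝ, 0 < Λ ∧ IsGreatest {s : ℝ | ∃ m k : ℤ, P.IsGrowthRate m k s} Λ ∧
      ∃ m k : ℤ, P.IsGrowthRate m k Λ ∧ IsLeast (P.energyValues m k Λ) (-Λ ^ 2)) := by
  refine ⟨fun m k s hs => ⟨ZPinch.nonempty_energyValues hP m k s,
    ZPinch.bddBelow_energyValues hP m k hs⟩, fun k hk => ZPinch.nonempty_negSet hP hk,
    fun m k h => ZPinch.existsUnique_isGrowthRate hP h,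
    fun c hc => ZPinch.exists_isGrowthRate_lt hP hc, fun c hc => ZPinch.finite_modes hP hc, ?_⟩
  obtain ⟨Λ, hΛ, hmax⟩ := ZPinch.exists_isGreatest_growthRate hP
  obtain ⟨m, k, hmk⟩ := hmax.1
  refine ⟨Λ, hΛ, hmax, m, k, hmk, ?_⟩
  rw [← hmk.lowest_eq]
  exact ZPinch.isLeast_lowest hP hΛ hmk.1.2
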